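/- Call a sequence $\lambda=(\lambda_n)$ a frequency if it is a strictly increasing sequence of non-negative real numbers tending to $\infty$, and write $[\operatorname{Re}>0]$ for the open right half-plane. A Dirichlet series $\sum a_n e^{-\lambda_n s}$ is a $\lambda$-Riesz germ of $f\colon[\operatorname{Re}>0]\to\mathbb C$ if there are $m\ge 0$ and $\sigma\in\mathbb R$ such that $$f(s)=\lim_{x\to\infty}\sum_{\lambda_n<x}a_n e^{-\lambda_n s}\Big(1-\frac{\lambda_n}{x}\Big)^m\qquad\text{for all } s\in[\operatorname{Re}>0]\text{ with }\operatorname{Re}s>\sigma .$$ For $\ell\ge 0$ let $H_{\infty,\ell}^\lambda[\operatorname{Re}>0]$ be the space of all holomorphic $f\colon[\operatorname{Re}>0]\to\mathbb C$ that have a $\lambda$-Riesz germ and satisfy $\|f\|_{\infty,\ell}=\sup_{\operatorname{Re}s>0}|f(s)|/(1+|s|)^\ell<\infty$. Let $H_\infty^\lambda[\operatorname{Re}>0]$, with the norm $\|f\|_\infty=\sup_{\operatorname{Re}s>0}|f(s)|$, be the space of all bounded holomorphic $f\colon[\operatorname{Re}>0]\to\mathbb C$ such that $t\mapsto f(\sigma+it)$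 is uniformly almost periodic (in the sense of Bohr) for every $\sigma>0$ and such that the Bohr coefficients $$a_x(f)=\lim_{T\to\infty}\frac1{2T}\int_{-T}^{T}f(\sigma+it)\,e^{(\sigma+it)x}\,dt\qquad(x\in\mathbb R,\ \sigma>0),$$ which do not depend on $\sigma$, vanish for all $x\notin\{\lambda_n\}$. Then for every frequency $\lambda$ $$H_{\infty,0}^\lambda[\operatorname{Re}>0]=H_\infty^\lambda[\operatorname{Re}>0].$$ Moreover, this identity is isometric, $\|f\|_{\infty,0}=\|f\|_\infty$, and coefficient preserving: every $f$ in this space has exactly one $\lambda$-Riesz germ $\sum a_n e^{-\lambda_n s}$, and $a_n=a_{\lambda_n}(f)$ for all $n$. -/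

import Mathlib

open Filter Topology

noncomputable section

/-- A frequency: a strictly increasing sequence of non-negative reals tending to infinity. -/
structure Frequency where
  val : ℕ → ℝ
  strictMono : StrictMono val
  nonneg : ∀ n, 0 ≤ val n
  tendsto : Tendsto val atTop atTop

namespace Frequency

theorem finite_lt (lam : Frequency) (x : ℝ) : {n : ℕ | lam.val n < x}.Finite := by
  have h := lam.tendsto.eventually_ge_atTop x
  rw [← Nat.cofinite_eq_atTop, eventually_cofinite] at h
  simpa using h

/-- The finite set of all indices `n` with `λ n < x`. -/
def below (lam : Frequency) (x : ℝ) : Finset ℕ := (lam.finite_lt x).toFinset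

end Frequency

/-- The open right half-plane `[Re > 0]`. -/
abbrev RightHalfPlane : Type := {s : ℂ // 0 < s.re}

/-- The point `σ + i t` of the vertical line `[Re = σ]`, where `σ > 0`. -/
def linePoint {σ : ℝ} (hσ : 0 < σ) (t : ℝ) : RightHalfPlane :=
  ⟨(σ : ℂ) + (t : ℂ) * Complex.I, by simpa using hσ⟩

/-- Holomorphy of a function on the open right half-plane (extended by `0` to all of `ℂ`, which
does not affect differentiability at the points of this open set). -/
def IsHolomorphic (f : RightHalfPlane → ℂ) : Prop :=
  DifferentiableOn ℂ (Function.extend Subtype.val f 0) {s : ℂ | 0 < s.re}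

/-- The Riesz mean of order `m` of the Dirichlet series `∑ a n * exp (-λ n * s)`. -/
def rieszMean (lam : Frequency) (m : ℝ) (a : ℕ → ℂ) (x : ℝ) (s : ℂ) : ℂ :=
  ∑ n ∈ lam.below x,
    a n * Complex.exp (-(lam.val n : ℂ) * s) * (((1 - lam.val n / x) ^ m : ℝ) : ℂ)

/-- The Dirichlet series `∑ a n * exp (-λ n * s)` is a Riesz germ of `f`: for some order `m ≥ 0`,
its Riesz means converge pointwise to `f` on some half-plane. -/
def IsRieszGerm (lam : Frequency) (a : ℕ → ℂ) (f : RightHalfPlane → ℂ) : Prop :=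
  ∃ m : ℝ, 0 ≤ m ∧ ∃ σ : ℝ, ∀ s : RightHalfPlane, σ < s.val.re →
    Tendsto (fun x : ℝ => rieszMean lam m a x s.val) atTop (𝓝 (f s))

/-- The norm `sup |f s| / (1 + |s|) ^ ℓ` (used for functions where this is finite). -/
def orderNorm (l : ℝ) (f : RightHalfPlane → ℂ) : ℝ :=
  ⨆ s : RightHalfPlane, ‖f s‖ / (1 + ‖s.val‖) ^ l

/-- The sup norm on the right half-plane (used for bounded functions). -/
def supNorm (f : RightHalfPlane → ℂ) : ℝ :=
  ⨆ s : RightHalfPlane, ‖f s‖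

/-- The space of all holomorphic functions on the right half-plane that have a Riesz germ
and have finite norm `orderNorm l`. -/
def HInftyOrder (lam : Frequency) (l : ℝ) : Set (RightHalfPlane → ℂ) :=
  {f | IsHolomorphic f ∧ (∃ a : ℕ → ℂ, IsRieszGerm lam a f) ∧
    BddAbove (Set.range fun s : RightHalfPlane => ‖f s‖ / (1 + ‖s.val‖) ^ l)}

/-- Uniform almost periodicity in the sense of Bohr: `g` is continuous, and for every `ε > 0`
the set of its `ε`-translation numbers is relatively dense. -/
def UniformlyAlmostPeriodic (g : ℝ → ℂ) : Prop :=
  Continuous g ∧ ∀ ε : ℝ, 0 < ε → ∃ L : ℝ, 0 < L ∧ ∀ u : ℝ, ∃ τ ∈ Set.Icc u (u + L),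
    ∀ t : ℝ, ‖g (t + τ) - g t‖ ≤ ε

/-- `c` is the Bohr coefficient of `f` at `x`: on every vertical line `[Re = σ]`, `σ > 0`,
the mean `(1 / 2T) ∫_{-T}^{T} f (σ + i t) exp ((σ + i t) x) dt` tends to `c` as `T → ∞`. -/
def HasBohrCoeff (f : RightHalfPlane → ℂ) (x : ℝ) (c : ℂ) : Prop :=
  ∀ (σ : ℝ) (hσ : 0 < σ),
    Tendsto (fun T : ℝ => (1 / (2 * (T : ℂ))) *
      ∫ t in (-T)..T, f (linePoint hσ t) * Complex.exp ((linePoint hσ t).val * (x : ℂ)))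
      atTop (𝓝 c)

/-- The space of all bounded holomorphic functions on the right half-plane that are uniformly
almost periodic on all vertical lines, with Bohr coefficients vanishing off `{λ n}`. -/
def HInfty (lam : Frequency) : Set (RightHalfPlane → ℂ) :=
  {f | IsHolomorphic f ∧ BddAbove (Set.range fun s : RightHalfPlane => ‖f s‖) ∧
    (∀ (σ : ℝ) (hσ : 0 < σ), UniformlyAlmostPeriodic fun t => f (linePoint hσ t)) ∧
    ∀ x : ℝ, x ∉ Set.range lam.val → HasBohrCoeff f x 0}

end

/-! Both inclusions rest on convolution along vertical lines. If φ is supported in [-1, 1] with φ(0)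
= 1 and K is its Fourier transform, then convolving with K at scale 2π/y multiplies e^{-λs} by
φ(λ/y) (`vconv_exp`). For f in either space the convolution should therefore be the Dirichlet
polynomial ∑_{λ_n < y} a_n φ(λ_n/y) e^{-λ_n s}; since f is bounded, the convolution tends to f as y
→ ∞.

From `HInfty` to a germ, φ is the triangle and K the Fejér kernel, so the polynomial is exactly the
Riesz mean of order 1. It and the convolution are almost periodic on [Re = 1] with equal Bohr
coefficients; Bohr's uniqueness theorem identifies them on that line and the identity theorem on the
half-plane (`exists_isRieszGerm_of_mem_HInfty`). The uniqueness theorem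
(`eq_zero_of_bohrMean_tendsto_zero`) compares g with its Fourier series on [0, P]. If all Bohr
coefficients vanish, the coefficients c_n on [0, P] are uniformly small for large P, so the
autocorrelation ∑ |c_n|² e^{2πinτ/P} has small mean square ∑ |c_n|⁴. At almost periods τ it is
bounded below, and these fill a positive proportion of [0, κP]: a contradiction.

From a germ to `HInfty`, the convolution is identified by passing to the limit in the Riesz means
under the integral. This needs domination: Riesz means bounded at one point grow at most
polynomially along any line further right (`exists_bound_rieszMean_add`), which comes from a
Volterra operator relating the means at s₀ and s₀ + z. The Fejér kernel decays too slowly for this,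
so φ is now a smooth bump. Cauchy's estimate makes the convergence uniform on each line, so f is
almost periodic there and its Bohr coefficients are the a_n, or 0 off the frequency. Uniqueness of
the germ follows from uniqueness of Bohr coefficients. -/

open MeasureTheory
open scoped FourierTransform

noncomputable section

/-! ### Almost periodic functions: uniform continuity, Bochner's criterion, algebra operations -/

namespace UniformlyAlmostPeriodic

variable {g h : ℝ → ℂ}

theorem exists_bound (hg : UniformlyAlmostPeriodic g) : ∃ B : ℝ, 0 < B ∧ ∀ t, ‖g t‖ ≤ B := by
  obtain ⟨L, hL, h⟩ := hg.2 1 one_pos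
  obtain ⟨C, hC⟩ := (isCompact_Icc (a := (0 : ℝ)) (b := L)).exists_bound_of_continuousOn
    hg.1.continuousOn
  refine ⟨max C 0 + 1, by positivity, fun t => ?_⟩
  obtain ⟨τ, hτ, h'⟩ := h (-t)
  have h1 := hC (t + τ) ⟨by linarith [hτ.1], by linarith [hτ.2]⟩
  have h2 := h' t
  have h3 : ‖g t‖ ≤ ‖g (t + τ)‖ + ‖g (t + τ) - g t‖ := by
    have := norm_sub_le (g (t + τ)) (g (t + τ) - g t)
    simpa using this
  linarith [le_max_left C 0]

/-- An almost period carries both points into one fixed compact interval, widened by 1 at each end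
to make room for the second point. -/
theorem uniformContinuous (hg : UniformlyAlmostPeriodic g) : UniformContinuous g := by
  rw [Metric.uniformContinuous_iff]
  intro ε hε
  obtain ⟨L, hL, h⟩ := hg.2 (ε / 4) (by positivity)
  have hc := (isCompact_Icc (a := (-1 : ℝ)) (b := L + 1)).uniformContinuousOn_of_continuous
    hg.1.continuousOn
  rw [Metric.uniformContinuousOn_iff] at hc
  obtain ⟨δ, hδ, hc⟩ := hc (ε / 4) (by positivity)
  refine ⟨min δ 1, by positivity, fun {a b} hab => ?_⟩
  obtain ⟨τ, hτ, h'⟩ := h (-a)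
  rw [Real.dist_eq] at hab
  have hab1 := lt_of_lt_of_le hab (min_le_left _ _)
  have hab2 := abs_lt.1 (lt_of_lt_of_le hab (min_le_right _ _))
  have h1 := hc (a + τ) ⟨by linarith [hτ.1], by linarith [hτ.2]⟩ (b + τ)
    ⟨by linarith [hτ.1], by linarith [hτ.2]⟩ (by rw [Real.dist_eq]; simpa using hab1)
  rw [dist_eq_norm] at h1 ⊢
  have h2 := h' a
  have h3 := h' b
  have e : g a - g b = (g (a + τ) - g (b + τ)) - (g (a + τ) - g a) + (g (b + τ) - g b) := by ring
  rw [e]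
  have := norm_add_le ((g (a + τ) - g (b + τ)) - (g (a + τ) - g a)) (g (b + τ) - g b)
  have := norm_sub_le (g (a + τ) - g (b + τ)) (g (a + τ) - g a)
  linarith

end UniformlyAlmostPeriodic

/-- Bochner's criterion: the translates of `g` have finite nets in the uniform metric. -/
def HasFiniteNets (g : ℝ → ℂ) : Prop :=
  ∀ ε : ℝ, 0 < ε → ∃ F : Finset ℝ, ∀ s : ℝ, ∃ r ∈ F, ∀ t : ℝ, ‖g (t + s) - g (t + r)‖ ≤ ε

theorem UniformlyAlmostPeriodic.hasFiniteNets {g : ℝ → ℂ} (hg : UniformlyAlmostPeriodic g) :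
    HasFiniteNets g := by
  intro ε hε
  obtain ⟨L, hL, h⟩ := hg.2 (ε / 2) (by positivity)
  obtain ⟨δ, hδ, hu⟩ := Metric.uniformContinuous_iff.1 hg.uniformContinuous (ε / 2) (by positivity)
  obtain ⟨F, -, hfin, hF⟩ := (isCompact_Icc (a := (0 : ℝ)) (b := L)).finite_cover_balls hδ
  refine ⟨hfin.toFinset, fun s => ?_⟩
  obtain ⟨τ, hτ, h'⟩ := h (-s)
  have hm : s + τ ∈ Set.Icc 0 L := ⟨by linarith [hτ.1], by linarith [hτ.2]⟩
  obtain ⟨r, hr, hr'⟩ := Set.mem_iUnion₂.1 (hF hm)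
  refine ⟨r, hfin.mem_toFinset.2 hr, fun t => ?_⟩
  have h1 : dist (g (t + (s + τ))) (g (t + r)) < ε / 2 := hu (by
    rw [Metric.mem_ball] at hr'
    simpa using hr')
  rw [dist_eq_norm] at h1
  have h2 := h' (t + s)
  have e : g (t + s) - g (t + r) = (g (t + (s + τ)) - g (t + r)) - (g (t + s + τ) - g (t + s)) := by
    rw [add_assoc]; ring
  rw [e]
  linarith [norm_sub_le (g (t + (s + τ)) - g (t + r)) (g (t + s + τ) - g (t + s))]

/-- If the translate by u + M is close to the one by r, where M bounds the net, then u + M - r is an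
almost period, and it lies in [u, u + 2M]. -/
theorem HasFiniteNets.uniformlyAlmostPeriodic {g : ℝ → ℂ} (h : HasFiniteNets g)
    (hc : Continuous g) : UniformlyAlmostPeriodic g := by
  refine ⟨hc, fun ε hε => ?_⟩
  obtain ⟨F, hF⟩ := h ε hε
  obtain ⟨M, hM⟩ : ∃ M : ℝ, ∀ r ∈ F, |r| ≤ M := by
    obtain ⟨M, hM⟩ := (F.image (fun r => |r|)).bddAbove
    exact ⟨M, fun r hr => hM (by simpa using ⟨r, hr, rfl⟩)⟩
  refine ⟨2 * max M 0 + 1, by positivity, fun u => ?_⟩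
  obtain ⟨r, hr, h'⟩ := hF (u + max M 0)
  have hb := abs_le.1 (hM r hr)
  refine ⟨u + max M 0 - r, ⟨by linarith [le_max_left M 0], by linarith [le_max_left M 0]⟩,
    fun t => ?_⟩
  convert h' (t - r) using 3 <;> ring_nf

/-- Two functions with finite nets have common finite nets. -/
theorem HasFiniteNets.common {g h : ℝ → ℂ} (hg : HasFiniteNets g) (hh : HasFiniteNets h)
    {ε : ℝ} (hε : 0 < ε) : ∃ F : Finset ℝ, ∀ s : ℝ, ∃ r ∈ F,
      ∀ t : ℝ, ‖g (t + s) - g (t + r)‖ ≤ ε ∧ ‖h (t + s) - h (t + r)‖ ≤ ε := by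
  classical
  obtain ⟨F, hF⟩ := hg (ε / 2) (by positivity)
  obtain ⟨G, hG⟩ := hh (ε / 2) (by positivity)
  choose p hpF hp using hF
  choose q hqG hq using hG
  -- Group the translations s by the pair (p s, q s) of net points they receive. The inverse
  -- function picks one representative of each attained pair, and two translations with the same
  -- pair are close for both functions. Its values at unattained pairs are harmless.
  refine ⟨(F ×ˢ G).image (Function.invFun fun s => (p s, q s)), fun s => ?_⟩
  have hrs : (p (Function.invFun (fun s => (p s, q s)) (p s, q s)),
      q (Function.invFun (fun s => (p s, q s)) (p s, q s))) = (p s, q s) :=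
    Function.invFun_eq (f := fun s => (p s, q s)) ⟨s, rfl⟩
  set r := Function.invFun (fun s => (p s, q s)) (p s, q s) with hr
  simp only [Prod.mk.injEq] at hrs
  refine ⟨r, Finset.mem_image.2 ⟨(p s, q s), by simp [hpF, hqG], hr.symm⟩, fun t => ⟨?_, ?_⟩⟩
  · have h1 := hp s t
    have h2 := hp r t
    rw [hrs.1] at h2
    have e : g (t + s) - g (t + r) =
      (g (t + s) - g (t + p s)) - (g (t + r) - g (t + p s)) := by ring
    rw [e]; linarith [norm_sub_le (g (t + s) - g (t + p s)) (g (t + r) - g (t + p s))]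
  · have h1 := hq s t
    have h2 := hq r t
    rw [hrs.2] at h2
    have e : h (t + s) - h (t + r) =
      (h (t + s) - h (t + q s)) - (h (t + r) - h (t + q s)) := by ring
    rw [e]; linarith [norm_sub_le (h (t + s) - h (t + q s)) (h (t + r) - h (t + q s))]

namespace UniformlyAlmostPeriodic

variable {g h : ℝ → ℂ}

theorem exp (ξ : ℝ) :
    UniformlyAlmostPeriodic fun t => Complex.exp (Complex.I * ((ξ * t : ℝ) : ℂ)) := by
  refine ⟨by fun_prop, fun ε hε => ?_⟩
  rcases eq_or_ne ξ 0 with rfl | hξ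
  · exact ⟨1, one_pos, fun u => ⟨u, ⟨le_rfl, by linarith⟩, fun t => by simpa using hε.le⟩⟩
  have hp : 0 < 2 * Real.pi / |ξ| := by positivity
  refine ⟨2 * Real.pi / |ξ|, hp, fun u => ?_⟩
  set p := 2 * Real.pi / |ξ|
  refine ⟨⌈u / p⌉ * p, ⟨?_, ?_⟩, fun t => ?_⟩
  · exact (div_le_iff₀ hp).1 (Int.le_ceil _)
  · have := (Int.ceil_lt_add_one (u / p)).le
    calc (⌈u / p⌉ : ℝ) * p ≤ (u / p + 1) * p := by gcongr
      _ = u + p := by field_simp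
  · have : Complex.exp (Complex.I * ((ξ * (t + ⌈u / p⌉ * p) : ℝ) : ℂ)) =
        Complex.exp (Complex.I * ((ξ * t : ℝ) : ℂ)) := by
      rcases lt_or_gt_of_ne hξ with h | h
      · have e : ξ * (t + ⌈u / p⌉ * p) = ξ * t - ⌈u / p⌉ * (2 * Real.pi) := by
          simp only [p, abs_of_neg h]; field_simp; ring
        rw [e]
        have := Complex.exp_periodic.int_mul (-⌈u / p⌉) (Complex.I * ((ξ * t : ℝ) : ℂ))
        rw [← this]; congr 1; push_cast; ring
      · have e : ξ * (t + ⌈u / p⌉ * p) = ξ * t + ⌈u / p⌉ * (2 * Real.pi) := by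
          simp only [p, abs_of_pos h]; field_simp
        rw [e]
        have := Complex.exp_periodic.int_mul (⌈u / p⌉) (Complex.I * ((ξ * t : ℝ) : ℂ))
        rw [← this]; congr 1; push_cast; ring
    simp only [this]; simpa using hε.le

theorem const (c : ℂ) : UniformlyAlmostPeriodic fun _ => c :=
  ⟨continuous_const, fun ε hε => ⟨1, one_pos, fun u => ⟨u, ⟨le_rfl, by linarith⟩, fun t => by
    simpa using hε.le⟩⟩⟩

theorem add (hg : UniformlyAlmostPeriodic g) (hh : UniformlyAlmostPeriodic h) :
    UniformlyAlmostPeriodic fun t => g t + h t := by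
  refine HasFiniteNets.uniformlyAlmostPeriodic (fun ε hε => ?_) (hg.1.add hh.1)
  obtain ⟨F, hF⟩ := hg.hasFiniteNets.common hh.hasFiniteNets (half_pos hε)
  refine ⟨F, fun s => ?_⟩
  obtain ⟨r, hr, h'⟩ := hF s
  refine ⟨r, hr, fun t => ?_⟩
  obtain ⟨h1, h2⟩ := h' t
  rw [add_sub_add_comm]
  linarith [norm_add_le (g (t + s) - g (t + r)) (h (t + s) - h (t + r))]

theorem mul (hg : UniformlyAlmostPeriodic g) (hh : UniformlyAlmostPeriodic h) :
    UniformlyAlmostPeriodic fun t => g t * h t := by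
  refine HasFiniteNets.uniformlyAlmostPeriodic (fun ε hε => ?_) (hg.1.mul hh.1)
  obtain ⟨B, hB, hB'⟩ := hg.exists_bound
  obtain ⟨C, hC, hC'⟩ := hh.exists_bound
  obtain ⟨F, hF⟩ := hg.hasFiniteNets.common hh.hasFiniteNets (ε := ε / (B + C)) (by positivity)
  refine ⟨F, fun s => ?_⟩
  obtain ⟨r, hr, h'⟩ := hF s
  refine ⟨r, hr, fun t => ?_⟩
  obtain ⟨h1, h2⟩ := h' t
  have e : g (t + s) * h (t + s) - g (t + r) * h (t + r) =
    (g (t + s) - g (t + r)) * h (t + s) + g (t + r) * (h (t + s) - h (t + r)) := by ring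
  rw [e]
  calc _ ≤ ‖g (t + s) - g (t + r)‖ * ‖h (t + s)‖ + ‖g (t + r)‖ * ‖h (t + s) - h (t + r)‖ := by
        rw [← norm_mul, ← norm_mul]; exact norm_add_le _ _
    _ ≤ ε / (B + C) * C + B * (ε / (B + C)) := by
        gcongr
        · exact hC' _
        · exact hB' _
    _ = ε := by field_simp; ring

theorem const_mul (c : ℂ) (hg : UniformlyAlmostPeriodic g) :
    UniformlyAlmostPeriodic fun t => c * g t := (const c).mul hg

theorem sum {ι : Type*} (S : Finset ι) (G : ι → ℝ → ℂ)
    (hG : ∀ i ∈ S, UniformlyAlmostPeriodic (G i)) :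
    UniformlyAlmostPeriodic fun t => ∑ i ∈ S, G i t := by
  classical
  induction S using Finset.induction_on with
  | empty => simpa using const 0
  | insert a S ha ih =>
    simp only [Finset.sum_insert ha]
    exact (hG a (by simp)).add (ih fun i hi => hG i (by simp [hi]))

theorem sub (hg : UniformlyAlmostPeriodic g) (hh : UniformlyAlmostPeriodic h) :
    UniformlyAlmostPeriodic fun t => g t - h t := by
  simpa [sub_eq_add_neg] using hg.add (hh.const_mul (-1))

theorem of_uniform_approx (hc : Continuous g)
    (H : ∀ ε : ℝ, 0 < ε → ∃ p, UniformlyAlmostPeriodic p ∧ ∀ t, ‖g t - p t‖ ≤ ε) :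
    UniformlyAlmostPeriodic g := by
  refine ⟨hc, fun ε hε => ?_⟩
  obtain ⟨p, hp, hp'⟩ := H (ε / 3) (by positivity)
  obtain ⟨L, hL, h⟩ := hp.2 (ε / 3) (by positivity)
  refine ⟨L, hL, fun u => ?_⟩
  obtain ⟨τ, hτ, h'⟩ := h u
  refine ⟨τ, hτ, fun t => ?_⟩
  have e : g (t + τ) - g t = (g (t + τ) - p (t + τ)) - (g t - p t) + (p (t + τ) - p t) := by ring
  rw [e]
  linarith [norm_add_le ((g (t + τ) - p (t + τ)) - (g t - p t)) (p (t + τ) - p t),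
    norm_sub_le (g (t + τ) - p (t + τ)) (g t - p t), h' t, hp' t, hp' (t + τ)]

end UniformlyAlmostPeriodic

/-! ### Integrals over windows -/

/-- Replacing a bounded function by its moving averages changes its integrals little. -/
theorem norm_integral_sub_average_le {E : Type*} [NormedAddCommGroup E] [NormedSpace ℝ E]
    [CompleteSpace E]
    {G : ℝ → E} (hG : Continuous G) {B : ℝ} (hB : ∀ t, ‖G t‖ ≤ B) {W : ℝ} (hW : 0 < W)
    (a b : ℝ) :
    ‖(∫ t in a..b, G t) - W⁻¹ • ∫ t in a..b, ∫ v in t..(t + W), G v‖ ≤ W * B := by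
  have hB0 : 0 ≤ B := (norm_nonneg _).trans (hB 0)
  have e1 : ∀ t, ∫ v in t..(t + W), G v = ∫ v in (0 : ℝ)..W, G (t + v) := fun t => by
    rw [intervalIntegral.integral_comp_add_left]; simp
  have e2 : ∫ t in a..b, ∫ v in t..(t + W), G v =
      ∫ v in (0 : ℝ)..W, ∫ t in a..b, G (t + v) := by
    simp_rw [e1]
    refine intervalIntegral_intervalIntegral_swap (F := fun t v => G (t + v)) ?_
    have : Continuous (Function.uncurry fun t v => G (t + v)) := by
      simp only [Function.uncurry_def]; fun_prop
    exact (this.continuousOn.integrableOn_compact (isCompact_uIcc.prod isCompact_uIcc)).mono_set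
      (Set.prod_mono Set.uIoc_subset_uIcc Set.uIoc_subset_uIcc)
  have hcont : Continuous fun v => ∫ t in a..b, G (t + v) :=
    intervalIntegral.continuous_parametric_intervalIntegral_of_continuous' (by
      simp only [Function.uncurry_def]; fun_prop) a b
  have e3 : (∫ t in a..b, G t) - W⁻¹ • ∫ t in a..b, ∫ v in t..(t + W), G v =
      W⁻¹ • ∫ v in (0 : ℝ)..W, ((∫ t in a..b, G t) - ∫ t in a..b, G (t + v)) := by
    rw [e2, intervalIntegral.integral_sub (by simp) (hcont.intervalIntegrable _ _), smul_sub]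
    rw [intervalIntegral.integral_const, sub_zero, smul_smul, inv_mul_cancel₀ hW.ne', one_smul]
  -- Translation by v exchanges two end pieces of length v. Averaging the bound 2Bv over 0 < v ≤ W
  -- gives WB.
  have key : ∀ v ∈ Set.uIoc 0 W, ‖(∫ t in a..b, G t) - ∫ t in a..b, G (t + v)‖ ≤ 2 * B * v := by
    intro v hv
    rw [Set.uIoc_of_le hW.le] at hv
    have e : (∫ t in a..b, G t) - ∫ t in a..b, G (t + v) =
        (∫ t in a..(a + v), G t) - ∫ t in b..(b + v), G t := by
      rw [intervalIntegral.integral_comp_add_right]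
      exact intervalIntegral.integral_interval_sub_interval_comm
        (hG.intervalIntegrable _ _) (hG.intervalIntegrable _ _) (hG.intervalIntegrable _ _)
    rw [e]
    have h1 := intervalIntegral.norm_integral_le_of_norm_le_const (a := a) (b := a + v)
      (f := G) (C := B) fun t _ => hB t
    have h2 := intervalIntegral.norm_integral_le_of_norm_le_const (a := b) (b := b + v)
      (f := G) (C := B) fun t _ => hB t
    rw [add_sub_cancel_left, abs_of_pos hv.1] at h1 h2
    linarith [norm_sub_le (∫ t in a..(a + v), G t) (∫ t in b..(b + v), G t)]
  rw [e3, norm_smul, norm_inv, Real.norm_of_nonneg hW.le]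
  have : ‖∫ v in (0 : ℝ)..W, ((∫ t in a..b, G t) - ∫ t in a..b, G (t + v))‖ ≤
      |∫ v in (0 : ℝ)..W, 2 * B * v| := by
    refine intervalIntegral.norm_integral_le_abs_of_norm_le ?_
      ((by fun_prop : Continuous fun v : ℝ => 2 * B * v).intervalIntegrable _ _)
    exact (ae_restrict_iff' measurableSet_uIoc).2 (Eventually.of_forall key)
  have hval : ∫ v in (0 : ℝ)..W, 2 * B * v = B * W ^ 2 := by
    rw [intervalIntegral.integral_const_mul, integral_id]; ring
  rw [hval, abs_of_nonneg (by positivity)] at this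
  calc W⁻¹ * _ ≤ W⁻¹ * (B * W ^ 2) := by gcongr
    _ = W * B := by field_simp

/-- Moving averages over windows of length W are at most δ in norm, and replacing G by them costs W
* B, whatever the length of [a, b]. -/
theorem norm_integral_le_of_windows {E : Type*} [NormedAddCommGroup E] [NormedSpace ℝ E]
    [CompleteSpace E]
    {G : ℝ → E} (hG : Continuous G) {B : ℝ} (hB : ∀ t, ‖G t‖ ≤ B) {W δ : ℝ} (hW : 0 < W)
    (hδ : ∀ u, ‖∫ v in u..(u + W), G v‖ ≤ δ * W) {a b : ℝ} (hab : a ≤ b) :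
    ‖∫ t in a..b, G t‖ ≤ δ * (b - a) + W * B := by
  have h1 := norm_integral_sub_average_le hG hB hW a b
  have h2 := intervalIntegral.norm_integral_le_of_norm_le_const (a := a) (b := b)
    (f := fun t => ∫ v in t..(t + W), G v) (C := δ * W) fun t _ => hδ t
  rw [abs_of_nonneg (sub_nonneg.2 hab)] at h2
  have h3 : ‖W⁻¹ • ∫ t in a..b, ∫ v in t..(t + W), G v‖ ≤ δ * (b - a) := by
    rw [norm_smul, norm_inv, Real.norm_of_nonneg hW.le]
    calc W⁻¹ * _ ≤ W⁻¹ * (δ * W * (b - a)) := by gcongr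
      _ = δ * (b - a) := by field_simp
  have := norm_add_le ((∫ t in a..b, G t) - W⁻¹ • ∫ t in a..b, ∫ v in t..(t + W), G v)
    (W⁻¹ • ∫ t in a..b, ∫ v in t..(t + W), G v)
  rw [sub_add_cancel] at this
  linarith

theorem norm_integral_window_sub_le {G : ℝ → ℂ} (hG : Continuous G) {B : ℝ}
    (hB : ∀ t, ‖G t‖ ≤ B) (u u' W : ℝ) :
    ‖(∫ t in u..(u + W), G t) - ∫ t in u'..(u' + W), G t‖ ≤ 2 * |u - u'| * B := by
  have e : (∫ t in u..(u + W), G t) - ∫ t in u'..(u' + W), G t =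
      (∫ t in u..u', G t) - ∫ t in (u + W)..(u' + W), G t :=
    intervalIntegral.integral_interval_sub_interval_comm
        (hG.intervalIntegrable _ _) (hG.intervalIntegrable _ _) (hG.intervalIntegrable _ _)
  rw [e]
  have h1 := intervalIntegral.norm_integral_le_of_norm_le_const (a := u) (b := u')
      (f := G) (C := B) fun t _ => hB t
  have h2 := intervalIntegral.norm_integral_le_of_norm_le_const (a := u + W) (b := u' + W)
      (f := G) (C := B) fun t _ => hB t
  rw [add_sub_add_right_eq_sub] at h2
  rw [abs_sub_comm] at h1 h2
  linarith [norm_sub_le (∫ t in u..u', G t) (∫ t in (u + W)..(u' + W), G t)]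

/-! ### Bohr means: existence and behaviour under convolution -/

/-- The symmetric mean value of `g` over `[-T, T]`. -/
def bohrMean (g : ℝ → ℂ) (T : ℝ) : ℂ := (1 / (2 * (T : ℂ))) * ∫ t in (-T)..T, g t

theorem norm_bohrMean (g : ℝ → ℂ) {T : ℝ} (hT : 0 < T) :
    ‖bohrMean g T‖ = ‖∫ t in (-T)..T, g t‖ / (2 * T) := by
  rw [bohrMean, norm_mul, norm_div, norm_mul, Complex.norm_real, Real.norm_of_nonneg hT.le]
  simp; ring

theorem bohrMean_sub {g h : ℝ → ℂ} (hg : Continuous g) (hh : Continuous h) (T : ℝ) :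
    bohrMean (fun t => g t - h t) T = bohrMean g T - bohrMean h T := by
  rw [bohrMean, intervalIntegral.integral_sub (hg.intervalIntegrable _ _)
    (hh.intervalIntegrable _ _), mul_sub]; rfl

theorem bohrMean_const_mul (c : ℂ) (g : ℝ → ℂ) (T : ℝ) :
    bohrMean (fun t => c * g t) T = c * bohrMean g T := by
  rw [bohrMean, intervalIntegral.integral_const_mul, bohrMean]; ring

theorem bohrMean_sum {ι : Type*} (S : Finset ι) {G : ι → ℝ → ℂ}
    (hG : ∀ i ∈ S, Continuous (G i)) (T : ℝ) :
    bohrMean (fun t => ∑ i ∈ S, G i t) T = ∑ i ∈ S, bohrMean (G i) T := by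
  rw [bohrMean, intervalIntegral.integral_finsetSum fun i hi => (hG i hi).intervalIntegrable _ _,
    Finset.mul_sum]; rfl

theorem bohrMean_const (c : ℂ) {T : ℝ} (hT : T ≠ 0) : bohrMean (fun _ => c) T = c := by
  have : (T : ℂ) ≠ 0 := by exact_mod_cast hT
  simp [bohrMean]; field_simp; ring

theorem norm_bohrMean_le {g : ℝ → ℂ} {B : ℝ} (hB : ∀ t, ‖g t‖ ≤ B) {T : ℝ} (hT : 0 < T) :
    ‖bohrMean g T‖ ≤ B := by
  rw [norm_bohrMean g hT, div_le_iff₀ (by positivity)]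
  have := intervalIntegral.norm_integral_le_of_norm_le_const (a := -T) (b := T)
      (f := g) (C := B) fun t _ => hB t
  rwa [sub_neg_eq_add, abs_of_pos (by positivity), ← two_mul] at this

theorem tendsto_bohrMean_exp (ξ : ℝ) :
    Tendsto (bohrMean fun t => Complex.exp (Complex.I * ((ξ * t : ℝ) : ℂ))) atTop
      (𝓝 (if ξ = 0 then 1 else 0)) := by
  split_ifs with h
  · subst h
    refine tendsto_const_nhds.congr' ?_
    filter_upwards [eventually_gt_atTop 0] with T hT
    simpa using (bohrMean_const 1 hT.ne').symm
  · rw [tendsto_zero_iff_norm_tendsto_zero]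
    have h0 : Tendsto (fun T : ℝ => |ξ|⁻¹ / T) atTop (𝓝 0) := tendsto_const_nhds.div_atTop tendsto_id
    refine squeeze_zero' (Eventually.of_forall fun _ => norm_nonneg _) ?_ h0
    filter_upwards [eventually_gt_atTop 0] with T hT
    rw [norm_bohrMean _ hT]
    have hc : Complex.I * ξ ≠ 0 := mul_ne_zero Complex.I_ne_zero (by exact_mod_cast h)
    have e : ∀ t : ℝ, Complex.exp (Complex.I * ((ξ * t : ℝ) : ℂ)) =
        Complex.exp (Complex.I * ξ * t) := fun t => by push_cast; ring_nf
    simp_rw [e]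
    rw [integral_exp_mul_complex hc, norm_div, norm_mul, Complex.norm_I, one_mul,
      Complex.norm_real, Real.norm_eq_abs]
    have n1 : ∀ t : ℝ, ‖Complex.exp (Complex.I * ξ * t)‖ = 1 := fun t => by
      rw [← e, mul_comm]; exact Complex.norm_exp_ofReal_mul_I _
    have := norm_sub_le (Complex.exp (Complex.I * ξ * (T : ℝ)))
      (Complex.exp (Complex.I * ξ * ((-T : ℝ) : ℂ)))
    rw [n1, n1] at this
    have hx : 0 < |ξ| := abs_pos.2 h
    rw [div_div, inv_eq_one_div, div_div, div_le_div_iff₀ (by positivity) (by positivity)]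
    nlinarith [mul_pos hx hT]

theorem tendsto_bohrMean_of_uniform_approx {g : ℝ → ℂ} (hg : Continuous g) {c : ℂ}
    (H : ∀ ε : ℝ, 0 < ε → ∃ p : ℝ → ℂ, ∃ d : ℂ, Continuous p ∧ (∀ t, ‖g t - p t‖ ≤ ε) ∧
      Tendsto (bohrMean p) atTop (𝓝 d) ∧ ‖d - c‖ ≤ ε) :
    Tendsto (bohrMean g) atTop (𝓝 c) := by
  rw [Metric.tendsto_nhds]
  intro ε hε
  obtain ⟨p, d, hp, hgp, hd, hdc⟩ := H (ε / 4) (by positivity)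
  filter_upwards [eventually_gt_atTop 0, Metric.tendsto_nhds.1 hd (ε / 4) (by positivity)]
    with T hT h
  rw [dist_eq_norm] at h ⊢
  have h1 := norm_bohrMean_le (g := fun t => g t - p t) hgp hT
  rw [bohrMean_sub hg hp] at h1
  have e : bohrMean g T - c = (bohrMean g T - bohrMean p T) + (bohrMean p T - d) + (d - c) := by
    ring
  rw [e]
  linarith [norm_add₃_le (a := bohrMean g T - bohrMean p T) (b := bohrMean p T - d) (c := d - c)]

namespace UniformlyAlmostPeriodic

variable {g : ℝ → ℂ}

/-- Windows of the same length have nearly the same means. -/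
theorem norm_integral_window_sub_le (hg : UniformlyAlmostPeriodic g) {B : ℝ}
    (hB : ∀ t, ‖g t‖ ≤ B) {δ : ℝ} (hδ : 0 < δ) : ∃ L : ℝ, 0 < L ∧ ∀ u v W : ℝ, 0 < W →
      ‖(∫ t in u..(u + W), g t) - ∫ t in v..(v + W), g t‖ ≤ δ * W + 2 * L * B := by
  obtain ⟨L, hL, h⟩ := hg.2 δ hδ
  have hB0 : 0 ≤ B := (norm_nonneg _).trans (hB 0)
  refine ⟨L, hL, fun u v W hW => ?_⟩
  obtain ⟨τ, hτ, h'⟩ := h (u - v)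
  have h1 := _root_.norm_integral_window_sub_le hg.1 hB u (v + τ) W
  have h2 : (∫ t in (v + τ)..(v + τ + W), g t) = ∫ t in v..(v + W), g (t + τ) := by
    rw [intervalIntegral.integral_comp_add_right]; ring_nf
  have h3 := intervalIntegral.norm_integral_le_of_norm_le_const (a := v) (b := v + W)
      (f := fun t => g (t + τ) - g t) (C := δ) fun t _ => h' t
  have hgc := hg.1
  rw [intervalIntegral.integral_sub ((by fun_prop : Continuous fun t => g (t + τ)).intervalIntegrable
    _ _) (hgc.intervalIntegrable _ _), ← h2, add_sub_cancel_left, abs_of_pos hW] at h3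
  have h4 : |u - (v + τ)| ≤ L := abs_le.2 ⟨by linarith [hτ.2], by linarith [hτ.1]⟩
  have h5 : 2 * |u - (v + τ)| * B ≤ 2 * L * B := by gcongr
  have := norm_add_le ((∫ t in u..(u + W), g t) - ∫ t in (v + τ)..(v + τ + W), g t)
    ((∫ t in (v + τ)..(v + τ + W), g t) - ∫ t in v..(v + W), g t)
  rw [sub_add_sub_cancel] at this
  linarith

/-- Only almost periods of g are used: translation by τ multiplies the exponential by a constant of
modulus 1, which the norm ignores. Hence L does not depend on ξ, which later gives smallness uniform
in the frequency. -/
theorem norm_integral_window_mul_exp_le (hg : UniformlyAlmostPeriodic g) {B : ℝ}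
    (hB : ∀ t, ‖g t‖ ≤ B) {δ : ℝ} (hδ : 0 < δ) : ∃ L : ℝ, 0 < L ∧ ∀ ξ u v W : ℝ, 0 < W →
      ‖∫ t in u..(u + W), g t * Complex.exp (Complex.I * ((ξ * t : ℝ) : ℂ))‖ ≤
      ‖∫ t in v..(v + W), g t * Complex.exp (Complex.I * ((ξ * t : ℝ) : ℂ))‖ +
        δ * W + 2 * L * B := by
  obtain ⟨L, hL, h⟩ := hg.2 δ hδ
  have hB0 : 0 ≤ B := (norm_nonneg _).trans (hB 0)
  refine ⟨L, hL, fun ξ u v W hW => ?_⟩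
  obtain ⟨τ, hτ, h'⟩ := h (u - v)
  have hn : ∀ t : ℝ, ‖Complex.exp (Complex.I * ((ξ * t : ℝ) : ℂ))‖ = 1 := fun t => by
    rw [mul_comm]; exact Complex.norm_exp_ofReal_mul_I _
  have hgc := hg.1
  have hc : Continuous fun t => g t * Complex.exp (Complex.I * ((ξ * t : ℝ) : ℂ)) := by fun_prop
  have h1 := _root_.norm_integral_window_sub_le hc (B := B)
    (fun t => by rw [norm_mul, hn, mul_one]; exact hB t) u (v + τ) W
  have h2 : (∫ t in (v + τ)..(v + τ + W), g t * Complex.exp (Complex.I * ((ξ * t : ℝ) : ℂ))) =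
      Complex.exp (Complex.I * ((ξ * τ : ℝ) : ℂ)) *
      ∫ t in v..(v + W), g (t + τ) * Complex.exp (Complex.I * ((ξ * t : ℝ) : ℂ)) := by
    rw [← intervalIntegral.integral_const_mul, show v + τ + W = v + W + τ by ring,
      ← intervalIntegral.integral_comp_add_right]
    refine intervalIntegral.integral_congr fun t _ => ?_
    rw [mul_left_comm, ← Complex.exp_add]
    congr 2; push_cast; ring
  have h3 := intervalIntegral.norm_integral_le_of_norm_le_const (a := v) (b := v + W)
      (f := fun t => g (t + τ) * Complex.exp (Complex.I * ((ξ * t : ℝ) : ℂ)) -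
        g t * Complex.exp (Complex.I * ((ξ * t : ℝ) : ℂ))) (C := δ)
      fun t _ => by rw [← sub_mul, norm_mul, hn, mul_one]; exact h' t
  rw [intervalIntegral.integral_sub ((by fun_prop : Continuous fun t : ℝ =>
    g (t + τ) * Complex.exp (Complex.I * ((ξ * t : ℝ) : ℂ))).intervalIntegrable
    _ _) (hc.intervalIntegrable _ _), add_sub_cancel_left, abs_of_pos hW] at h3
  have h2' := congrArg norm h2
  rw [norm_mul, hn, one_mul] at h2'
  have h4 : |u - (v + τ)| ≤ L := abs_le.2 ⟨by linarith [hτ.2], by linarith [hτ.1]⟩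
  have h5 : 2 * |u - (v + τ)| * B ≤ 2 * L * B := by gcongr
  have h6 := norm_le_norm_add_norm_sub
    (∫ t in (v + τ)..(v + τ + W), g t * Complex.exp (Complex.I * ((ξ * t : ℝ) : ℂ)))
    (∫ t in u..(u + W), g t * Complex.exp (Complex.I * ((ξ * t : ℝ) : ℂ)))
  have h7 := norm_le_norm_add_norm_sub
    (∫ t in v..(v + W), g t * Complex.exp (Complex.I * ((ξ * t : ℝ) : ℂ)))
    (∫ t in v..(v + W), g (t + τ) * Complex.exp (Complex.I * ((ξ * t : ℝ) : ℂ)))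
  rw [norm_sub_rev] at h6 h7
  rw [← h2'] at h7
  linarith

theorem exists_mean (hg : UniformlyAlmostPeriodic g) :
    ∃ c : ℂ, Tendsto (bohrMean g) atTop (𝓝 c) := by
  obtain ⟨B, hB, hB'⟩ := hg.exists_bound
  refine cauchy_map_iff_exists_tendsto.1 (Metric.cauchy_iff.2 ⟨inferInstance, fun ε hε => ?_⟩)
  set δ := ε / 16 with hδ
  have hδ0 : 0 < δ := by positivity
  obtain ⟨L, hL, hw⟩ := hg.norm_integral_window_sub_le hB' hδ0
  -- With this length the error 2LB equals δW, so every window mean is within 2δ of the mean c of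
  -- the window at 0.
  set W := 2 * L * B / δ with hWdef
  have hW : 0 < W := by positivity
  set c : ℂ := (W : ℂ)⁻¹ * ∫ t in (0 : ℝ)..(0 + W), g t with hc
  have hcB : ‖c‖ ≤ B := by
    have := intervalIntegral.norm_integral_le_of_norm_le_const (a := 0) (b := 0 + W)
      (f := g) (C := B) fun t _ => hB' t
    rw [hc, norm_mul, norm_inv, Complex.norm_real, Real.norm_of_nonneg hW.le]
    rw [add_sub_cancel_left, abs_of_pos hW] at this
    calc W⁻¹ * _ ≤ W⁻¹ * (B * W) := by gcongr
      _ = B := by field_simp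
  have hwin : ∀ u, ‖∫ t in u..(u + W), (g t - c)‖ ≤ 2 * δ * W := by
    intro u
    rw [intervalIntegral.integral_sub (hg.1.intervalIntegrable _ _) (by simp)]
    have e : ∫ _ in u..(u + W), c = ∫ t in (0 : ℝ)..(0 + W), g t := by
      rw [intervalIntegral.integral_const, add_sub_cancel_left, hc, Complex.real_smul, ← mul_assoc,
        mul_inv_cancel₀ (by exact_mod_cast hW.ne'), one_mul]
    rw [e]
    have := hw u 0 W hW
    have e2 : 2 * L * B = δ * W := by rw [hWdef]; field_simp
    linarith
  have hmain : ∀ T, W * (2 * B) / δ < T → ‖bohrMean g T - c‖ ≤ 4 * δ := by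
    intro T hT
    have hT0 : 0 < T := lt_trans (by positivity) hT
    rw [← bohrMean_const c hT0.ne', ← bohrMean_sub hg.1 continuous_const, norm_bohrMean _ hT0,
      div_le_iff₀ (by positivity)]
    have h1 := norm_integral_le_of_windows (G := fun t => g t - c) (B := 2 * B)
      (hg.1.sub continuous_const) (fun t => by linarith [norm_sub_le (g t) c, hB' t])
      hW hwin (a := -T) (b := T) (by linarith)
    have h2 : W * (2 * B) ≤ δ * T := by
      rw [div_lt_iff₀ hδ0] at hT; linarith
    nlinarith
  refine ⟨bohrMean g '' Set.Ioi (W * (2 * B) / δ), image_mem_map (Ioi_mem_atTop _), ?_⟩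
  rintro _ ⟨S, hS, rfl⟩ _ ⟨T, hT, rfl⟩
  rw [dist_eq_norm]
  have e : bohrMean g S - bohrMean g T = (bohrMean g S - c) - (bohrMean g T - c) := by ring
  rw [e]
  linarith [norm_sub_le (bohrMean g S - c) (bohrMean g T - c), hmain S hS, hmain T hT]

/-- Convolution with an integrable kernel preserves almost periodicity. -/
theorem conv (hg : UniformlyAlmostPeriodic g) {K : ℝ → ℂ} (hK : Integrable K) (q : ℝ) :
    UniformlyAlmostPeriodic fun t => ∫ w, g (t - q * w) * K w := by
  obtain ⟨B, hB, hB'⟩ := hg.exists_bound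
  have hgc := hg.1
  have hi : ∀ t, Integrable fun w => g (t - q * w) * K w := fun t =>
    hK.bdd_mul (c := B) (by fun_prop) (Eventually.of_forall fun w => hB' _)
  refine ⟨?_, fun ε hε => ?_⟩
  · refine continuous_of_dominated (bound := fun w => B * ‖K w‖)
      (fun t => (hi t).aestronglyMeasurable) (fun t => Eventually.of_forall fun w => ?_)
      (hK.norm.const_mul B) (Eventually.of_forall fun w => by fun_prop)
    rw [norm_mul]; gcongr; exact hB' _
  · set N := ∫ w, ‖K w‖ with hN
    have hN0 : 0 ≤ N := integral_nonneg fun w => norm_nonneg _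
    obtain ⟨L, hL, h⟩ := hg.2 (ε / (N + 1)) (by positivity)
    refine ⟨L, hL, fun u => ?_⟩
    obtain ⟨τ, hτ, h'⟩ := h u
    refine ⟨τ, hτ, fun t => ?_⟩
    rw [← integral_sub (hi _) (hi _)]
    calc _ ≤ ∫ w, ε / (N + 1) * ‖K w‖ := by
          refine norm_integral_le_of_norm_le (hK.norm.const_mul _)
            (Eventually.of_forall fun w => ?_)
          rw [← sub_mul, norm_mul]
          gcongr
          have := h' (t - q * w)
          rwa [show t - q * w + τ = t + τ - q * w by ring] at this
      _ = ε / (N + 1) * N := by rw [integral_const_mul]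
      _ ≤ ε := by
        rw [div_mul_eq_mul_div, div_le_iff₀ (by positivity)]; nlinarith

/-- The Bohr coefficients of a convolution are products. -/
theorem tendsto_bohrMean_conv (hg : UniformlyAlmostPeriodic g) {K : ℝ → ℂ} (hK : Integrable K)
    (q ξ : ℝ) {c : ℂ} (hc : Tendsto
      (bohrMean fun t => g t * Complex.exp (Complex.I * ((ξ * t : ℝ) : ℂ))) atTop (𝓝 c)) :
    Tendsto (bohrMean fun t => (∫ w, g (t - q * w) * K w) *
      Complex.exp (Complex.I * ((ξ * t : ℝ) : ℂ))) atTop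
      (𝓝 (c * ∫ w, Complex.exp (Complex.I * ((ξ * (q * w) : ℝ) : ℂ)) * K w)) := by
  obtain ⟨B, hB, hB'⟩ := hg.exists_bound
  have hgc := hg.1
  have hn : ∀ t : ℝ, ‖Complex.exp (Complex.I * ((ξ * t : ℝ) : ℂ))‖ = 1 := fun t => by
    rw [mul_comm]; exact Complex.norm_exp_ofReal_mul_I _
  set G : ℝ → ℂ := fun t => g t * Complex.exp (Complex.I * ((ξ * t : ℝ) : ℂ)) with hG
  have hGc : Continuous G := by fun_prop
  have hGB : ∀ t, ‖G t‖ ≤ B := fun t => by rw [hG]; simp only; rw [norm_mul, hn, mul_one]; exact hB' t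
  set J : ℝ → ℂ := fun w => Complex.exp (Complex.I * ((ξ * (q * w) : ℝ) : ℂ)) * K w with hJ
  have hJi : Integrable J := hK.bdd_mul (c := 1) (by fun_prop)
    (Eventually.of_forall fun w => (hn _).le)
  have e1 : ∀ t w, g (t - q * w) * K w * Complex.exp (Complex.I * ((ξ * t : ℝ) : ℂ)) =
      G (t - q * w) * J w := by
    intro t w
    have : Complex.exp (Complex.I * ((ξ * t : ℝ) : ℂ)) =
        Complex.exp (Complex.I * ((ξ * (t - q * w) : ℝ) : ℂ)) *
        Complex.exp (Complex.I * ((ξ * (q * w) : ℝ) : ℂ)) := by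
      rw [← Complex.exp_add]; congr 1; push_cast; ring
    rw [this, hG, hJ]; ring
  have e2 : ∀ T : ℝ, bohrMean (fun t => (∫ w, g (t - q * w) * K w) *
      Complex.exp (Complex.I * ((ξ * t : ℝ) : ℂ))) T =
      ∫ w, bohrMean (fun t => G (t - q * w)) T * J w := by
    intro T
    simp_rw [bohrMean, ← integral_mul_const, e1]
    rw [intervalIntegral_integral_swap, ← integral_const_mul]
    · refine integral_congr_ae (Eventually.of_forall fun w => ?_)
      simp only
      rw [intervalIntegral.integral_mul_const]; ring
    · have : IsFiniteMeasure (volume.restrict (Set.uIoc (-T) T)) := ⟨by simp [Set.uIoc]⟩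
      have : Integrable (Function.uncurry fun (_ : ℝ) w => J w)
          ((volume.restrict (Set.uIoc (-T) T)).prod volume) := by
        have := (integrable_const (μ := volume.restrict (Set.uIoc (-T) T)) (1 : ℂ)).mul_prod hJi
        simpa [Function.uncurry_def] using this
      exact this.bdd_mul (c := B) (f := fun p : ℝ × ℝ => G (p.1 - q * p.2))
        (by fun_prop) (Eventually.of_forall fun p => hGB _)
  simp_rw [funext e2]
  rw [← integral_const_mul]
  refine tendsto_integral_filter_of_dominated_convergence (fun w => B * ‖J w‖) ?_ ?_
    (hJi.norm.const_mul B) ?_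
  · refine Eventually.of_forall fun T => ?_
    refine Continuous.aestronglyMeasurable ?_ |>.mul hJi.aestronglyMeasurable
    refine continuous_const.mul (intervalIntegral.continuous_parametric_intervalIntegral_of_continuous'
      (by simp only [Function.uncurry_def]; fun_prop) _ _)
  · filter_upwards [eventually_gt_atTop 0] with T hT
    refine Eventually.of_forall fun w => ?_
    rw [norm_mul]; gcongr; exact norm_bohrMean_le (fun t => hGB _) hT
  · refine Eventually.of_forall fun w => Tendsto.mul_const _ ?_
    -- Shifting the integrand by q * w changes the integral over [-T, T] by at most 2|qw|B, which is
    -- negligible after division by 2T.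
    have : Tendsto (fun T => bohrMean (fun t => G (t - q * w)) T - bohrMean G T) atTop (𝓝 0) := by
      rw [tendsto_zero_iff_norm_tendsto_zero]
      have h0 : Tendsto (fun T : ℝ => |q * w| * B / T) atTop (𝓝 0) :=
        tendsto_const_nhds.div_atTop tendsto_id
      refine squeeze_zero' (Eventually.of_forall fun _ => norm_nonneg _) ?_ h0
      filter_upwards [eventually_gt_atTop 0] with T hT
      rw [← bohrMean_sub (by fun_prop) hGc, norm_bohrMean _ hT,
        intervalIntegral.integral_sub ((by fun_prop : Continuous fun t =>
          G (t - q * w)).intervalIntegrable _ _) (hGc.intervalIntegrable _ _),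
        intervalIntegral.integral_comp_sub_right]
      have := _root_.norm_integral_window_sub_le hGc hGB (-T - q * w) (-T) (2 * T)
      rw [show -T - q * w + 2 * T = T - q * w by ring, show -T + 2 * T = T by ring,
        show -T - q * w - -T = -(q * w) by ring, abs_neg] at this
      rw [div_le_div_iff₀ (by positivity) hT]
      nlinarith
    simpa using this.add hc

end UniformlyAlmostPeriodic

/-! ### Windowed means that are small uniformly in the frequency -/

theorem norm_exp_I_mul_ofReal (x : ℝ) : ‖Complex.exp (Complex.I * (x : ℂ))‖ = 1 := by
  rw [mul_comm]; exact Complex.norm_exp_ofReal_mul_I _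

theorem norm_exp_I_mul_sub_exp_I_mul_le (x y : ℝ) :
    ‖Complex.exp (Complex.I * (x : ℂ)) - Complex.exp (Complex.I * (y : ℂ))‖ ≤ |x - y| := by
  have e : Complex.exp (Complex.I * (x : ℂ)) - Complex.exp (Complex.I * (y : ℂ)) =
      Complex.exp (Complex.I * (y : ℂ)) * (Complex.exp (Complex.I * ((x - y : ℝ) : ℂ)) - 1) := by
    rw [mul_sub, ← Complex.exp_add, mul_one]; congr 2; push_cast; ring
  rw [e, norm_mul, norm_exp_I_mul_ofReal, one_mul]
  exact Real.norm_exp_I_mul_ofReal_sub_one_le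

namespace UniformlyAlmostPeriodic

variable {g : ℝ → ℂ}

/-- Fix one T for which the mean at ξ₀ is at most δ. On [-T, T] a frequency change below δ/(BT)
alters the integrand by at most δ; almost periodicity carries the bound to all windows of length 2T,
and averaging to all long windows. -/
theorem window_means_small_near (hg : UniformlyAlmostPeriodic g) {ξ₀ : ℝ}
    (H : Tendsto (bohrMean fun t => g t * Complex.exp (Complex.I * ((ξ₀ * t : ℝ) : ℂ))) atTop
      (𝓝 0)) {ε : ℝ} (hε : 0 < ε) :
    ∃ r : ℝ, 0 < r ∧ ∃ P₀ : ℝ, ∀ ξ : ℝ, |ξ - ξ₀| < r → ∀ P, P₀ ≤ P → ∀ u,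
      ‖∫ t in u..(u + P), g t * Complex.exp (Complex.I * ((ξ * t : ℝ) : ℂ))‖ ≤ ε * P := by
  obtain ⟨B, hB, hB'⟩ := hg.exists_bound
  have hgc := hg.1
  set δ := ε / 8 with hδ
  have hδ0 : 0 < δ := by positivity
  obtain ⟨L, hL, hw⟩ := hg.norm_integral_window_mul_exp_le hB' hδ0
  have h1 := (tendsto_zero_iff_norm_tendsto_zero.1 H).eventually_le_const hδ0
  obtain ⟨T, ⟨hT1, hT0⟩, hTL⟩ := ((h1.and (eventually_gt_atTop 0)).and
    (eventually_ge_atTop (L * B / δ))).exists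
  rw [norm_bohrMean _ hT0, div_le_iff₀ (by positivity)] at hT1
  rw [div_le_iff₀ hδ0] at hTL
  refine ⟨δ / (B * T), by positivity, max 0 (2 * T * B / δ), fun ξ hξ P hP u => ?_⟩
  have hc : ∀ ξ : ℝ, Continuous fun t : ℝ => g t * Complex.exp (Complex.I * ((ξ * t : ℝ) : ℂ)) :=
    fun ξ => by fun_prop
  have h2 : ‖∫ t in (-T)..T, g t * Complex.exp (Complex.I * ((ξ * t : ℝ) : ℂ))‖ ≤
      2 * δ * (2 * T) := by
    have h3 := intervalIntegral.norm_integral_le_of_norm_le_const (a := -T) (b := T)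
      (f := fun t => g t * Complex.exp (Complex.I * ((ξ * t : ℝ) : ℂ)) -
        g t * Complex.exp (Complex.I * ((ξ₀ * t : ℝ) : ℂ))) (C := δ) fun t ht => by
      rw [Set.uIoc_of_le (by linarith)] at ht
      rw [← mul_sub, norm_mul]
      have h4 := norm_exp_I_mul_sub_exp_I_mul_le (ξ * t) (ξ₀ * t)
      rw [← sub_mul, abs_mul] at h4
      have h5 : |t| ≤ T := abs_le.2 ⟨ht.1.le, ht.2⟩
      calc _ ≤ B * (δ / (B * T) * T) := by
            gcongr
            · exact hB' t
            · exact h4.trans (by gcongr)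
        _ = δ := by field_simp
    rw [intervalIntegral.integral_sub ((hc _).intervalIntegrable _ _)
      ((hc _).intervalIntegrable _ _), abs_of_pos (by linarith)] at h3
    have := norm_le_norm_add_norm_sub'
      (∫ t in (-T)..T, g t * Complex.exp (Complex.I * ((ξ * t : ℝ) : ℂ)))
      (∫ t in (-T)..T, g t * Complex.exp (Complex.I * ((ξ₀ * t : ℝ) : ℂ)))
    linarith
  have hwin : ∀ u, ‖∫ t in u..(u + 2 * T),
      g t * Complex.exp (Complex.I * ((ξ * t : ℝ) : ℂ))‖ ≤ 4 * δ * (2 * T) := by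
    intro u
    have := hw ξ u (-T) (2 * T) (by positivity)
    rw [show -T + 2 * T = T by ring] at this
    linarith
  have h6 := norm_integral_le_of_windows (hc ξ) (B := B) (fun t => by
    rw [norm_mul, norm_exp_I_mul_ofReal, mul_one]; exact hB' t) (by positivity) hwin (a := u)
    (b := u + P) (by linarith [(le_max_left _ _).trans hP])
  have h7 := (le_max_right _ _).trans hP
  rw [div_le_iff₀ hδ0] at h7
  have h8 := (le_max_left _ _).trans hP
  rw [add_sub_cancel_left] at h6
  have : ε * P = 8 * δ * P := by rw [hδ]; ring
  nlinarith

/-- The Riemann–Lebesgue argument: translation by the half period π/ξ reverses the sign of the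
exponential, so twice the integral is controlled by the oscillation of g over π/ξ, plus end pieces.
-/
theorem window_means_small_of_large (hg : UniformlyAlmostPeriodic g) {ε : ℝ} (hε : 0 < ε) :
    ∃ R : ℝ, ∃ P₀ : ℝ, ∀ ξ : ℝ, R < |ξ| → ∀ P, P₀ ≤ P → ∀ u,
      ‖∫ t in u..(u + P), g t * Complex.exp (Complex.I * ((ξ * t : ℝ) : ℂ))‖ ≤ ε * P := by
  obtain ⟨B, hB, hB'⟩ := hg.exists_bound
  have hgc := hg.1
  obtain ⟨ρ, hρ, hu⟩ := Metric.uniformContinuous_iff.1 hg.uniformContinuous ε hε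
  refine ⟨Real.pi / ρ, 2 * ρ * B / ε, fun ξ hξ P hP u => ?_⟩
  have hP0 : 0 ≤ P := le_trans (by positivity) hP
  have hξ0 : 0 < |ξ| := lt_trans (by positivity) hξ
  have hξne : ξ ≠ 0 := abs_pos.1 hξ0
  set p := Real.pi / ξ with hp
  have hpρ : |p| < ρ := by
    rw [hp, abs_div, abs_of_pos Real.pi_pos, div_lt_iff₀ hξ0]
    rwa [div_lt_iff₀ hρ, mul_comm] at hξ
  set G : ℝ → ℂ := fun t => g t * Complex.exp (Complex.I * ((ξ * t : ℝ) : ℂ)) with hG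
  have hGc : Continuous G := by fun_prop
  have hGB : ∀ t, ‖G t‖ ≤ B := fun t => by
    simp only [hG]; rw [norm_mul, norm_exp_I_mul_ofReal, mul_one]; exact hB' t
  have e : ∀ t, G t + G (t + p) =
      (g t - g (t + p)) * Complex.exp (Complex.I * ((ξ * t : ℝ) : ℂ)) := by
    intro t
    have : Complex.exp (Complex.I * ((ξ * (t + p) : ℝ) : ℂ)) =
        -Complex.exp (Complex.I * ((ξ * t : ℝ) : ℂ)) := by
      have e' : ξ * (t + p) = ξ * t + Real.pi := by rw [hp]; field_simp
      rw [e', Complex.ofReal_add, mul_add, Complex.exp_add, mul_comm Complex.I (Real.pi : ℂ),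
        Complex.exp_pi_mul_I]; ring
    simp only [hG]; rw [this]; ring
  have h1 := intervalIntegral.norm_integral_le_of_norm_le_const (a := u) (b := u + P)
      (f := fun t => G t + G (t + p)) (C := ε) fun t _ => by
    rw [e, norm_mul, norm_exp_I_mul_ofReal, mul_one, ← dist_eq_norm]
    exact (hu (by simpa using hpρ)).le
  rw [intervalIntegral.integral_add (hGc.intervalIntegrable _ _)
    ((by fun_prop : Continuous fun t => G (t + p)).intervalIntegrable _ _),
    intervalIntegral.integral_comp_add_right, add_sub_cancel_left, abs_of_nonneg hP0] at h1
  have h2 := _root_.norm_integral_window_sub_le hGc hGB u (u + p) P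
  rw [show u + p + P = u + P + p by ring, show u - (u + p) = -p by ring, abs_neg] at h2
  have h3 := norm_add_le ((∫ t in u..(u + P), G t) + ∫ t in (u + p)..(u + P + p), G t)
    ((∫ t in u..(u + P), G t) - ∫ t in (u + p)..(u + P + p), G t)
  rw [show ((∫ t in u..(u + P), G t) + ∫ t in (u + p)..(u + P + p), G t) +
    ((∫ t in u..(u + P), G t) - ∫ t in (u + p)..(u + P + p), G t) =
    2 * ∫ t in u..(u + P), G t by ring, norm_mul] at h3
  rw [div_le_iff₀ hε] at hP
  have h4 : 2 * |p| * B ≤ 2 * ρ * B := by gcongr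
  simp only [Complex.norm_ofNat] at h3
  linarith

/-- If all Bohr coefficients vanish, the windowed means are small uniformly in the frequency. -/
theorem window_means_small (hg : UniformlyAlmostPeriodic g)
    (H : ∀ ξ : ℝ, Tendsto (bohrMean fun t => g t * Complex.exp (Complex.I * ((ξ * t : ℝ) : ℂ)))
      atTop (𝓝 0)) {ε : ℝ} (hε : 0 < ε) :
    ∃ P₀ : ℝ, ∀ ξ : ℝ, ∀ P, P₀ ≤ P → ∀ u,
      ‖∫ t in u..(u + P), g t * Complex.exp (Complex.I * ((ξ * t : ℝ) : ℂ))‖ ≤ ε * P := by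
  obtain ⟨R, P₁, h1⟩ := hg.window_means_small_of_large hε
  have h2 : ∃ P₂ : ℝ, ∀ ξ ∈ Set.Icc (-R) R, ∀ P, P₂ ≤ P → ∀ u,
      ‖∫ t in u..(u + P), g t * Complex.exp (Complex.I * ((ξ * t : ℝ) : ℂ))‖ ≤ ε * P := by
    -- A compactness argument makes the threshold uniform for |ξ| ≤ R: it is local near each ξ₀, and
    -- finitely many thresholds have a maximum.
    refine isCompact_Icc.induction_on (p := fun s : Set ℝ => ∃ P₂ : ℝ, ∀ ξ ∈ s, ∀ P, P₂ ≤ P → ∀ u,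
      ‖∫ t in u..(u + P), g t * Complex.exp (Complex.I * ((ξ * t : ℝ) : ℂ))‖ ≤ ε * P)
      ⟨0, by simp⟩ ?_ ?_ ?_
    · rintro s t hst ⟨P₂, h⟩
      exact ⟨P₂, fun ξ hξ => h ξ (hst hξ)⟩
    · rintro s t ⟨P₂, h⟩ ⟨P₃, h'⟩
      refine ⟨max P₂ P₃, fun ξ hξ P hP => ?_⟩
      rcases hξ with hξ | hξ
      · exact h ξ hξ P ((le_max_left _ _).trans hP)
      · exact h' ξ hξ P ((le_max_right _ _).trans hP)
    · intro ξ₀ _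
      obtain ⟨r, hr, P₂, h⟩ := hg.window_means_small_near (H ξ₀) hε
      refine ⟨Metric.ball ξ₀ r, mem_nhdsWithin_of_mem_nhds (Metric.ball_mem_nhds _ hr), P₂,
        fun ξ hξ => h ξ (by simpa [Real.dist_eq] using hξ)⟩
  obtain ⟨P₂, h2⟩ := h2
  refine ⟨max P₁ P₂, fun ξ P hP => ?_⟩
  rcases lt_or_ge R |ξ| with h | h
  · exact h1 ξ h P ((le_max_left _ _).trans hP)
  · exact h2 ξ (abs_le.1 h) P ((le_max_right _ _).trans hP)

end UniformlyAlmostPeriodic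

/-! ### Fourier series on [0, P] and autocorrelation -/

/-- The Fourier coefficients of `f` on the interval `[0, P]`. -/
def periodCoeff (P : ℝ) (f : ℝ → ℂ) (n : ℤ) : ℂ :=
  (P : ℂ)⁻¹ * ∫ t in (0 : ℝ)..P, f t * Complex.exp (Complex.I * ((-(2 * Real.pi * n / P) * t : ℝ) : ℂ))

/-- Parseval's identity. Measurability rather than continuity is assumed because it is also applied
to circle translates, which may jump. -/
theorem hasSum_sq_periodCoeff {P : ℝ} (hP : 0 < P) {f : ℝ → ℂ} (hf : Measurable f) {B : ℝ}
    (hB : ∀ t, ‖f t‖ ≤ B) :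
    HasSum (fun n => ‖periodCoeff P f n‖ ^ 2) (P⁻¹ * ∫ t in (0 : ℝ)..P, ‖f t‖ ^ 2) := by
  have := hasSum_sq_fourierCoeffOn hP (f := f)
    (MemLp.of_bound hf.aestronglyMeasurable B (Eventually.of_forall hB))
  convert this using 2 with n
  · congr 1
    rw [fourierCoeffOn_eq_integral, periodCoeff]
    simp only [sub_zero, smul_eq_mul, Complex.real_smul]
    congr 2
    · push_cast; simp
    · refine intervalIntegral.integral_congr fun t _ => ?_
      rw [mul_comm, fourier_coe_apply]
      congr 2; push_cast; ring
  · simp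

theorem integral_exp_period {P : ℝ} (hP : 0 < P) (k : ℤ) :
    ∫ t in (0 : ℝ)..P, Complex.exp (Complex.I * ((2 * Real.pi * k / P * t : ℝ) : ℂ)) =
      if k = 0 then (P : ℂ) else 0 := by
  have hP' : (P : ℂ) ≠ 0 := by exact_mod_cast hP.ne'
  split_ifs with h
  · subst h; simp
  · have e : ∀ t : ℝ, Complex.exp (Complex.I * ((2 * Real.pi * k / P * t : ℝ) : ℂ)) =
        Complex.exp (2 * Real.pi * k / P * Complex.I * t) := fun t => by
      congr 1; push_cast; ring
    simp_rw [e]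
    rw [integral_exp_mul_complex]
    · have : 2 * Real.pi * k / P * Complex.I * P = k * (2 * Real.pi * Complex.I) := by
        field_simp
      rw [this, Complex.exp_int_mul_two_pi_mul_I]; simp
    · have : (Real.pi : ℂ) ≠ 0 := by exact_mod_cast Real.pi_ne_zero
      have : (k : ℂ) ≠ 0 := by exact_mod_cast h
      simp_all [Complex.I_ne_zero]

/-- The autocorrelation series of `f` on the circle of length `P`. -/
def autocorrelation (P : ℝ) (f : ℝ → ℂ) (τ : ℝ) : ℂ :=
  ∑' n : ℤ, ((‖periodCoeff P f n‖ ^ 2 : ℝ) : ℂ) *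
    Complex.exp (Complex.I * ((2 * Real.pi * n / P * τ : ℝ) : ℂ))

section

variable {P : ℝ} {f : ℝ → ℂ} {B : ℝ}

theorem continuous_autocorrelation (hP : 0 < P) (hf : Measurable f) (hB : ∀ t, ‖f t‖ ≤ B) :
    Continuous (autocorrelation P f) := by
  refine continuous_tsum (u := fun n => ‖periodCoeff P f n‖ ^ 2) (fun n => by fun_prop)
    (hasSum_sq_periodCoeff hP hf hB).summable fun n t => ?_
  rw [norm_mul, norm_exp_I_mul_ofReal, mul_one, Complex.norm_real,
    Real.norm_of_nonneg (by positivity)]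

theorem hasSum_autocorrelation (hP : 0 < P) (hf : Measurable f) (hB : ∀ t, ‖f t‖ ≤ B) (τ : ℝ) :
    HasSum (fun n : ℤ => ((‖periodCoeff P f n‖ ^ 2 : ℝ) : ℂ) *
    Complex.exp (Complex.I * ((2 * Real.pi * n / P * τ : ℝ) : ℂ))) (autocorrelation P f τ) := by
  refine (Summable.of_norm_bounded (hasSum_sq_periodCoeff hP hf hB).summable fun n => ?_).hasSum
  rw [norm_mul, norm_exp_I_mul_ofReal, mul_one, Complex.norm_real,
    Real.norm_of_nonneg (by positivity)]

theorem norm_autocorrelation_le (hP : 0 < P) (hf : Measurable f) (hB : ∀ t, ‖f t‖ ≤ B) (τ : ℝ) :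
    ‖autocorrelation P f τ‖ ≤ P⁻¹ * ∫ t in (0 : ℝ)..P, ‖f t‖ ^ 2 := by
  refine tsum_of_norm_bounded (hasSum_sq_periodCoeff hP hf hB) fun n => ?_
  rw [norm_mul, norm_exp_I_mul_ofReal, mul_one, Complex.norm_real,
    Real.norm_of_nonneg (by positivity)]

/-- The series converges absolutely and uniformly, so it may be integrated termwise against a
character; orthogonality leaves one term. -/
theorem periodCoeff_autocorrelation (hP : 0 < P) (hf : Measurable f) (hB : ∀ t, ‖f t‖ ≤ B)
    (m : ℤ) : periodCoeff P (autocorrelation P f) m = ((‖periodCoeff P f m‖ ^ 2 : ℝ) : ℂ) := by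
  have hP' : (P : ℂ) ≠ 0 := by exact_mod_cast hP.ne'
  have h1 := intervalIntegral.hasSum_integral_of_dominated_convergence (μ := volume) (a := 0)
    (b := P)
    (F := fun (n : ℤ) (t : ℝ) => ((‖periodCoeff P f n‖ ^ 2 : ℝ) : ℂ) *
      Complex.exp (Complex.I * ((2 * Real.pi * n / P * t : ℝ) : ℂ)) *
      Complex.exp (Complex.I * ((-(2 * Real.pi * m / P) * t : ℝ) : ℂ)))
    (f := fun t => autocorrelation P f t *
      Complex.exp (Complex.I * ((-(2 * Real.pi * m / P) * t : ℝ) : ℂ)))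
    (fun n _ => ‖periodCoeff P f n‖ ^ 2)
    (fun n => Continuous.aestronglyMeasurable (by fun_prop))
    (fun n => Eventually.of_forall fun t _ => by
      rw [norm_mul, norm_mul, norm_exp_I_mul_ofReal, norm_exp_I_mul_ofReal, mul_one, mul_one,
        Complex.norm_real, Real.norm_of_nonneg (by positivity)])
    (Eventually.of_forall fun t _ => (hasSum_sq_periodCoeff hP hf hB).summable)
    (by simp)
    (Eventually.of_forall fun t _ => (hasSum_autocorrelation hP hf hB t).mul_right _)
  have h2 : ∀ n : ℤ, ∫ t in (0 : ℝ)..P, ((‖periodCoeff P f n‖ ^ 2 : ℝ) : ℂ) *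
      Complex.exp (Complex.I * ((2 * Real.pi * n / P * t : ℝ) : ℂ)) *
      Complex.exp (Complex.I * ((-(2 * Real.pi * m / P) * t : ℝ) : ℂ)) =
      if n = m then ((‖periodCoeff P f m‖ ^ 2 : ℝ) : ℂ) * P else 0 := by
    intro n
    have e : ∀ t : ℝ, ((‖periodCoeff P f n‖ ^ 2 : ℝ) : ℂ) *
      Complex.exp (Complex.I * ((2 * Real.pi * n / P * t : ℝ) : ℂ)) *
      Complex.exp (Complex.I * ((-(2 * Real.pi * m / P) * t : ℝ) : ℂ)) =
      ((‖periodCoeff P f n‖ ^ 2 : ℝ) : ℂ) *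
      Complex.exp (Complex.I * ((2 * Real.pi * (n - m : ℤ) / P * t : ℝ) : ℂ)) := by
      intro t
      rw [mul_assoc, ← Complex.exp_add]; congr 2; push_cast; ring
    simp_rw [e]
    rw [intervalIntegral.integral_const_mul, integral_exp_period hP]
    by_cases h : n = m
    · simp [h]
    · simp [h, sub_eq_zero]
  simp_rw [h2] at h1
  have h3 := h1.unique (hasSum_ite_eq m _)
  rw [periodCoeff, h3]; field_simp

/-- By Parseval the left side is ∑ |c_n|⁴, at most η² ∑ |c_n|². This is how uniformly small
coefficients force a small autocorrelation. -/
theorem integral_sq_autocorrelation_le (hP : 0 < P) (hf : Measurable f) (hB : ∀ t, ‖f t‖ ≤ B)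
    {η : ℝ} (hη : ∀ n, ‖periodCoeff P f n‖ ≤ η) :
    P⁻¹ * ∫ t in (0 : ℝ)..P, ‖autocorrelation P f t‖ ^ 2 ≤
      η ^ 2 * (P⁻¹ * ∫ t in (0 : ℝ)..P, ‖f t‖ ^ 2) := by
  refine hasSum_le (fun n => ?_) (hasSum_sq_periodCoeff hP
    (continuous_autocorrelation hP hf hB).measurable (norm_autocorrelation_le hP hf hB))
    ((hasSum_sq_periodCoeff hP hf hB).mul_left (η ^ 2))
  rw [periodCoeff_autocorrelation hP hf hB, Complex.norm_real, Real.norm_of_nonneg (by positivity),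
    pow_two (‖periodCoeff P f n‖ ^ 2)]
  have := hη n
  gcongr

/-- The translate by `τ` of the periodic extension of the restriction of `f` to `(0, P]`. -/
def circleTranslate (P : ℝ) (f : ℝ → ℂ) (τ x : ℝ) : ℂ :=
  if x ≤ P - τ then f (x + τ) else f (x + τ - P)

theorem measurable_circleTranslate (hf : Measurable f) (τ : ℝ) :
    Measurable (circleTranslate P f τ) :=
  Measurable.ite measurableSet_Iic (by fun_prop) (by fun_prop)

theorem periodCoeff_circleTranslate (hP : 0 < P) (hf : Continuous f) {τ : ℝ}
    (hτ : τ ∈ Set.Icc 0 P) (n : ℤ) :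
    periodCoeff P (circleTranslate P f τ) n =
      Complex.exp (Complex.I * ((2 * Real.pi * n / P * τ : ℝ) : ℂ)) * periodCoeff P f n := by
  set E : ℝ → ℂ := fun t => Complex.exp (Complex.I * ((-(2 * Real.pi * n / P) * t : ℝ) : ℂ)) with hE
  set c : ℂ := Complex.exp (Complex.I * ((2 * Real.pi * n / P * τ : ℝ) : ℂ)) with hc
  have hEc : Continuous E := by fun_prop
  have hE1 : ∀ t, c * E (t + τ) = E t := fun t => by
    simp only [hE, hc]; rw [← Complex.exp_add]; congr 1; push_cast; ring
  have hE2 : ∀ t, c * E (t + τ - P) = E t := fun t => by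
    have hP' : (P : ℂ) ≠ 0 := by exact_mod_cast hP.ne'
    have : c * E (t + τ - P) = E t * Complex.exp (n * (2 * Real.pi * Complex.I)) := by
      simp only [hE, hc]; rw [← Complex.exp_add, ← Complex.exp_add]; congr 1; push_cast
      field_simp; ring
    rw [this, Complex.exp_int_mul_two_pi_mul_I, mul_one]
  have h1 : ∫ t in (0 : ℝ)..(P - τ), circleTranslate P f τ t * E t =
      c * ∫ t in τ..P, f t * E t := by
    rw [show ∫ t in τ..P, f t * E t = ∫ t in (0 + τ)..(P - τ + τ), f t * E t by simp,
      ← intervalIntegral.integral_comp_add_right (fun t => f t * E t),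
      ← intervalIntegral.integral_const_mul]
    refine intervalIntegral.integral_congr_ae (Eventually.of_forall fun t ht => ?_)
    rw [Set.uIoc_of_le (by linarith [hτ.2])] at ht
    rw [circleTranslate, if_pos ht.2, ← hE1]; ring
  have h2 : ∫ t in (P - τ)..P, circleTranslate P f τ t * E t =
      c * ∫ t in (0 : ℝ)..τ, f t * E t := by
    rw [show ∫ t in (0 : ℝ)..τ, f t * E t =
      ∫ t in (P - τ + (τ - P))..(P + (τ - P)), f t * E t by ring_nf,
      ← intervalIntegral.integral_comp_add_right (fun t => f t * E t),
      ← intervalIntegral.integral_const_mul]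
    refine intervalIntegral.integral_congr_ae (Eventually.of_forall fun t ht => ?_)
    rw [Set.uIoc_of_le (by linarith [hτ.1])] at ht
    rw [circleTranslate, if_neg (by linarith [ht.1]), ← hE2, ← add_sub_assoc]; ring
  have hi : ∀ a b : ℝ, IntervalIntegrable (fun t => f t * E t) volume a b := fun a b =>
    (hf.mul hEc).intervalIntegrable _ _
  have hi1 : IntervalIntegrable (fun t => circleTranslate P f τ t * E t) volume 0 (P - τ) := by
    refine IntervalIntegrable.congr (f := fun t => f (t + τ) * E t) (fun t ht => ?_)
      ((by fun_prop : Continuous fun t => f (t + τ) * E t).intervalIntegrable _ _)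
    rw [Set.uIoc_of_le (by linarith [hτ.2])] at ht
    simp only [circleTranslate, if_pos ht.2]
  have hi2 : IntervalIntegrable (fun t => circleTranslate P f τ t * E t) volume (P - τ) P := by
    refine IntervalIntegrable.congr (f := fun t => f (t + τ - P) * E t) (fun t ht => ?_)
      ((by fun_prop : Continuous fun t => f (t + τ - P) * E t).intervalIntegrable _ _)
    rw [Set.uIoc_of_le (by linarith [hτ.1])] at ht
    simp only [circleTranslate, if_neg (not_le.2 ht.1)]
  rw [periodCoeff, periodCoeff, ← intervalIntegral.integral_add_adjacent_intervals hi1 hi2, h1, h2,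
    ← intervalIntegral.integral_add_adjacent_intervals (hi 0 τ) (hi τ P)]
  ring

/-- Rotation by τ multiplies c_n by e^{iθ}, and |e^{iθ} - 1|² = 2 - 2 cos θ. Parseval for f and for
its rotation minus f then expresses ∑ |c_n|² cos θ. -/
theorem re_autocorrelation (hP : 0 < P) (hf : Continuous f) (hB : ∀ t, ‖f t‖ ≤ B) {τ : ℝ}
    (hτ : τ ∈ Set.Icc 0 P) :
    (autocorrelation P f τ).re = P⁻¹ * (∫ t in (0 : ℝ)..P, ‖f t‖ ^ 2) -
      (P⁻¹ * ∫ t in (0 : ℝ)..P, ‖circleTranslate P f τ t - f t‖ ^ 2) / 2 := by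
  have hm := measurable_circleTranslate (P := P) hf.measurable τ
  have hB2 : ∀ t, ‖circleTranslate P f τ t‖ ≤ B := fun t => by
    rw [circleTranslate]; split_ifs <;> exact hB _
  have hi1 : IntervalIntegrable (circleTranslate P f τ) volume 0 P :=
    (intervalIntegrable_const (c := B)).mono_fun hm.aestronglyMeasurable
      (Eventually.of_forall fun t => by
        rw [Real.norm_of_nonneg ((norm_nonneg _).trans (hB 0))]; exact hB2 t)
  have h1 := hasSum_sq_periodCoeff hP (hm.sub hf.measurable) (B := B + B)
    (fun t => (norm_sub_le _ _).trans (add_le_add (hB2 t) (hB t)))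
  have h2 := hasSum_sq_periodCoeff hP hf.measurable hB
  have h3 := Complex.hasSum_re (hasSum_autocorrelation hP hf.measurable hB τ)
  have e : ∀ n : ℤ, periodCoeff P (circleTranslate P f τ - f) n =
      (Complex.exp (Complex.I * ((2 * Real.pi * n / P * τ : ℝ) : ℂ)) - 1) *
        periodCoeff P f n := by
    intro n
    rw [sub_mul, one_mul, ← periodCoeff_circleTranslate hP hf hτ, periodCoeff, periodCoeff,
      periodCoeff, ← mul_sub, ← intervalIntegral.integral_sub]
    · simp only [Pi.sub_apply, sub_mul]
    · exact hi1.mul_continuousOn (by fun_prop)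
    · exact (by fun_prop : Continuous fun t : ℝ => f t * Complex.exp (Complex.I *
        ((-(2 * Real.pi * n / P) * t : ℝ) : ℂ))).intervalIntegrable _ _
  have h4 := h2.sub (h1.div_const 2)
  have hterm : (fun n : ℤ => (((‖periodCoeff P f n‖ ^ 2 : ℝ) : ℂ) *
      Complex.exp (Complex.I * ((2 * Real.pi * n / P * τ : ℝ) : ℂ))).re) =
      fun n => ‖periodCoeff P f n‖ ^ 2 - ‖periodCoeff P (circleTranslate P f τ - f) n‖ ^ 2 / 2 := by
    funext n
    have hsq : ∀ θ : ℝ, ‖Complex.exp (Complex.I * (θ : ℂ)) - 1‖ ^ 2 = 2 - 2 * Real.cos θ := by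
      intro θ
      have : Complex.exp (Complex.I * (θ : ℂ)) - 1 =
          ((Real.cos θ - 1 : ℝ) : ℂ) + (Real.sin θ : ℝ) * Complex.I := by
        rw [mul_comm, Complex.exp_mul_I]; push_cast; ring
      rw [← Complex.normSq_eq_norm_sq, this, Complex.normSq_add_mul_I]
      linear_combination Real.sin_sq_add_cos_sq θ
    rw [e, norm_mul, mul_pow, hsq, Complex.re_ofReal_mul, mul_comm Complex.I,
      Complex.exp_ofReal_mul_I_re]
    ring
  rw [hterm] at h3
  exact h3.unique h4

/-- Up to P - τ the rotation is an honest translate and differs from f by at most δ. On the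
remaining length τ it wraps around, and only the crude bound (2B)² is available. -/
theorem le_re_autocorrelation (hP : 0 < P) (hf : Continuous f) (hB : ∀ t, ‖f t‖ ≤ B) {τ : ℝ}
    (hτ : τ ∈ Set.Icc 0 P) {δ : ℝ} (hδ : ∀ t, ‖f (t + τ) - f t‖ ≤ δ) :
    P⁻¹ * (∫ t in (0 : ℝ)..P, ‖f t‖ ^ 2) - (δ ^ 2 + 4 * B ^ 2 * τ / P) / 2 ≤
      (autocorrelation P f τ).re := by
  rw [re_autocorrelation hP hf hB hτ]
  have hm := (measurable_circleTranslate (P := P) hf.measurable τ).sub hf.measurable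
  have hb : ∀ t, ‖circleTranslate P f τ t - f t‖ ^ 2 ≤ 4 * B ^ 2 := fun t => by
    have h2 : ‖circleTranslate P f τ t‖ ≤ B := by
      rw [circleTranslate]; split_ifs <;> exact hB _
    have := norm_sub_le (circleTranslate P f τ t) (f t)
    have : ‖circleTranslate P f τ t - f t‖ ≤ 2 * B := by linarith [hB t]
    calc _ ≤ (2 * B) ^ 2 := by gcongr
      _ = _ := by ring
  have hi : ∀ a b : ℝ, IntervalIntegrable (fun t => ‖circleTranslate P f τ t - f t‖ ^ 2)
      volume a b := fun a b =>
    (intervalIntegrable_const (c := 4 * B ^ 2)).mono_fun (hm.norm.pow_const 2).aestronglyMeasurable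
      (Eventually.of_forall fun t => by
        simpa [abs_of_nonneg (sq_nonneg B)] using hb t)
  have h1 := intervalIntegral.norm_integral_le_of_norm_le_const (a := 0) (b := P - τ)
    (f := fun t => ‖circleTranslate P f τ t - f t‖ ^ 2) (C := δ ^ 2) fun t ht => by
      rw [Set.uIoc_of_le (by linarith [hτ.2])] at ht
      rw [Real.norm_of_nonneg (by positivity), circleTranslate, if_pos ht.2]
      have := hδ t
      gcongr
  have h2 := intervalIntegral.norm_integral_le_of_norm_le_const (a := P - τ) (b := P)
    (f := fun t => ‖circleTranslate P f τ t - f t‖ ^ 2) (C := 4 * B ^ 2) fun t _ => by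
      rw [Real.norm_of_nonneg (by positivity)]
      exact hb t
  rw [sub_zero, abs_of_nonneg (by linarith [hτ.2])] at h1
  rw [show P - (P - τ) = τ by ring, abs_of_nonneg hτ.1] at h2
  have h3 := (le_abs_self _).trans h1
  have h4 := (le_abs_self _).trans h2
  have h5 : ∫ t in (0 : ℝ)..P, ‖circleTranslate P f τ t - f t‖ ^ 2 ≤
      P * (δ ^ 2 + 4 * B ^ 2 * τ / P) := by
    rw [← intervalIntegral.integral_add_adjacent_intervals (hi 0 (P - τ)) (hi (P - τ) P)]
    have e : P * (δ ^ 2 + 4 * B ^ 2 * τ / P) = δ ^ 2 * P + 4 * B ^ 2 * τ := by field_simp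
    have : δ ^ 2 * (P - τ) ≤ δ ^ 2 * P := by
      have := hτ.1
      gcongr; linarith
    linarith
  have h6 : P⁻¹ * ∫ t in (0 : ℝ)..P, ‖circleTranslate P f τ t - f t‖ ^ 2 ≤
      δ ^ 2 + 4 * B ^ 2 * τ / P := by
    rw [inv_mul_le_iff₀ hP]; exact h5
  linarith

end

/-! ### The uniqueness theorem -/

theorem le_integral_of_windows {φ : ℝ → ℝ} (hφ : Continuous φ) {W m : ℝ} (n : ℕ)
    (h : ∀ j < n, m ≤ ∫ t in (j * W)..(j * W + W), φ t) :
    n * m ≤ ∫ t in (0 : ℝ)..(n * W), φ t := by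
  induction n with
  | zero => simp
  | succ n ih =>
    have h1 := ih fun j hj => h j (by omega)
    have h2 := h n (by omega)
    rw [← intervalIntegral.integral_add_adjacent_intervals (hφ.intervalIntegrable 0 (n * W))
      (hφ.intervalIntegrable (n * W) _)]
    push_cast
    rw [show ((n : ℝ) + 1) * W = n * W + W by ring]
    linarith

theorem le_integral_of_le_on_subinterval {φ : ℝ → ℝ} (hφ : Continuous φ) (h0 : ∀ t, 0 ≤ φ t)
    {a b c d m : ℝ} (hac : a ≤ c) (hcd : c ≤ d) (hdb : d ≤ b) (hm : ∀ t ∈ Set.Icc c d, m ≤ φ t) :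
    m * (d - c) ≤ ∫ t in a..b, φ t := by
  have h1 : ∫ t in c..d, φ t ≤ ∫ t in a..b, φ t :=
    intervalIntegral.integral_mono_interval hac hcd hdb (Eventually.of_forall h0)
      (hφ.intervalIntegrable _ _)
  have h2 : ∫ _ in c..d, m ≤ ∫ t in c..d, φ t :=
    intervalIntegral.integral_mono_on hcd (by simp) (hφ.intervalIntegrable _ _) hm
  rw [intervalIntegral.integral_const, smul_eq_mul] at h2
  linarith

namespace UniformlyAlmostPeriodic

variable {g : ℝ → ℂ}

/-- A third of |g(t₀)| is lost to the almost period and a third to uniform continuity, so |g| ≥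
|g(t₀)|/3 on an interval of length 2r in every window of length W. -/
theorem exists_integral_sq_ge (hg : UniformlyAlmostPeriodic g) {t₀ : ℝ} (h0 : g t₀ ≠ 0) :
    ∃ c P₀ : ℝ, 0 < c ∧ ∀ P, P₀ ≤ P → c * P ≤ ∫ t in (0 : ℝ)..P, ‖g t‖ ^ 2 := by
  have hgc := hg.1
  set a := ‖g t₀‖ / 3 with ha
  have ha0 : 0 < a := by have := norm_pos_iff.2 h0; positivity
  obtain ⟨ρ, hρ, hu⟩ := Metric.uniformContinuous_iff.1 hg.uniformContinuous a ha0
  set r := ρ / 2 with hr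
  have hr0 : 0 < r := by positivity
  obtain ⟨L, hL, h⟩ := hg.2 a ha0
  set W := L + 2 * r with hW
  have hW0 : 0 < W := by positivity
  set m := a ^ 2 * (2 * r) with hm
  have hm0 : 0 < m := by positivity
  have hwin : ∀ u, m ≤ ∫ t in u..(u + W), ‖g t‖ ^ 2 := by
    intro u
    obtain ⟨τ, hτ, h'⟩ := h (u - t₀ + r)
    have := le_integral_of_le_on_subinterval (φ := fun t => ‖g t‖ ^ 2) (by fun_prop)
      (fun t => by positivity) (a := u) (b := u + W) (c := t₀ + τ - r) (d := t₀ + τ + r)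
      (m := a ^ 2) (by linarith [hτ.1]) (by linarith) (by linarith [hτ.2]) (fun t ht => by
        have h1 := h' (t - τ)
        rw [sub_add_cancel] at h1
        have h2 : dist (g (t - τ)) (g t₀) < a := hu (by
          rw [Real.dist_eq, abs_lt]; constructor <;> linarith [ht.1, ht.2])
        rw [dist_eq_norm] at h2
        have e : g t₀ = g t - (g t - g (t - τ)) - (g (t - τ) - g t₀) := by ring
        have h3 : ‖g t₀‖ ≤ ‖g t‖ + ‖g t - g (t - τ)‖ + ‖g (t - τ) - g t₀‖ := by
          conv_lhs => rw [e]
          exact (norm_sub_le _ _).trans (add_le_add (norm_sub_le _ _) le_rfl)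
        have : a ≤ ‖g t‖ := by linarith
        gcongr)
    rw [show t₀ + τ + r - (t₀ + τ - r) = 2 * r by ring] at this
    exact this
  refine ⟨m / (2 * W), 2 * W, by positivity, fun P hP => ?_⟩
  have hP0 : 0 ≤ P / W := div_nonneg (by linarith) hW0.le
  have h1 := le_integral_of_windows (φ := fun t => ‖g t‖ ^ 2) (by fun_prop) (W := W) (m := m)
    ⌊P / W⌋₊ fun j _ => hwin _
  have h2 : (⌊P / W⌋₊ : ℝ) * W ≤ P := (le_div_iff₀ hW0).1 (Nat.floor_le hP0)
  have h3 : ∫ t in (0 : ℝ)..(⌊P / W⌋₊ * W), ‖g t‖ ^ 2 ≤ ∫ t in (0 : ℝ)..P, ‖g t‖ ^ 2 :=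
    intervalIntegral.integral_mono_interval le_rfl (by positivity) h2
      (Eventually.of_forall fun t => by positivity)
      ((by fun_prop : Continuous fun t => ‖g t‖ ^ 2).intervalIntegrable _ _)
  have h4 := Nat.lt_floor_add_one (P / W)
  have h5 : 2 ≤ P / W := (le_div_iff₀ hW0).2 hP
  have h6 : P / W / 2 ≤ ⌊P / W⌋₊ := by linarith
  calc m / (2 * W) * P = P / W / 2 * m := by field_simp
    _ ≤ ⌊P / W⌋₊ * m := by gcongr
    _ ≤ _ := h1.trans h3

/-- **Uniqueness theorem** for almost periodic functions. -/
theorem eq_zero_of_bohrMean_tendsto_zero (hg : UniformlyAlmostPeriodic g)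
    (H : ∀ ξ : ℝ, Tendsto (bohrMean fun t => g t * Complex.exp (Complex.I * ((ξ * t : ℝ) : ℂ)))
      atTop (𝓝 0)) (t₀ : ℝ) : g t₀ = 0 := by
  by_contra h0
  have hgc := hg.1
  obtain ⟨B, hB, hB'⟩ := hg.exists_bound
  obtain ⟨c, P₁, hc, hP₁⟩ := hg.exists_integral_sq_ge h0
  -- The choices δ² = c/2 and 4B²κ ≤ c/2 keep the loss in `le_re_autocorrelation` below c/2 for
  -- translations τ ≤ κP that move g by at most δ.
  set δ := Real.sqrt (c / 2) with hδ
  have hδ0 : 0 < δ := Real.sqrt_pos.2 (by positivity)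
  have hδ2 : δ ^ 2 = c / 2 := Real.sq_sqrt (by positivity)
  set κ := min 1 (c / (8 * B ^ 2)) with hκ
  have hκ0 : 0 < κ := by positivity
  have hκ1 : κ ≤ 1 := min_le_left _ _
  have hκ2 : 4 * B ^ 2 * κ ≤ c / 2 := by
    calc 4 * B ^ 2 * κ ≤ 4 * B ^ 2 * (c / (8 * B ^ 2)) := by gcongr; exact min_le_right _ _
      _ = c / 2 := by field_simp; ring
  obtain ⟨ρ, hρ, hu⟩ := Metric.uniformContinuous_iff.1 hg.uniformContinuous (δ / 2) (by positivity)
  set r := ρ / 2 with hr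
  have hr0 : 0 < r := by positivity
  obtain ⟨L, hL, hL'⟩ := hg.2 (δ / 2) (by positivity)
  set W := L + 2 * r with hW
  have hW0 : 0 < W := by positivity
  -- Each of the κP/W windows in [0, κP] will contribute (c/2)² · 2r, so c₃ bounds the mean square
  -- of the autocorrelation over [0, P] from below. Then η is taken with η²B² < c₃ to contradict
  -- this.
  set c₃ := κ / W * ((c / 2) ^ 2 * (2 * r)) with hc₃
  have hc₃0 : 0 < c₃ := by positivity
  set η := Real.sqrt (c₃ / (2 * B ^ 2)) with hη
  have hη0 : 0 < η := Real.sqrt_pos.2 (by positivity)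
  have hη2 : η ^ 2 * B ^ 2 < c₃ := by
    rw [Real.sq_sqrt (by positivity)]
    have : c₃ / (2 * B ^ 2) * B ^ 2 = c₃ / 2 := by field_simp
    linarith
  obtain ⟨P₂, hP₂⟩ := hg.window_means_small H hη0
  obtain ⟨n, hn⟩ := exists_nat_ge (max 1 (max P₁ P₂) * κ / W)
  -- With this P, the interval [0, κP] consists of exactly n windows of length W.
  set P := n * W / κ with hP
  have hPge : max 1 (max P₁ P₂) ≤ P := by
    rw [hP, le_div_iff₀ hκ0]; exact (div_le_iff₀ hW0).1 hn
  have hP0 : 0 < P := lt_of_lt_of_le one_pos ((le_max_left _ _).trans hPge)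
  have hPP1 : P₁ ≤ P := ((le_max_left _ _).trans (le_max_right _ _)).trans hPge
  have hPP2 : P₂ ≤ P := ((le_max_right _ _).trans (le_max_right _ _)).trans hPge
  have hκP : n * W = κ * P := by rw [hP]; field_simp
  -- The frequencies 2πk/P vary with P, which is why smallness had to be uniform in the frequency.
  have hcoef : ∀ k : ℤ, ‖periodCoeff P g k‖ ≤ η := by
    intro k
    have := hP₂ (-(2 * Real.pi * k / P)) P hPP2 0
    rw [zero_add] at this
    rw [periodCoeff, norm_mul, norm_inv, Complex.norm_real, Real.norm_of_nonneg hP0.le,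
      inv_mul_le_iff₀ hP0]
    linarith
  have h1 := integral_sq_autocorrelation_le hP0 hgc.measurable hB' hcoef
  have h2 : P⁻¹ * ∫ t in (0 : ℝ)..P, ‖g t‖ ^ 2 ≤ B ^ 2 := by
    rw [inv_mul_le_iff₀ hP0]
    have := intervalIntegral.norm_integral_le_of_norm_le_const (a := 0) (b := P)
      (f := fun t => ‖g t‖ ^ 2) (C := B ^ 2) fun t _ => by
        rw [Real.norm_of_nonneg (by positivity)]; have := hB' t; gcongr
    rw [sub_zero, abs_of_pos hP0] at this
    linarith [(le_abs_self _).trans this]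
  have h3 : c ≤ P⁻¹ * ∫ t in (0 : ℝ)..P, ‖g t‖ ^ 2 := by
    rw [le_inv_mul_iff₀ hP0, mul_comm]; exact hP₁ P hPP1
  have hAc := continuous_autocorrelation hP0 hgc.measurable hB'
  -- Each window contains an interval of radius r around a δ/2-almost period τ. Uniform continuity
  -- makes all its points δ-almost periods.
  have hwin : ∀ j < n, (c / 2) ^ 2 * (2 * r) ≤
      ∫ t in (j * W)..(j * W + W), ‖autocorrelation P g t‖ ^ 2 := by
    intro j hj
    obtain ⟨τ, hτ, h'⟩ := hL' (j * W + r)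
    have hj0 : (0 : ℝ) ≤ j * W := by positivity
    have hj1 : j * W + W ≤ κ * P := by
      rw [← hκP]
      have : (j : ℝ) + 1 ≤ n := by exact_mod_cast hj
      nlinarith
    have := le_integral_of_le_on_subinterval (φ := fun t => ‖autocorrelation P g t‖ ^ 2)
      (hAc.norm.pow 2) (fun t => by positivity) (a := j * W) (b := j * W + W) (c := τ - r)
      (d := τ + r) (m := (c / 2) ^ 2) (by linarith [hτ.1]) (by linarith) (by linarith [hτ.2])
      (fun t ht => by
        have ht0 : 0 ≤ t := by linarith [ht.1, hτ.1]
        have ht1 : t ≤ κ * P := by linarith [ht.2, hτ.2]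
        have htP : t ≤ P := ht1.trans (mul_le_of_le_one_left hP0.le hκ1)
        have htr : ∀ x, ‖g (x + t) - g x‖ ≤ δ := by
          intro x
          have h4 : dist (g (x + t)) (g (x + τ)) < δ / 2 := hu (by
            rw [Real.dist_eq, abs_lt]; constructor <;> linarith [ht.1, ht.2])
          rw [dist_eq_norm] at h4
          have := norm_add_le (g (x + t) - g (x + τ)) (g (x + τ) - g x)
          rw [sub_add_sub_cancel] at this
          linarith [h' x]
        have h5 := le_re_autocorrelation hP0 hgc hB' ⟨ht0, htP⟩ htr
        have h6 := (le_abs_self _).trans (Complex.abs_re_le_norm (autocorrelation P g t))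
        have h7 : 4 * B ^ 2 * t / P ≤ c / 2 := by
          refine le_trans ?_ hκ2
          rw [div_le_iff₀ hP0, mul_assoc (4 * B ^ 2) κ]
          gcongr
        have h8 : c / 2 ≤ ‖autocorrelation P g t‖ := by linarith
        gcongr)
    rw [show τ + r - (τ - r) = 2 * r by ring] at this
    exact this
  have h9 := le_integral_of_windows (φ := fun t => ‖autocorrelation P g t‖ ^ 2) (hAc.norm.pow 2)
    n hwin
  have h10 : ∫ t in (0 : ℝ)..(n * W), ‖autocorrelation P g t‖ ^ 2 ≤
      ∫ t in (0 : ℝ)..P, ‖autocorrelation P g t‖ ^ 2 :=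
    intervalIntegral.integral_mono_interval le_rfl (by positivity) (by rw [hκP]; exact mul_le_of_le_one_left hP0.le hκ1)
      (Eventually.of_forall fun t => by positivity)
      ((hAc.norm.pow 2).intervalIntegrable _ _)
  have h11 : c₃ ≤ P⁻¹ * ∫ t in (0 : ℝ)..P, ‖autocorrelation P g t‖ ^ 2 := by
    rw [le_inv_mul_iff₀ hP0]
    have : P * c₃ = n * ((c / 2) ^ 2 * (2 * r)) := by
      have : (n : ℝ) = κ * P / W := by rw [← hκP]; field_simp
      rw [this, hc₃]; field_simp
    linarith
  have h12 : η ^ 2 * (P⁻¹ * ∫ t in (0 : ℝ)..P, ‖g t‖ ^ 2) ≤ η ^ 2 * B ^ 2 := by gcongr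
  linarith

end UniformlyAlmostPeriodic

/-! ### Summation kernels -/

/-- Fourier inversion, written so that φ appears as the multiplier of convolution with its Fourier
transform. -/
theorem integral_exp_mul_fourier {φ : ℝ → ℂ} (hc : Continuous φ) (hi : Integrable φ)
    (hF : Integrable (𝓕 φ)) (ξ : ℝ) :
    ∫ w : ℝ, Complex.exp (Complex.I * ((ξ * (2 * Real.pi * w) : ℝ) : ℂ)) * (𝓕 φ) w = φ ξ := by
  have h := congrFun (hc.fourierInv_fourier_eq hi hF) ξ
  rw [Real.fourierInv_eq'] at h
  rw [← h]
  refine integral_congr_ae (Eventually.of_forall fun w => ?_)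
  simp only [smul_eq_mul]
  congr 2
  simp only [RCLike.inner_apply, conj_trivial]
  push_cast; ring

/-- The triangle function `max 0 (1 - |x|)`. -/
def triangle (x : ℝ) : ℂ := ((max 0 (1 - |x|) : ℝ) : ℂ)

theorem continuous_triangle : Continuous triangle := by unfold triangle; fun_prop

theorem triangle_eq_zero {x : ℝ} (hx : 1 ≤ |x|) : triangle x = 0 := by
  rw [triangle, max_eq_left (by linarith)]; simp

theorem norm_triangle_le (x : ℝ) : ‖triangle x‖ ≤ 1 := by
  rw [triangle, Complex.norm_real, Real.norm_of_nonneg (le_max_left _ _)]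
  exact max_le zero_le_one (by linarith [abs_nonneg x])

theorem hasCompactSupport_triangle : HasCompactSupport triangle := by
  refine HasCompactSupport.of_support_subset_isCompact (isCompact_Icc (a := (-1 : ℝ)) (b := 1))
    fun x hx => ?_
  by_contra h
  refine hx (triangle_eq_zero ?_)
  by_contra h'
  exact h (abs_le.1 (not_le.1 h').le)

theorem integrable_triangle : Integrable triangle :=
  continuous_triangle.integrable_of_hasCompactSupport hasCompactSupport_triangle

theorem integral_triangle_mul_exp {c : ℂ} (hc : c ≠ 0) :
    ∫ x : ℝ, triangle x * Complex.exp (c * x) =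
      (Complex.exp c + Complex.exp (-c) - 2) / c ^ 2 := by
  have hs : Function.support (fun x : ℝ => triangle x * Complex.exp (c * x)) ⊆ Set.Ioc (-1) 1 := by
    intro x hx
    by_contra h
    refine hx ?_
    simp only
    rw [triangle_eq_zero, zero_mul]
    by_contra h'
    have := abs_lt.1 (not_le.1 h')
    exact h ⟨this.1, this.2.le⟩
  rw [← intervalIntegral.integral_eq_integral_of_support_subset hs]
  have hcont : Continuous fun x : ℝ => triangle x * Complex.exp (c * x) := by
    have := continuous_triangle
    fun_prop
  rw [← intervalIntegral.integral_add_adjacent_intervals (hcont.intervalIntegrable (-1) 0)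
    (hcont.intervalIntegrable 0 1)]
  have hexp : ∀ x : ℝ, HasDerivAt (fun x : ℝ => Complex.exp (c * x)) (Complex.exp (c * x) * c) x :=
    fun x => by
      have := ((Complex.ofRealCLM.hasDerivAt (x := x)).const_mul c).cexp
      simpa using this
  have hid : ∀ x : ℝ, HasDerivAt (fun x : ℝ => (x : ℂ)) 1 x := fun x => by
    exact HasDerivAt.ofReal_comp (f := fun x => x) (hasDerivAt_id x)
  have h1 : ∫ x in (-1 : ℝ)..0, triangle x * Complex.exp (c * x) =
      ((1 + ((0 : ℝ) : ℂ)) / c - 1 / c ^ 2) * Complex.exp (c * (0 : ℝ)) -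
      ((1 + ((-1 : ℝ) : ℂ)) / c - 1 / c ^ 2) * Complex.exp (c * (-1 : ℝ)) := by
    refine intervalIntegral.integral_eq_sub_of_hasDerivAt
      (f := fun x : ℝ => ((1 + (x : ℂ)) / c - 1 / c ^ 2) * Complex.exp (c * x)) (fun x hx => ?_)
      (hcont.intervalIntegrable _ _)
    rw [Set.uIcc_of_le (by norm_num)] at hx
    have := ((((hid x).const_add 1).div_const c).sub_const (1 / c ^ 2)).mul (hexp x)
    refine this.congr_deriv ?_
    simp only [triangle]
    rw [abs_of_nonpos hx.2, max_eq_right (by linarith [hx.1])]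
    push_cast
    field_simp
    ring
  have h2 : ∫ x in (0 : ℝ)..1, triangle x * Complex.exp (c * x) =
      ((1 - ((1 : ℝ) : ℂ)) / c + 1 / c ^ 2) * Complex.exp (c * (1 : ℝ)) -
      ((1 - ((0 : ℝ) : ℂ)) / c + 1 / c ^ 2) * Complex.exp (c * (0 : ℝ)) := by
    refine intervalIntegral.integral_eq_sub_of_hasDerivAt
      (f := fun x : ℝ => ((1 - (x : ℂ)) / c + 1 / c ^ 2) * Complex.exp (c * x)) (fun x hx => ?_)
      (hcont.intervalIntegrable _ _)
    rw [Set.uIcc_of_le (by norm_num)] at hx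
    have := ((((hid x).const_sub 1).div_const c).add_const (1 / c ^ 2)).mul (hexp x)
    refine this.congr_deriv ?_
    simp only [triangle]
    rw [abs_of_nonneg hx.1, max_eq_right (by linarith [hx.2])]
    push_cast
    field_simp
    ring
  rw [h1, h2]
  push_cast
  simp only [mul_zero, Complex.exp_zero, mul_one, mul_neg]
  field_simp
  ring

/-- The trivial bound 2 handles small w, and the explicit formula gives w²|K(w)| ≤ 4/(2π)² ≤ 1. The
decay makes the Fejér kernel integrable, as inversion requires. -/
theorem norm_fourier_triangle_le (w : ℝ) : ‖(𝓕 triangle) w‖ ≤ 4 * (1 + w ^ 2)⁻¹ := by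
  have hF : (𝓕 triangle) w = ∫ x : ℝ, triangle x * Complex.exp (-(2 * Real.pi * w) * Complex.I * x) := by
    rw [Real.fourier_eq']
    refine integral_congr_ae (Eventually.of_forall fun x => ?_)
    simp only [smul_eq_mul, RCLike.inner_apply, conj_trivial]
    rw [mul_comm]; congr 2; push_cast; ring
  rw [← div_eq_mul_inv, le_div_iff₀ (by positivity)]
  have h1 : ‖(𝓕 triangle) w‖ ≤ 2 := by
    have hs : Function.support (fun x : ℝ =>
        triangle x * Complex.exp (-(2 * Real.pi * w) * Complex.I * x)) ⊆ Set.Ioc (-1) 1 := by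
      intro x hx
      by_contra h
      refine hx ?_
      simp only
      rw [triangle_eq_zero, zero_mul]
      by_contra h'
      have := abs_lt.1 (not_le.1 h')
      exact h ⟨this.1, this.2.le⟩
    rw [hF, ← intervalIntegral.integral_eq_integral_of_support_subset hs]
    have := intervalIntegral.norm_integral_le_of_norm_le_const (a := -1) (b := 1) (C := 1)
      (f := fun x : ℝ => triangle x * Complex.exp (-(2 * Real.pi * w) * Complex.I * x))
      fun x _ => by
        have e : -(2 * Real.pi * w) * Complex.I * x =
          Complex.I * ((-(2 * Real.pi * w) * x : ℝ) : ℂ) := by push_cast; ring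
        rw [norm_mul, e, norm_exp_I_mul_ofReal, mul_one]
        exact norm_triangle_le x
    norm_num at this ⊢
    exact this
  rcases eq_or_ne w 0 with rfl | hw
  · simp at h1 ⊢; linarith
  have hpi : (Real.pi : ℂ) ≠ 0 := by exact_mod_cast Real.pi_ne_zero
  have hw' : (w : ℂ) ≠ 0 := by exact_mod_cast hw
  have h2 : ‖(𝓕 triangle) w‖ * w ^ 2 ≤ 1 := by
    have e : ∀ x : ℝ, ‖Complex.exp (x * Complex.I)‖ = 1 := Complex.norm_exp_ofReal_mul_I
    rw [hF, integral_triangle_mul_exp (by simp [hpi, hw']), norm_div, norm_pow]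
    have e1 : ‖-(2 * (Real.pi : ℂ) * w) * Complex.I‖ = 2 * Real.pi * |w| := by
      simp [abs_of_pos Real.pi_pos]
    rw [e1, mul_pow, sq_abs, div_mul_eq_mul_div, div_le_one (by positivity)]
    have e2 : ‖Complex.exp (-(2 * (Real.pi : ℂ) * w) * Complex.I) +
        Complex.exp (-(-(2 * (Real.pi : ℂ) * w) * Complex.I)) - 2‖ ≤ 4 := by
      have a1 := e (-(2 * Real.pi * w))
      have a2 := e (2 * Real.pi * w)
      have e3 : -(-(2 * (Real.pi : ℂ) * w) * Complex.I) =
        ((2 * Real.pi * w : ℝ) : ℂ) * Complex.I := by push_cast; ring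
      have e4 : (-(2 * (Real.pi : ℂ) * w) * Complex.I) =
        ((-(2 * Real.pi * w) : ℝ) : ℂ) * Complex.I := by push_cast; ring
      rw [e3, e4]
      have := norm_sub_le (Complex.exp (((-(2 * Real.pi * w) : ℝ) : ℂ) * Complex.I) +
        Complex.exp (((2 * Real.pi * w : ℝ) : ℂ) * Complex.I)) 2
      have := norm_add_le (Complex.exp (((-(2 * Real.pi * w) : ℝ) : ℂ) * Complex.I))
        (Complex.exp (((2 * Real.pi * w : ℝ) : ℂ) * Complex.I))
      simp only [Complex.norm_ofNat] at *
      linarith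
    have h3 : (4 : ℝ) ≤ (2 * Real.pi) ^ 2 := by nlinarith [Real.pi_gt_three]
    gcongr
    linarith
  linarith

theorem integrable_fourier_triangle : Integrable (𝓕 triangle) :=
  (integrable_inv_one_add_sq.const_mul 4).mono'
    (VectorFourier.fourierIntegral_continuous Real.continuous_fourierChar (by fun_prop) integrable_triangle).aestronglyMeasurable
    (Eventually.of_forall norm_fourier_triangle_le)

/-- There is a kernel of rapid decay whose Fourier transform is compactly supported. -/
theorem exists_rapidly_decaying_kernel : ∃ φ K : ℝ → ℂ, φ 0 = 1 ∧ Continuous φ ∧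
    (∀ x, 1 ≤ |x| → φ x = 0) ∧ Continuous K ∧
    (∀ k : ℕ, Integrable fun w => (1 + |w|) ^ k * ‖K w‖) ∧
    ∀ ξ : ℝ, ∫ w : ℝ, Complex.exp (Complex.I * ((ξ * (2 * Real.pi * w) : ℝ) : ℂ)) * K w = φ ξ := by
  -- The radii give φ = 1 at 0 and φ = 0 for |x| ≥ 1. Smoothness with compact support puts φ, hence
  -- its transform, in the Schwartz class.
  let b : ContDiffBump (0 : ℝ) := ⟨1 / 2, 1, by norm_num, by norm_num⟩
  let f : ℝ → ℂ := fun x => (b x : ℂ)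
  have hf1 : HasCompactSupport f := b.hasCompactSupport.comp_left (g := fun x : ℝ => (x : ℂ)) (by simp)
  have hf2 : ContDiff ℝ (⊤ : ℕ∞) f := Complex.ofRealCLM.contDiff.comp b.contDiff
  let S : SchwartzMap ℝ ℂ := hf1.toSchwartzMap hf2
  have hS : (S : ℝ → ℂ) = f := rfl
  refine ⟨S, (𝓕 S : SchwartzMap ℝ ℂ), ?_, S.continuous, fun x hx => ?_, (𝓕 S).continuous, fun k => ?_, ?_⟩
  · rw [hS]
    simp only [f]
    rw [b.one_of_mem_closedBall (by simp [b])]; simp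
  · rw [hS]
    simp only [f]
    rw [b.zero_of_le_dist (by simpa [b] using hx)]; simp
  · have h : Integrable fun w => 2 ^ (k - 1) * (‖(𝓕 S) w‖ + |w| ^ k * ‖(𝓕 S) w‖) := by
      refine ((𝓕 S).integrable.norm.add ?_).const_mul _
      simpa using (𝓕 S).integrable_pow_mul volume k
    refine h.mono' (by have := (𝓕 S).continuous; fun_prop) (Eventually.of_forall fun w => ?_)
    rw [Real.norm_of_nonneg (by positivity)]
    have := add_pow_le (zero_le_one' ℝ) (abs_nonneg w) k
    rw [one_pow] at this
    calc (1 + |w|) ^ k * ‖(𝓕 S) w‖ ≤ 2 ^ (k - 1) * (1 + |w| ^ k) * ‖(𝓕 S) w‖ := by gcongr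
      _ = _ := by ring
  · intro ξ
    have := integral_exp_mul_fourier S.continuous S.integrable (by
      rw [← SchwartzMap.fourier_coe]; exact (𝓕 S).integrable) ξ
    rw [← this, SchwartzMap.fourier_coe]

/-! ### Convolution along vertical lines -/

section

variable {F : ℂ → ℂ} {B : ℝ}

/-- Cauchy's estimate on a circle of radius σ/2, which stays in the open half-plane. -/
theorem norm_deriv_le_of_bounded (hF : DifferentiableOn ℂ F {s : ℂ | 0 < s.re})
    (hB : ∀ s : ℂ, 0 < s.re → ‖F s‖ ≤ B) {s : ℂ} {σ : ℝ} (hσ : 0 < σ) (hs : σ ≤ s.re) :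
    ‖deriv F s‖ ≤ 2 * B / σ := by
  have hsub : Metric.closedBall s (σ / 2) ⊆ {s : ℂ | 0 < s.re} := fun z hz => by
    rw [Metric.mem_closedBall, dist_eq_norm] at hz
    have := (abs_le.1 ((Complex.abs_re_le_norm _).trans hz)).1
    rw [Complex.sub_re] at this
    show 0 < z.re
    linarith
  have := Complex.norm_deriv_le_of_forall_mem_sphere_norm_le (f := F) (c := s) (C := B)
    (half_pos hσ) ((hF.mono hsub).diffContOnCl_ball le_rfl) fun z hz =>
      hB z (hsub (Metric.sphere_subset_closedBall hz))
  refine this.trans (le_of_eq ?_)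
  field_simp

theorem norm_sub_le_of_bounded (hF : DifferentiableOn ℂ F {s : ℂ | 0 < s.re})
    (hB : ∀ s : ℂ, 0 < s.re → ‖F s‖ ≤ B) {s z : ℂ} {σ : ℝ} (hσ : 0 < σ) (hs : σ ≤ s.re)
    (hz : σ ≤ z.re) : ‖F z - F s‖ ≤ 2 * B / σ * ‖z - s‖ :=
  (convex_halfSpace_re_ge σ).norm_image_sub_le_of_norm_deriv_le
    (fun w hw => (hF w (hσ.trans_le hw)).differentiableAt
      ((isOpen_lt continuous_const Complex.continuous_re).mem_nhds (hσ.trans_le hw)))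
    (fun _ hw => norm_deriv_le_of_bounded hF hB hσ hw) hs hz

/-- The point obtained from `s` by a vertical translation by `-t`. -/
def verticalShift (s : ℂ) (t : ℝ) : ℂ := s - (t : ℂ) * Complex.I

@[simp] theorem verticalShift_re (s : ℂ) (t : ℝ) : (verticalShift s t).re = s.re := by
  simp [verticalShift]

/-- The convolution of `F` with the kernel `K`, at the scale `q`, on vertical lines. -/
def vconv (F : ℂ → ℂ) (K : ℝ → ℂ) (q : ℝ) (s : ℂ) : ℂ := ∫ w : ℝ, F (verticalShift s (q * w)) * K w

variable {K : ℝ → ℂ}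

theorem continuous_comp_verticalShift (hF : DifferentiableOn ℂ F {s : ℂ | 0 < s.re}) {s : ℂ}
    (hs : 0 < s.re) (q : ℝ) : Continuous fun w : ℝ => F (verticalShift s (q * w)) :=
  hF.continuousOn.comp_continuous (by unfold verticalShift; fun_prop) fun w => by simpa using hs

theorem integrable_vconv (hF : DifferentiableOn ℂ F {s : ℂ | 0 < s.re})
    (hB : ∀ s : ℂ, 0 < s.re → ‖F s‖ ≤ B) (hK : Integrable K) {s : ℂ} (hs : 0 < s.re) (q : ℝ) :
    Integrable fun w : ℝ => F (verticalShift s (q * w)) * K w :=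
  hK.bdd_mul (c := B) (continuous_comp_verticalShift hF hs q).aestronglyMeasurable
    (Eventually.of_forall fun w => hB _ (by simpa using hs))

/-- Differentiation under the integral; Cauchy's estimate on a smaller half-plane around s supplies
the dominating function. -/
theorem differentiableOn_vconv (hF : DifferentiableOn ℂ F {s : ℂ | 0 < s.re})
    (hB : ∀ s : ℂ, 0 < s.re → ‖F s‖ ≤ B) (hK : Integrable K) (q : ℝ) :
    DifferentiableOn ℂ (vconv F K q) {s : ℂ | 0 < s.re} := by
  have hopen : IsOpen {s : ℂ | 0 < s.re} := isOpen_lt continuous_const Complex.continuous_re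
  intro s hs
  have hs' : 0 < s.re := hs
  set σ := s.re / 2 with hσ
  have hσ0 : 0 < σ := by positivity
  have hd := (hF.deriv hopen)
  refine (hasDerivAt_integral_of_dominated_loc_of_deriv_le (𝕜 := ℂ) (μ := volume)
    (F := fun z w => F (verticalShift z (q * w)) * K w)
    (F' := fun z w => deriv F (verticalShift z (q * w)) * K w) (x₀ := s)
    (s := {z : ℂ | σ < z.re}) (bound := fun w => 2 * B / σ * ‖K w‖)
    ((isOpen_lt continuous_const Complex.continuous_re).mem_nhds (by simp only [Set.mem_ofPred_eq]; linarith)) ?_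
    (integrable_vconv hF hB hK hs q) ?_ ?_ (hK.norm.const_mul _) ?_).2.differentiableAt.differentiableWithinAt
  · filter_upwards [hopen.mem_nhds hs] with z hz
    exact (integrable_vconv hF hB hK hz q).aestronglyMeasurable
  · exact (continuous_comp_verticalShift hd hs q).aestronglyMeasurable.mul hK.aestronglyMeasurable
  · refine Eventually.of_forall fun w z hz => ?_
    rw [norm_mul]
    gcongr
    exact norm_deriv_le_of_bounded hF hB hσ0 (by simpa using (le_of_lt hz))
  · refine Eventually.of_forall fun w z hz => ?_
    have hz' : 0 < (verticalShift z (q * w)).re := by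
      rw [verticalShift_re]; exact hσ0.trans hz
    have h1 : HasDerivAt F (deriv F (verticalShift z (q * w))) (verticalShift z (q * w)) :=
      ((hF _ hz').differentiableAt (hopen.mem_nhds hz')).hasDerivAt
    have h2 : HasDerivAt (fun z => verticalShift z (q * w)) 1 z :=
      (hasDerivAt_id z).sub_const _
    have := (h1.comp z h2).mul_const (K w)
    rw [mul_one] at this
    exact this

/-- F is Lipschitz on [Re ≥ σ], so the error is the first moment of K times the scale. The bound is
uniform on vertical lines, but the finite first moment excludes the Fejér kernel. -/
theorem norm_vconv_sub_le (hF : DifferentiableOn ℂ F {s : ℂ | 0 < s.re})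
    (hB : ∀ s : ℂ, 0 < s.re → ‖F s‖ ≤ B) (hK : Integrable K) (hK1 : ∫ w, K w = 1)
    (hK2 : Integrable fun w => |w| * ‖K w‖) {s : ℂ} {σ : ℝ} (hσ : 0 < σ) (hs : σ ≤ s.re) (q : ℝ) :
    ‖vconv F K q s - F s‖ ≤ 2 * B / σ * |q| * ∫ w, |w| * ‖K w‖ := by
  have hs' := hσ.trans_le hs
  have e : vconv F K q s - F s = ∫ w, (F (verticalShift s (q * w)) - F s) * K w := by
    simp_rw [sub_mul]
    rw [integral_sub (integrable_vconv hF hB hK hs' q) (hK.const_mul _), integral_const_mul, hK1,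
      mul_one]; rfl
  rw [e, ← integral_const_mul]
  refine norm_integral_le_of_norm_le (hK2.const_mul _) (Eventually.of_forall fun w => ?_)
  have h1 := norm_sub_le_of_bounded hF hB hσ hs (z := verticalShift s (q * w)) (by simpa using hs)
  have h2 : ‖verticalShift s (q * w) - s‖ = |q| * |w| := by
    simp [verticalShift]
  rw [h2] at h1
  rw [norm_mul]
  calc _ ≤ 2 * B / σ * (|q| * |w|) * ‖K w‖ := by gcongr
    _ = _ := by ring

/-- A pointwise substitute for `norm_vconv_sub_le` that needs only integrability of K, and so covers
the Fejér kernel. -/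
theorem tendsto_vconv (hF : DifferentiableOn ℂ F {s : ℂ | 0 < s.re})
    (hB : ∀ s : ℂ, 0 < s.re → ‖F s‖ ≤ B) (hK : Integrable K) (hK1 : ∫ w, K w = 1)
    {s : ℂ} (hs : 0 < s.re) {q : ℝ → ℝ} {l : Filter ℝ} [l.IsCountablyGenerated]
    (hq : Tendsto q l (𝓝 0)) : Tendsto (fun y => vconv F K (q y) s) l (𝓝 (F s)) := by
  have e : F s = ∫ w, F s * K w := by rw [integral_const_mul, hK1, mul_one]
  rw [e]
  refine tendsto_integral_filter_of_dominated_convergence (fun w => B * ‖K w‖)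
    (Eventually.of_forall fun y => (integrable_vconv hF hB hK hs _).aestronglyMeasurable)
    (Eventually.of_forall fun y => Eventually.of_forall fun w => ?_) (hK.norm.const_mul B)
    (Eventually.of_forall fun w => ?_)
  · rw [norm_mul]; gcongr; exact hB _ (by simpa using hs)
  · refine Tendsto.mul_const _ ?_
    have h1 : Tendsto (fun y => q y * w) l (𝓝 (0 * w)) := hq.mul_const w
    rw [zero_mul] at h1
    have h2 : Continuous fun x : ℝ => F (verticalShift s x) := by
      simpa using continuous_comp_verticalShift hF hs 1
    have h3 := (h2.tendsto 0).comp h1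
    simpa [verticalShift, Function.comp_def] using h3

/-- The convolution of an exponential is a multiple of the exponential. -/
theorem vconv_exp {φ : ℝ → ℂ}
    (hφ : ∀ ξ : ℝ, ∫ w : ℝ, Complex.exp (Complex.I * ((ξ * (2 * Real.pi * w) : ℝ) : ℂ)) * K w = φ ξ)
    (x y : ℝ) (s : ℂ) :
    vconv (fun z => Complex.exp (-(x : ℂ) * z)) K (2 * Real.pi / y) s =
      φ (x / y) * Complex.exp (-(x : ℂ) * s) := by
  rw [vconv, ← hφ, ← integral_mul_const]
  refine integral_congr_ae (Eventually.of_forall fun w => ?_)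
  simp only
  have : Complex.exp (-(x : ℂ) * verticalShift s (2 * Real.pi / y * w)) =
      Complex.exp (Complex.I * ((x / y * (2 * Real.pi * w) : ℝ) : ℂ)) *
        Complex.exp (-(x : ℂ) * s) := by
    rw [← Complex.exp_add]; congr 1; simp only [verticalShift]; push_cast; ring
  rw [this]; ring

end

/-! ### Identity theorem, Dirichlet polynomials and their Bohr coefficients -/

theorem isPreconnected_rightHalfPlane : IsPreconnected {s : ℂ | 0 < s.re} :=
  (convex_halfSpace_re_gt 0).isPreconnected

/-- Two holomorphic functions on the right half-plane which agree on a vertical line coincide. -/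
theorem eqOn_rightHalfPlane_of_eq_on_line {F G : ℂ → ℂ}
    (hF : DifferentiableOn ℂ F {s : ℂ | 0 < s.re}) (hG : DifferentiableOn ℂ G {s : ℂ | 0 < s.re})
    {σ : ℝ} (hσ : 0 < σ) (h : ∀ t : ℝ, F (σ + t * Complex.I) = G (σ + t * Complex.I)) :
    Set.EqOn F G {s : ℂ | 0 < s.re} := by
  have hopen : IsOpen {s : ℂ | 0 < s.re} := isOpen_lt continuous_const Complex.continuous_re
  refine (hF.analyticOnNhd hopen).eqOn_of_preconnected_of_frequently_eq (hG.analyticOnNhd hopen)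
    isPreconnected_rightHalfPlane (z₀ := (σ : ℂ)) (by simpa using hσ) ?_
  have ht : Tendsto (fun t : ℝ => (σ : ℂ) + t * Complex.I) (𝓝[≠] 0) (𝓝[≠] (σ : ℂ)) := by
    refine tendsto_nhdsWithin_iff.2 ⟨?_, ?_⟩
    · have : Continuous fun t : ℝ => (σ : ℂ) + t * Complex.I := by fun_prop
      have := (this.tendsto 0).mono_left (nhdsWithin_le_nhds (s := {0}ᶜ))
      simpa using this
    · filter_upwards [self_mem_nhdsWithin] with t ht
      simpa using ht
  exact ht.frequently (Eventually.of_forall h).frequently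

/-- A Dirichlet polynomial on a vertical line is almost periodic. -/
theorem uniformlyAlmostPeriodic_exp_neg_mul (x σ : ℝ) :
    UniformlyAlmostPeriodic fun t : ℝ => Complex.exp (-(x : ℂ) * (σ + t * Complex.I)) := by
  convert (UniformlyAlmostPeriodic.exp (-x)).const_mul (Complex.exp (-(x : ℂ) * σ)) using 2 with t
  rw [← Complex.exp_add]; congr 1; push_cast; ring

/-- The extension by zero of a function on the right half-plane. -/
def extendByZero (f : RightHalfPlane → ℂ) : ℂ → ℂ := Function.extend Subtype.val f 0

theorem extendByZero_apply (f : RightHalfPlane → ℂ) (s : RightHalfPlane) :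
    extendByZero f s.val = f s := Subtype.val_injective.extend_apply _ _ _

theorem extendByZero_line (f : RightHalfPlane → ℂ) {σ : ℝ} (hσ : 0 < σ) (t : ℝ) :
    extendByZero f (σ + t * Complex.I) = f (linePoint hσ t) :=
  extendByZero_apply f (linePoint hσ t)

theorem hasBohrCoeff_iff {f : RightHalfPlane → ℂ} {x : ℝ} {c : ℂ} :
    HasBohrCoeff f x c ↔ ∀ σ : ℝ, 0 < σ → Tendsto (bohrMean fun t =>
      extendByZero f (σ + t * Complex.I) * Complex.exp ((σ + t * Complex.I) * (x : ℂ))) atTop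
      (𝓝 c) := by
  refine forall_congr' fun σ => forall_congr' fun hσ => ?_
  simp_rw [extendByZero_line f hσ]
  rfl

/-- The Dirichlet polynomial with coefficients `b` and indices in `S`. -/
def dirichletPoly (lam : Frequency) (S : Finset ℕ) (b : ℕ → ℂ) (s : ℂ) : ℂ :=
  ∑ n ∈ S, b n * Complex.exp (-(lam.val n : ℂ) * s)

theorem Frequency.mem_below {lam : Frequency} {x : ℝ} {n : ℕ} :
    n ∈ lam.below x ↔ lam.val n < x := by simp [Frequency.below]

theorem differentiable_dirichletPoly (lam : Frequency) (S : Finset ℕ) (b : ℕ → ℂ) :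
    Differentiable ℂ (dirichletPoly lam S b) := by
  unfold dirichletPoly; fun_prop

theorem uniformlyAlmostPeriodic_dirichletPoly (lam : Frequency) (S : Finset ℕ) (b : ℕ → ℂ)
    (σ : ℝ) : UniformlyAlmostPeriodic fun t : ℝ => dirichletPoly lam S b (σ + t * Complex.I) :=
  UniformlyAlmostPeriodic.sum S (fun n t =>
    b n * Complex.exp (-(lam.val n : ℂ) * (σ + t * Complex.I))) fun n _ =>
    (uniformlyAlmostPeriodic_exp_neg_mul (lam.val n) σ).const_mul (b n)

theorem tendsto_bohrMean_dirichletPoly (lam : Frequency) (S : Finset ℕ) (b : ℕ → ℂ) (σ ξ : ℝ) :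
    Tendsto (bohrMean fun t => dirichletPoly lam S b (σ + t * Complex.I) *
      Complex.exp ((σ + t * Complex.I) * (ξ : ℂ))) atTop
      (𝓝 (∑ n ∈ S, b n * if lam.val n = ξ then 1 else 0)) := by
  have e : ∀ T, bohrMean (fun t => dirichletPoly lam S b (σ + t * Complex.I) *
      Complex.exp ((σ + t * Complex.I) * (ξ : ℂ))) T =
      ∑ n ∈ S, b n * Complex.exp ((ξ - lam.val n : ℝ) * σ) *
        bohrMean (fun t => Complex.exp (Complex.I * (((ξ - lam.val n) * t : ℝ) : ℂ))) T := by
    intro T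
    simp_rw [← bohrMean_const_mul]
    rw [← bohrMean_sum S fun n _ => by fun_prop]
    congr 1
    funext t
    rw [dirichletPoly, Finset.sum_mul]
    refine Finset.sum_congr rfl fun n _ => ?_
    rw [mul_assoc, mul_assoc, ← Complex.exp_add, ← Complex.exp_add]
    congr 2
    push_cast
    ring
  rw [funext e]
  refine tendsto_finsetSum _ fun n _ => ?_
  have := (tendsto_bohrMean_exp (ξ - lam.val n)).const_mul
    (b n * Complex.exp ((ξ - lam.val n : ℝ) * σ))
  convert this using 2
  by_cases h : lam.val n = ξ
  · simp [h]
  · have h' : ¬ ξ - lam.val n = 0 := fun h' => h (by linarith)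
    simp [h, h']

/-- Separates the constant e^{σξ} in the definition of Bohr coefficients from the unimodular
character used for almost periodic functions. -/
theorem bohrMean_mul_exp_line (g : ℝ → ℂ) (σ ξ T : ℝ) :
    bohrMean (fun t => g t * Complex.exp ((σ + t * Complex.I) * (ξ : ℂ))) T =
      Complex.exp (σ * ξ) *
        bohrMean (fun t => g t * Complex.exp (Complex.I * ((ξ * t : ℝ) : ℂ))) T := by
  rw [← bohrMean_const_mul]
  congr 1
  funext t
  rw [mul_left_comm, ← Complex.exp_add]
  congr 2
  push_cast
  ring

theorem vconv_dirichletPoly (lam : Frequency) (S : Finset ℕ) (b : ℕ → ℂ) {φ K : ℝ → ℂ}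
    (hK : Integrable K)
    (hφ : ∀ ξ : ℝ, ∫ w : ℝ, Complex.exp (Complex.I * ((ξ * (2 * Real.pi * w) : ℝ) : ℂ)) * K w = φ ξ)
    (y : ℝ) (s : ℂ) :
    vconv (dirichletPoly lam S b) K (2 * Real.pi / y) s =
      dirichletPoly lam S (fun n => b n * φ (lam.val n / y)) s := by
  have hi : ∀ x : ℝ, Integrable fun w : ℝ =>
      Complex.exp (-(x : ℂ) * verticalShift s (2 * Real.pi / y * w)) * K w := fun x => by
    refine hK.bdd_mul (c := Real.exp (-x * s.re)) ?_ (Eventually.of_forall fun w => ?_)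
    · exact Continuous.aestronglyMeasurable (by unfold verticalShift; fun_prop)
    · rw [Complex.norm_exp]; simp
  have : ∀ w : ℝ, dirichletPoly lam S b (verticalShift s (2 * Real.pi / y * w)) * K w =
      ∑ n ∈ S, b n * (Complex.exp (-(lam.val n : ℂ) *
        verticalShift s (2 * Real.pi / y * w)) * K w) := fun w => by
    rw [dirichletPoly, Finset.sum_mul]; simp only [mul_assoc]
  rw [vconv]
  simp_rw [this]
  rw [integral_finsetSum _ fun n _ => (hi _).const_mul _, dirichletPoly]
  refine Finset.sum_congr rfl fun n _ => ?_
  rw [integral_const_mul, mul_assoc, ← vconv_exp hφ]; rfl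

/-! ### From `HInfty` to a Riesz germ -/

/-- Convolution turns a function in `HInfty` into a Dirichlet polynomial. -/
theorem vconv_eq_dirichletPoly_of_bohrCoeff {lam : Frequency} {F : ℂ → ℂ} {φ K : ℝ → ℂ}
    (hK : Integrable K) (hφ0 : ∀ x, 1 ≤ |x| → φ x = 0)
    (hφ : ∀ ξ : ℝ, ∫ w : ℝ, Complex.exp (Complex.I * ((ξ * (2 * Real.pi * w) : ℝ) : ℂ)) * K w = φ ξ)
    {σ : ℝ} (hg : UniformlyAlmostPeriodic fun t : ℝ => F (σ + t * Complex.I)) {c : ℝ → ℂ}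
    (hc : ∀ ξ : ℝ, Tendsto (bohrMean fun t => F (σ + t * Complex.I) *
      Complex.exp ((σ + t * Complex.I) * (ξ : ℂ))) atTop (𝓝 (c ξ)))
    (hc0 : ∀ ξ, ξ ∉ Set.range lam.val → c ξ = 0) {y : ℝ} (hy : 0 < y) (t : ℝ) :
    vconv F K (2 * Real.pi / y) (σ + t * Complex.I) =
      dirichletPoly lam (lam.below y) (fun n => c (lam.val n) * φ (lam.val n / y))
        (σ + t * Complex.I) := by
  set P := dirichletPoly lam (lam.below y) (fun n => c (lam.val n) * φ (lam.val n / y)) with hP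
  set q := 2 * Real.pi / y with hq
  have e : ∀ t : ℝ, vconv F K q (σ + t * Complex.I) =
      ∫ w, (fun t : ℝ => F (σ + t * Complex.I)) (t - q * w) * K w := by
    intro t
    rw [vconv]
    refine integral_congr_ae (Eventually.of_forall fun w => ?_)
    simp only [verticalShift]
    congr 2; push_cast; ring
  have hu1 := hg.conv hK q
  have hu2 := uniformlyAlmostPeriodic_dirichletPoly lam (lam.below y)
    (fun n => c (lam.val n) * φ (lam.val n / y)) σ
  -- Both sides are almost periodic on the line, so it suffices that all Bohr coefficients of the
  -- difference vanish.
  have key := (hu1.sub hu2).eq_zero_of_bohrMean_tendsto_zero (fun ξ => ?_) t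
  · rw [e]; exact sub_eq_zero.1 key
  have hne : Complex.exp (σ * ξ) ≠ 0 := Complex.exp_ne_zero _
  have h1 : Tendsto (bohrMean fun t => F (σ + t * Complex.I) *
      Complex.exp (Complex.I * ((ξ * t : ℝ) : ℂ))) atTop (𝓝 ((Complex.exp (σ * ξ))⁻¹ * c ξ)) := by
    have := (hc ξ).const_mul (Complex.exp (σ * ξ))⁻¹
    refine this.congr fun T => ?_
    rw [bohrMean_mul_exp_line (fun t : ℝ => F (σ + t * Complex.I)), inv_mul_cancel_left₀ hne]
  have h2 := hg.tendsto_bohrMean_conv hK q ξ h1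
  have h3 : ∫ w : ℝ, Complex.exp (Complex.I * ((ξ * (q * w) : ℝ) : ℂ)) * K w = φ (ξ / y) := by
    rw [← hφ]
    refine integral_congr_ae (Eventually.of_forall fun w => ?_)
    simp only
    congr 4
    rw [hq]; ring
  rw [h3] at h2
  have h4 := tendsto_bohrMean_dirichletPoly lam (lam.below y)
    (fun n => c (lam.val n) * φ (lam.val n / y)) σ ξ
  -- For ξ = λ_m ≥ y the polynomial has no such term, and c ξ * φ (ξ / y) vanishes because φ is zero
  -- from 1 on. Off the frequency, c ξ is zero.
  have h5 : (∑ n ∈ lam.below y, c (lam.val n) * φ (lam.val n / y) *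
      if lam.val n = ξ then 1 else 0) = c ξ * φ (ξ / y) := by
    by_cases hξ : ξ ∈ Set.range lam.val
    · obtain ⟨m, rfl⟩ := hξ
      simp only [lam.strictMono.injective.eq_iff, mul_ite, mul_one, mul_zero,
        Finset.sum_ite_eq']
      split_ifs with h
      · rfl
      · rw [Frequency.mem_below, not_lt] at h
        rw [hφ0, mul_zero]
        rw [abs_of_nonneg (div_nonneg (lam.nonneg m) hy.le)]
        exact (one_le_div hy).2 h
    · rw [hc0 ξ hξ, zero_mul]
      refine Finset.sum_eq_zero fun n _ => ?_
      rw [if_neg (fun h => hξ ⟨n, h⟩), mul_zero]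
  rw [h5] at h4
  have h6 := h4.const_mul (Complex.exp (σ * ξ))⁻¹
  have h7 := h2.sub h6
  have h8 : (Complex.exp (σ * ξ))⁻¹ * c ξ * φ (ξ / y) -
    (Complex.exp (σ * ξ))⁻¹ * (c ξ * φ (ξ / y)) = 0 := by ring
  rw [h8] at h7
  refine h7.congr fun T => ?_
  rw [bohrMean_mul_exp_line (fun t : ℝ => dirichletPoly lam _ _ (σ + t * Complex.I)),
    inv_mul_cancel_left₀ hne, ← bohrMean_sub]
  · simp only [sub_mul]
  · exact hu1.1.mul (by fun_prop)
  · exact hu2.1.mul (by fun_prop)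

theorem bounded_extendByZero {f : RightHalfPlane → ℂ}
    (hb : BddAbove (Set.range fun s : RightHalfPlane => ‖f s‖)) :
    ∃ B : ℝ, ∀ s : ℂ, 0 < s.re → ‖extendByZero f s‖ ≤ B := by
  obtain ⟨B, hB⟩ := hb
  refine ⟨B, fun s hs => ?_⟩
  rw [extendByZero_apply f ⟨s, hs⟩]
  exact hB ⟨⟨s, hs⟩, rfl⟩

/-- The Fejér means of f are Riesz means of order 1 and converge to f. Coefficients are taken on [Re
= 1] only; the identity theorem carries the result to other lines. -/
theorem exists_isRieszGerm_of_mem_HInfty {lam : Frequency} {f : RightHalfPlane → ℂ}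
    (hf : f ∈ HInfty lam) : ∃ a : ℕ → ℂ, IsRieszGerm lam a f := by
  obtain ⟨hol, hb, hap, hbohr⟩ := hf
  obtain ⟨B, hB⟩ := bounded_extendByZero hb
  set F := extendByZero f with hFdef
  have hF : DifferentiableOn ℂ F {s : ℂ | 0 < s.re} := hol
  have hg : UniformlyAlmostPeriodic fun t : ℝ => F ((1 : ℝ) + t * Complex.I) := by
    simpa only [hFdef, extendByZero_line f one_pos] using hap 1 one_pos
  have hex : ∀ ξ : ℝ, ∃ c : ℂ, Tendsto (bohrMean fun t => F ((1 : ℝ) + t * Complex.I) *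
      Complex.exp (((1 : ℝ) + t * Complex.I) * (ξ : ℂ))) atTop (𝓝 c) := by
    intro ξ
    obtain ⟨c, hc⟩ := (hg.mul (UniformlyAlmostPeriodic.exp ξ)).exists_mean
    exact ⟨_, (hc.const_mul (Complex.exp ((1 : ℝ) * ξ))).congr fun T =>
      (bohrMean_mul_exp_line (fun t : ℝ => F ((1 : ℝ) + t * Complex.I)) 1 ξ T).symm⟩
  choose c hc using hex
  have hc0 : ∀ ξ, ξ ∉ Set.range lam.val → c ξ = 0 := fun ξ hξ =>
    tendsto_nhds_unique (hc ξ) (hasBohrCoeff_iff.1 (hbohr ξ hξ) 1 one_pos)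
  have hφ := integral_exp_mul_fourier continuous_triangle integrable_triangle
    integrable_fourier_triangle
  have hK := integrable_fourier_triangle
  have hK1 : ∫ w, (𝓕 triangle) w = 1 := by
    have := hφ 0
    simpa [triangle] using this
  -- Order 1 suffices, and with abscissa 0: the convergence holds on the whole half-plane.
  refine ⟨fun n => c (lam.val n), 1, zero_le_one, 0, fun s _ => ?_⟩
  have hs : 0 < s.val.re := s.2
  have hlim : Tendsto (fun y : ℝ => vconv F (𝓕 triangle) (2 * Real.pi / y) s.val) atTop
      (𝓝 (F s.val)) :=
    tendsto_vconv hF hB hK hK1 hs (tendsto_const_nhds.div_atTop tendsto_id)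
  rw [hFdef, extendByZero_apply, ← hFdef] at hlim
  refine hlim.congr' ?_
  filter_upwards [eventually_gt_atTop 0] with y hy
  have := eqOn_rightHalfPlane_of_eq_on_line (differentiableOn_vconv hF hB hK (2 * Real.pi / y))
    (differentiable_dirichletPoly lam (lam.below y)
      (fun n => c (lam.val n) * triangle (lam.val n / y))).differentiableOn one_pos
    (fun t => vconv_eq_dirichletPoly_of_bohrCoeff hK (fun x hx => triangle_eq_zero hx) hφ hg hc
      hc0 hy t) hs
  rw [this, dirichletPoly, rieszMean]
  refine Finset.sum_congr rfl fun n hn => ?_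
  have h1 : lam.val n / y ≤ 1 := (div_le_one hy).2 (Frequency.mem_below.1 hn).le
  have h0 : 0 ≤ lam.val n / y := div_nonneg (lam.nonneg n) hy.le
  rw [triangle, abs_of_nonneg h0, max_eq_right (by linarith), Real.rpow_one]
  ring

/-! ### Raising the order of Riesz means -/

section Order

/-- The kernel of the average relating Riesz means of different orders. -/
theorem integral_beta_shift {m p μ : ℝ} (hμ1 : μ < 1) :
    ∫ t in μ..1, (t - μ) ^ m * (1 - t) ^ p =
      (1 - μ) ^ (m + p + 1) * ∫ t in (0 : ℝ)..1, t ^ m * (1 - t) ^ p := by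
  have h : 0 < 1 - μ := by linarith
  have h1 := intervalIntegral.integral_comp_mul_add (a := 0) (b := 1)
    (fun t => (t - μ) ^ m * (1 - t) ^ p) h.ne' μ
  rw [mul_zero, zero_add, mul_one, sub_add_cancel, smul_eq_mul, eq_inv_mul_iff_mul_eq₀ h.ne'] at h1
  rw [← h1, Real.rpow_add h, Real.rpow_one, mul_comm _ (1 - μ), mul_assoc]
  congr 1
  rw [← intervalIntegral.integral_const_mul]
  refine intervalIntegral.integral_congr fun t ht => ?_
  rw [Set.uIcc_of_le zero_le_one] at ht
  rw [add_sub_cancel_right, show 1 - ((1 - μ) * t + μ) = (1 - μ) * (1 - t) by ring,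
    Real.mul_rpow h.le ht.1, Real.mul_rpow h.le (by linarith [ht.2]), Real.rpow_add h]
  ring

theorem integral_beta_pos {m p : ℝ} (hm : 0 ≤ m) (hp : 0 ≤ p) :
    0 < ∫ t in (0 : ℝ)..1, t ^ m * (1 - t) ^ p := by
  refine intervalIntegral.intervalIntegral_pos_of_pos_on ?_ (fun t ht => ?_) zero_lt_one
  · refine Continuous.intervalIntegrable ?_ _ _
    exact (Real.continuous_rpow_const hm).mul
      ((Real.continuous_rpow_const hp).comp (by fun_prop : Continuous fun t : ℝ => 1 - t))
  · exact mul_pos (Real.rpow_pos_of_pos ht.1 _) (Real.rpow_pos_of_pos (by linarith [ht.2]) _)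

variable {lam : Frequency} {m : ℝ} {a : ℕ → ℂ} {s c : ℂ}

/-- Convergence bounds the means for x ≥ X. For smaller x they involve only the finitely many λ_n <
X, with weights in [0, 1]. -/
theorem exists_bound_rieszMean (hm : 0 ≤ m)
    (h : Tendsto (fun x : ℝ => rieszMean lam m a x s) atTop (𝓝 c)) :
    ∃ C : ℝ, 0 ≤ C ∧ ∀ x, 0 < x → ‖rieszMean lam m a x s‖ ≤ C := by
  have h1 := h.norm.eventually_le_const (lt_add_one ‖c‖)
  obtain ⟨X, hX⟩ := eventually_atTop.1 h1
  set D := ∑ n ∈ lam.below X, ‖a n * Complex.exp (-(lam.val n : ℂ) * s)‖ with hD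
  have hD0 : 0 ≤ D := Finset.sum_nonneg fun n _ => norm_nonneg _
  refine ⟨‖c‖ + 1 + D, by positivity, fun x hx => ?_⟩
  rcases le_or_gt X x with h' | h'
  · linarith [hX x h']
  · have : ‖rieszMean lam m a x s‖ ≤ D := by
      refine (norm_sum_le _ _).trans ((Finset.sum_le_sum fun n hn => ?_).trans
        (Finset.sum_le_sum_of_subset_of_nonneg (fun n hn => ?_) fun n _ _ => norm_nonneg _))
      · rw [norm_mul]
        refine mul_le_of_le_one_right (norm_nonneg _) ?_
        have h0 : 0 ≤ lam.val n / x := div_nonneg (lam.nonneg n) hx.le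
        have h2 : lam.val n / x ≤ 1 := (div_le_one hx).2 (Frequency.mem_below.1 hn).le
        rw [Complex.norm_real, Real.norm_of_nonneg (Real.rpow_nonneg (by linarith) _)]
        exact Real.rpow_le_one (by linarith) (by linarith) hm
      · rw [Frequency.mem_below] at hn ⊢
        exact hn.trans h'
    linarith [norm_nonneg c]

/-- Since t^m (1 - λ/(xt))^m = (t - λ/x)^m, the t-dependent range of summation becomes an indicator,
and one can integrate in t over a fixed finite sum. -/
theorem rieszMean_mul_rpow {x t : ℝ} (hx : 0 < x) (ht : t ∈ Set.Ioc (0 : ℝ) 1) :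
    rieszMean lam m a (x * t) s * ((t ^ m : ℝ) : ℂ) =
      ∑ n ∈ lam.below x, a n * Complex.exp (-(lam.val n : ℂ) * s) *
        (((Set.Ioi (lam.val n / x)).indicator (fun t => (t - lam.val n / x) ^ m) t : ℝ) : ℂ) := by
  have hsub : lam.below (x * t) ⊆ lam.below x := fun n hn => by
    rw [Frequency.mem_below] at hn ⊢
    exact hn.trans_le (mul_le_of_le_one_right hx.le ht.2)
  have hxt : 0 < x * t := mul_pos hx ht.1
  rw [rieszMean, Finset.sum_mul, ← Finset.sum_subset hsub]
  · refine Finset.sum_congr rfl fun n hn => ?_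
    rw [Frequency.mem_below] at hn
    have h1 : lam.val n / x < t := by rw [div_lt_iff₀ hx]; linarith
    have h2 : lam.val n / (x * t) ≤ 1 := (div_le_one hxt).2 hn.le
    rw [Set.indicator_of_mem (show t ∈ Set.Ioi (lam.val n / x) from h1), mul_assoc,
      ← Complex.ofReal_mul, ← Real.mul_rpow (by linarith) ht.1.le]
    congr 4
    have := ht.1.ne'
    field_simp
  · intro n _ hn
    rw [Frequency.mem_below, not_lt] at hn
    rw [Set.indicator_of_notMem, Complex.ofReal_zero, mul_zero]
    rw [Set.mem_Ioi, not_lt, le_div_iff₀ hx]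
    linarith

/-- Termwise, the beta integral of (t - μ)₊^m (1 - t)^p is a constant times (1 - μ)^{m+p+1}. So the
higher mean is a weighted average of lower ones. -/
theorem rieszMean_order_add (hm : 0 ≤ m) {p : ℝ} (hp : 0 ≤ p) {x : ℝ} (hx : 0 < x) :
    ∫ t in (0 : ℝ)..1, rieszMean lam m a (x * t) s * ((t ^ m * (1 - t) ^ p : ℝ) : ℂ) =
      rieszMean lam (m + p + 1) a x s * ((∫ t in (0 : ℝ)..1, t ^ m * (1 - t) ^ p : ℝ) : ℂ) := by
  have hcont : ∀ μ : ℝ, Continuous fun t : ℝ => (t - μ) ^ m * (1 - t) ^ p := fun μ =>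
    ((Real.continuous_rpow_const hm).comp (by fun_prop : Continuous fun t : ℝ => t - μ)).mul
      ((Real.continuous_rpow_const hp).comp (by fun_prop : Continuous fun t : ℝ => 1 - t))
  have hind : ∀ μ : ℝ, (fun t : ℝ => (Set.Ioi μ).indicator (fun t => (t - μ) ^ m) t * (1 - t) ^ p) =
      (Set.Ioi μ).indicator fun t => (t - μ) ^ m * (1 - t) ^ p := fun μ => by
    funext t
    by_cases h : t ∈ Set.Ioi μ <;> simp [h]
  have hint : ∀ μ : ℝ, ∀ u v : ℝ, IntervalIntegrable (fun t : ℝ =>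
      (Set.Ioi μ).indicator (fun t => (t - μ) ^ m) t * (1 - t) ^ p) volume u v := fun μ u v => by
    rw [hind, intervalIntegrable_iff]
    exact ((intervalIntegrable_iff.1 ((hcont μ).intervalIntegrable u v))).indicator
      measurableSet_Ioi
  have h1 : ∫ t in (0 : ℝ)..1, rieszMean lam m a (x * t) s * ((t ^ m * (1 - t) ^ p : ℝ) : ℂ) =
      ∫ t in (0 : ℝ)..1, ∑ n ∈ lam.below x, a n * Complex.exp (-(lam.val n : ℂ) * s) *
        (((Set.Ioi (lam.val n / x)).indicator (fun t => (t - lam.val n / x) ^ m) t *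
          (1 - t) ^ p : ℝ) : ℂ) := by
    refine intervalIntegral.integral_congr_ae (Eventually.of_forall fun t ht => ?_)
    rw [Set.uIoc_of_le zero_le_one] at ht
    rw [Complex.ofReal_mul, ← mul_assoc, rieszMean_mul_rpow hx ht, Finset.sum_mul]
    refine Finset.sum_congr rfl fun n _ => ?_
    rw [Complex.ofReal_mul, mul_assoc]
  rw [h1, intervalIntegral.integral_finsetSum, rieszMean, Finset.sum_mul]
  · refine Finset.sum_congr rfl fun n hn => ?_
    rw [intervalIntegral.integral_const_mul, intervalIntegral.integral_ofReal,
      mul_assoc (a n * Complex.exp (-(lam.val n : ℂ) * s))]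
    congr 1
    rw [← Complex.ofReal_mul]
    congr 1
    set μ := lam.val n / x
    have h0 : 0 ≤ μ := div_nonneg (lam.nonneg n) hx.le
    have h2 : μ < 1 := (div_lt_one hx).2 (Frequency.mem_below.1 hn)
    rw [← integral_beta_shift h2,
      ← intervalIntegral.integral_add_adjacent_intervals (hint μ 0 μ) (hint μ μ 1)]
    have e1 : ∫ t in (0 : ℝ)..μ, (Set.Ioi μ).indicator (fun t => (t - μ) ^ m) t * (1 - t) ^ p =
        0 := by
      rw [intervalIntegral.integral_congr_ae (g := fun _ => 0), intervalIntegral.integral_zero]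
      refine Eventually.of_forall fun t ht => ?_
      rw [Set.uIoc_of_le h0] at ht
      rw [Set.indicator_of_notMem (by simpa using ht.2), zero_mul]
    rw [e1, zero_add]
    refine intervalIntegral.integral_congr_ae (Eventually.of_forall fun t ht => ?_)
    rw [Set.uIoc_of_le h2.le] at ht
    rw [Set.indicator_of_mem (show t ∈ Set.Ioi μ from ht.1)]
  · intro n _
    have := hint (lam.val n / x) 0 1
    exact IntervalIntegrable.const_mul ⟨this.1.ofReal, this.2.ofReal⟩ _

/-- Riesz summability persists, with the same limit, when the order is raised. -/
theorem tendsto_rieszMean_order_add (hm : 0 ≤ m) {p : ℝ} (hp : 0 ≤ p)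
    (h : Tendsto (fun x : ℝ => rieszMean lam m a x s) atTop (𝓝 c)) :
    Tendsto (fun x : ℝ => rieszMean lam (m + p + 1) a x s) atTop (𝓝 c) := by
  obtain ⟨C, hC0, hC⟩ := exists_bound_rieszMean hm h
  set β := ∫ t in (0 : ℝ)..1, t ^ m * (1 - t) ^ p with hβ
  have hβ0 : (β : ℂ) ≠ 0 := by exact_mod_cast (integral_beta_pos hm hp).ne'
  have key : Tendsto (fun x : ℝ => ∫ t in (0 : ℝ)..1,
      rieszMean lam m a (x * t) s * ((t ^ m * (1 - t) ^ p : ℝ) : ℂ)) atTop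
      (𝓝 (∫ t in (0 : ℝ)..1, c * ((t ^ m * (1 - t) ^ p : ℝ) : ℂ))) := by
    refine intervalIntegral.tendsto_integral_filter_of_dominated_convergence (fun _ => C) ?_ ?_
      (by simp) ?_
    · filter_upwards [eventually_gt_atTop 0] with x hx
      have hmeas : Measurable fun t : ℝ => (∑ n ∈ lam.below x,
        a n * Complex.exp (-(lam.val n : ℂ) * s) *
        (((Set.Ioi (lam.val n / x)).indicator (fun t => (t - lam.val n / x) ^ m) t : ℝ) : ℂ)) *
        (((1 - t) ^ p : ℝ) : ℂ) := by
        refine Measurable.mul (Finset.measurable_sum _ fun n _ => ?_) (by fun_prop)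
        refine Measurable.const_mul (Complex.measurable_ofReal.comp ?_) _
        exact Measurable.indicator (by fun_prop) measurableSet_Ioi
      refine hmeas.aestronglyMeasurable.congr ?_
      rw [Set.uIoc_of_le zero_le_one]
      refine (ae_restrict_iff' measurableSet_Ioc).2 (Eventually.of_forall fun t ht => ?_)
      simp only
      rw [Complex.ofReal_mul, ← mul_assoc, rieszMean_mul_rpow hx ht]
    · filter_upwards [eventually_gt_atTop 0] with x hx
      refine Eventually.of_forall fun t ht => ?_
      rw [Set.uIoc_of_le zero_le_one] at ht
      rw [norm_mul, Complex.norm_real, Real.norm_of_nonneg (mul_nonneg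
        (Real.rpow_nonneg ht.1.le _) (Real.rpow_nonneg (by linarith [ht.2]) _))]
      have h1 := hC (x * t) (mul_pos hx ht.1)
      have h2 : t ^ m * (1 - t) ^ p ≤ 1 := mul_le_one₀ (Real.rpow_le_one ht.1.le ht.2 hm)
        (Real.rpow_nonneg (by linarith [ht.2]) _)
        (Real.rpow_le_one (by linarith [ht.2]) (by linarith [ht.1]) hp)
      exact (mul_le_of_le_one_right (norm_nonneg _) h2).trans h1
    · refine Eventually.of_forall fun t ht => ?_
      rw [Set.uIoc_of_le zero_le_one] at ht
      exact (h.comp (tendsto_id.atTop_mul_const ht.1)).mul_const _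
  rw [intervalIntegral.integral_const_mul, intervalIntegral.integral_ofReal, ← hβ] at key
  have := key.mul_const (β : ℂ)⁻¹
  rw [mul_inv_cancel_right₀ hβ0] at this
  refine this.congr' ?_
  filter_upwards [eventually_gt_atTop 0] with x hx
  rw [rieszMean_order_add hm hp hx, mul_inv_cancel_right₀ hβ0]

end Order

/-! ### A Volterra operator and the growth of Riesz means in the imaginary direction -/

section Volterra

/-- The Volterra operator `h ↦ h + z ∫₀ˣ h`. -/
def volterra (z : ℂ) (h : ℝ → ℂ) (x : ℝ) : ℂ := h x + z * ∫ u in (0 : ℝ)..x, h u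

/-- Interval integrability on all intervals. -/
def EverywhereIntervalIntegrable (h : ℝ → ℂ) : Prop := ∀ a b, IntervalIntegrable h volume a b

variable {z : ℂ} {h : ℝ → ℂ}

theorem EverywhereIntervalIntegrable.primitive (hh : EverywhereIntervalIntegrable h) :
    EverywhereIntervalIntegrable fun x => ∫ u in (0 : ℝ)..x, h u := fun a b =>
  (intervalIntegral.continuous_primitive hh 0).intervalIntegrable a b

theorem EverywhereIntervalIntegrable.volterra (hh : EverywhereIntervalIntegrable h) :
    EverywhereIntervalIntegrable (volterra z h) := fun a b =>
  (hh a b).add ((hh.primitive a b).const_mul z)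

theorem EverywhereIntervalIntegrable.iterate_volterra (hh : EverywhereIntervalIntegrable h)
    (j : ℕ) : EverywhereIntervalIntegrable ((_root_.volterra z)^[j] h) := by
  induction j with
  | zero => exact hh
  | succ j ih => rw [Function.iterate_succ_apply']; exact ih.volterra

theorem iterate_volterra_sum {ι : Type*} (S : Finset ι) (d : ι → ℂ) {G : ι → ℝ → ℂ}
    (hG : ∀ i, EverywhereIntervalIntegrable (G i)) (j : ℕ) :
    (volterra z)^[j] (fun x => ∑ i ∈ S, d i * G i x) =
      fun x => ∑ i ∈ S, d i * (volterra z)^[j] (G i) x := by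
  induction j with
  | zero => rfl
  | succ j ih =>
    funext x
    rw [Function.iterate_succ_apply', ih, volterra, intervalIntegral.integral_finsetSum fun i _ =>
      ((hG i).iterate_volterra j 0 x).const_mul (d i), Finset.mul_sum, ← Finset.sum_add_distrib]
    refine Finset.sum_congr rfl fun i _ => ?_
    rw [Function.iterate_succ_apply', volterra, intervalIntegral.integral_const_mul]
    ring

theorem iterate_volterra_const_mul (d : ℂ) (hh : EverywhereIntervalIntegrable h) (j : ℕ) :
    (volterra z)^[j] (fun x => d * h x) = fun x => d * (volterra z)^[j] h x := by
  simpa using iterate_volterra_sum (z := z) (Finset.univ : Finset Unit) (fun _ => d)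
    (G := fun _ => h) (fun _ => hh) j

theorem iterate_volterra_primitive (hh : EverywhereIntervalIntegrable h) (j : ℕ) :
    (volterra z)^[j] (fun x => ∫ u in (0 : ℝ)..x, h u) =
      fun x => ∫ u in (0 : ℝ)..x, (volterra z)^[j] h u := by
  induction j with
  | zero => rfl
  | succ j ih =>
    funext x
    rw [Function.iterate_succ_apply', ih, volterra]
    simp_rw [Function.iterate_succ_apply', volterra]
    rw [intervalIntegral.integral_add (hh.iterate_volterra j 0 x)
      (((hh.iterate_volterra j).primitive 0 x).const_mul z), intervalIntegral.integral_const_mul]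

/-- The truncated power `(x - l)₊ ^ k`. -/
def ramp (k : ℕ) (l : ℝ) : ℝ → ℂ := (Set.Ici l).indicator fun x => ((x - l : ℝ) : ℂ) ^ k

theorem ramp_of_le {k : ℕ} {l x : ℝ} (h : l ≤ x) : ramp k l x = ((x - l : ℝ) : ℂ) ^ k :=
  Set.indicator_of_mem h _

theorem ramp_of_lt {k : ℕ} {l x : ℝ} (h : x < l) : ramp k l x = 0 :=
  Set.indicator_of_notMem (by simpa using h) _

theorem ramp_zero_right {k : ℕ} {l : ℝ} (hl : 0 ≤ l) : ramp (k + 1) l 0 = 0 := by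
  rcases hl.eq_or_lt with rfl | h
  · rw [ramp_of_le le_rfl]; simp
  · exact ramp_of_lt h

theorem continuous_ramp_succ (k : ℕ) (l : ℝ) : Continuous (ramp (k + 1) l) := by
  have : ramp (k + 1) l = fun x => ((max (x - l) 0 : ℝ) : ℂ) ^ (k + 1) := by
    funext x
    rcases le_or_gt l x with h | h
    · rw [ramp_of_le h, max_eq_left (by linarith)]
    · rw [ramp_of_lt h, max_eq_right (by linarith)]; simp
  rw [this]; fun_prop

theorem everywhereIntervalIntegrable_mul_ramp {E : ℝ → ℂ} (hE : Continuous E) (k : ℕ) (l : ℝ) :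
    EverywhereIntervalIntegrable fun x => E x * ramp k l x := by
  intro a b
  have : (fun x => E x * ramp k l x) =
      (Set.Ici l).indicator fun x => E x * ((x - l : ℝ) : ℂ) ^ k := by
    funext x
    by_cases h : x ∈ Set.Ici l <;> simp [ramp, h]
  rw [this, intervalIntegrable_iff]
  exact (intervalIntegrable_iff.1 ((by fun_prop : Continuous fun x : ℝ =>
    E x * ((x - l : ℝ) : ℂ) ^ k).intervalIntegrable a b)).indicator measurableSet_Ici

/-- Truncated functions have right derivatives even at the truncation point; the fundamental theorem
for continuous functions with right derivatives needs no more. -/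
theorem hasDerivWithinAt_indicator_Ici {G G' : ℝ → ℂ} (hG : ∀ x, HasDerivAt G (G' x) x) (l x : ℝ) :
    HasDerivWithinAt ((Set.Ici l).indicator G) ((Set.Ici l).indicator G' x) (Set.Ioi x) x := by
  rcases le_or_gt l x with h | h
  · rw [Set.indicator_of_mem (show x ∈ Set.Ici l from h)]
    refine (hG x).hasDerivWithinAt.congr (fun y hy => ?_) ?_
    · exact Set.indicator_of_mem (show y ∈ Set.Ici l from h.trans (le_of_lt hy)) _
    · exact Set.indicator_of_mem (show x ∈ Set.Ici l from h) _
  · rw [Set.indicator_of_notMem (by simpa using h)]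
    refine ((hasDerivAt_const x (0 : ℂ)).congr_of_eventuallyEq ?_).hasDerivWithinAt
    filter_upwards [Iio_mem_nhds h] with y hy
    exact Set.indicator_of_notMem (by simpa using hy) _

theorem hasDerivAt_exp_neg_mul_ofReal (z : ℂ) (x : ℝ) :
    HasDerivAt (fun x : ℝ => Complex.exp (-z * x)) (-z * Complex.exp (-z * x)) x := by
  have := ((HasDerivAt.ofReal_comp (f := fun x => x) (hasDerivAt_id x)).const_mul (-z)).cexp
  refine this.congr_deriv ?_
  simp; ring

theorem hasDerivAt_ofReal_sub_pow (k : ℕ) (l x : ℝ) :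
    HasDerivAt (fun x : ℝ => ((x - l : ℝ) : ℂ) ^ (k + 1)) ((k + 1) * ((x - l : ℝ) : ℂ) ^ k) x := by
  have := (HasDerivAt.ofReal_comp (f := fun x => x - l) ((hasDerivAt_id x).sub_const l)).pow (k + 1)
  refine this.congr_deriv ?_
  simp

theorem integral_ramp {l : ℝ} (hl : 0 ≤ l) (k : ℕ) (x : ℝ) :
    (k + 1) * ∫ u in (0 : ℝ)..x, ramp k l u = ramp (k + 1) l x := by
  have := intervalIntegral.integral_eq_sub_of_hasDeriv_right (a := 0) (b := x)
    (f := ramp (k + 1) l) (f' := fun u => (k + 1) * ramp k l u)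
    (continuous_ramp_succ k l).continuousOn (fun u _ => by
      have := hasDerivWithinAt_indicator_Ici (hasDerivAt_ofReal_sub_pow k l) l u
      refine this.congr_deriv ?_
      simp only [ramp]
      by_cases h : u ∈ Set.Ici l <;> simp [h])
    (everywhereIntervalIntegrable_mul_ramp continuous_const k l 0 x)
  rw [intervalIntegral.integral_const_mul, ramp_zero_right hl, sub_zero] at this
  exact this

theorem volterra_exp_mul_ramp_zero {l : ℝ} (hl : 0 ≤ l) (x : ℝ) :
    volterra z (fun x => Complex.exp (-z * x) * ramp 0 l x) x =
      Complex.exp (-z * l) * ramp 0 l x := by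
  -- Subtracting the value at l makes the truncated primitive continuous there.
  set G : ℝ → ℂ := fun x => Complex.exp (-z * x) - Complex.exp (-z * l) with hG
  have hcont : Continuous ((Set.Ici l).indicator G) := by
    have : (Set.Ici l).indicator G = fun x => G (max x l) := by
      funext x
      rcases le_or_gt l x with h | h
      · rw [Set.indicator_of_mem (show x ∈ Set.Ici l from h), max_eq_left h]
      · rw [Set.indicator_of_notMem (by simpa using h), max_eq_right h.le]; simp [hG]
    rw [this]; fun_prop
  have h0 : (Set.Ici l).indicator G 0 = 0 := by
    rcases hl.eq_or_lt with rfl | h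
    · simp [hG]
    · exact Set.indicator_of_notMem (by simpa using h) _
  have := intervalIntegral.integral_eq_sub_of_hasDeriv_right (a := 0) (b := x)
    (f := (Set.Ici l).indicator G) (f' := fun u => -z * (Complex.exp (-z * u) * ramp 0 l u))
    hcont.continuousOn (fun u _ => by
      have := hasDerivWithinAt_indicator_Ici
        (fun x => (hasDerivAt_exp_neg_mul_ofReal z x).sub_const (Complex.exp (-z * l))) l u
      refine this.congr_deriv ?_
      simp only [ramp]
      by_cases h : u ∈ Set.Ici l <;> simp [h])
    ((everywhereIntervalIntegrable_mul_ramp (by fun_prop) 0 l 0 x).const_mul (-z))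
  rw [intervalIntegral.integral_const_mul, h0, sub_zero, neg_mul] at this
  rw [volterra, neg_eq_iff_eq_neg.1 this]
  rcases le_or_gt l x with h | h
  · rw [Set.indicator_of_mem (show x ∈ Set.Ici l from h), ramp_of_le h]; simp [hG]
  · rw [Set.indicator_of_notMem (by simpa using h), ramp_of_lt h]; simp

/-- By the product rule, the term -z e^{-zu}(u - l)₊^{k+1} of the derivative is cancelled by the
Volterra integral; the other term lowers the power by one. -/
theorem volterra_exp_mul_ramp_succ {l : ℝ} (hl : 0 ≤ l) (k : ℕ) (x : ℝ) :
    volterra z (fun x => Complex.exp (-z * x) * ramp (k + 1) l x) x =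
      (k + 1) * ∫ u in (0 : ℝ)..x, Complex.exp (-z * u) * ramp k l u := by
  have hc := continuous_ramp_succ k l
  have hi1 := everywhereIntervalIntegrable_mul_ramp
    (by fun_prop : Continuous fun u : ℝ => Complex.exp (-z * u)) (k + 1) l 0 x
  have hi2 := everywhereIntervalIntegrable_mul_ramp
    (by fun_prop : Continuous fun u : ℝ => Complex.exp (-z * u)) k l 0 x
  have := intervalIntegral.integral_eq_sub_of_hasDeriv_right (a := 0) (b := x)
    (f := fun u => Complex.exp (-z * u) * ramp (k + 1) l u)
    (f' := fun u => -z * (Complex.exp (-z * u) * ramp (k + 1) l u) +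
      (k + 1) * (Complex.exp (-z * u) * ramp k l u))
    (by fun_prop) (fun u _ => by
      have := (hasDerivAt_exp_neg_mul_ofReal z u).hasDerivWithinAt.mul
        (hasDerivWithinAt_indicator_Ici (hasDerivAt_ofReal_sub_pow k l) l u)
      refine this.congr_deriv ?_
      simp only [ramp]
      by_cases h : u ∈ Set.Ici l
      · simp [h]; ring
      · simp [h])
    ((hi1.const_mul _).add (hi2.const_mul _))
  rw [intervalIntegral.integral_add (hi1.const_mul _) (hi2.const_mul _),
    intervalIntegral.integral_const_mul, intervalIntegral.integral_const_mul, ramp_zero_right hl,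
    mul_zero, sub_zero] at this
  rw [volterra, ← this]
  ring

/-- With J the primitive from 0, the operator 1 + zJ commutes with J and turns e^{-zx} J g into
J(e^{-zx} g). Each application moves the exponential inside one integration, and the last freezes it
at l. The operator is the same for all l, so it maps whole Riesz sums at s₀ to those at s₀ + z. -/
theorem iterate_volterra_exp_mul_ramp {l : ℝ} (hl : 0 ≤ l) (k : ℕ) :
    (volterra z)^[k + 1] (fun x => Complex.exp (-z * x) * ramp k l x) =
      fun x => Complex.exp (-z * l) * ramp k l x := by
  induction k with
  | zero => funext x; exact volterra_exp_mul_ramp_zero hl x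
  | succ k ih =>
    have hi := everywhereIntervalIntegrable_mul_ramp
      (by fun_prop : Continuous fun u : ℝ => Complex.exp (-z * u)) k l
    rw [Function.iterate_succ_apply, funext (volterra_exp_mul_ramp_succ hl k),
      iterate_volterra_const_mul _ hi.primitive, iterate_volterra_primitive hi, ih]
    funext x
    simp only [intervalIntegral.integral_const_mul]
    rw [← integral_ramp hl k x]
    ring

/-- Half of the exponential decay absorbs the power, through v^k/k! ≤ e^v with v = δu/2. -/
theorem pow_mul_exp_neg_le {δ : ℝ} (hδ : 0 < δ) (k : ℕ) {u : ℝ} (hu : 0 ≤ u) :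
    u ^ k * Real.exp (-δ * u) ≤ (k.factorial * (2 / δ) ^ k) * Real.exp (-(δ / 2) * u) := by
  have h1 := Real.pow_div_factorial_le_exp (δ / 2 * u) (by positivity) k
  rw [div_le_iff₀ (by positivity), mul_pow] at h1
  have h2 : Real.exp (-δ * u) = Real.exp (-(δ / 2) * u) * Real.exp (-(δ / 2) * u) := by
    rw [← Real.exp_add]; ring_nf
  have h3 : Real.exp (δ / 2 * u) * Real.exp (-(δ / 2) * u) = 1 := by
    rw [← Real.exp_add]; simp
  have h4 : (2 / δ) ^ k * (δ / 2) ^ k = 1 := by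
    rw [← mul_pow]; field_simp; simp
  have hE := Real.exp_pos (-(δ / 2) * u)
  calc u ^ k * Real.exp (-δ * u) =
      (2 / δ) ^ k * ((δ / 2) ^ k * u ^ k) * (Real.exp (-(δ / 2) * u) * Real.exp (-(δ / 2) * u)) := by
        rw [h2, ← mul_assoc _ _ (u ^ k), h4, one_mul]
    _ ≤ (2 / δ) ^ k * (Real.exp (δ / 2 * u) * k.factorial) *
        (Real.exp (-(δ / 2) * u) * Real.exp (-(δ / 2) * u)) := by gcongr
    _ = (k.factorial * (2 / δ) ^ k) * Real.exp (-(δ / 2) * u) *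
        (Real.exp (δ / 2 * u) * Real.exp (-(δ / 2) * u)) := by ring
    _ = _ := by rw [h3, mul_one]

/-- The first application costs no power of x, since the decaying exponential is integrable; each
later one costs a factor 1 + x. Thus k + 1 applications give only (1 + x)^k, which the x^k in the
Riesz sums cancels. -/
theorem norm_iterate_volterra_le {D δ X : ℝ} (hD : 0 ≤ D) (hδ : 0 < δ)
    (hb : ∀ u, 0 ≤ u → u ≤ X → ‖h u‖ ≤ D * Real.exp (-δ * u)) (j : ℕ) :
    ∀ x, 0 ≤ x → x ≤ X → ‖(volterra z)^[j + 1] h x‖ ≤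
      D * (1 + 1 / δ) * (1 + ‖z‖) ^ (j + 1) * (1 + x) ^ j := by
  induction j with
  | zero =>
    intro x hx hxX
    have h1 : ‖∫ u in (0 : ℝ)..x, h u‖ ≤ D * (1 / δ) := by
      have hi : ∫ u in (0 : ℝ)..x, D * Real.exp (-δ * u) = D * ((1 - Real.exp (-δ * x)) / δ) := by
        rw [intervalIntegral.integral_const_mul,
          intervalIntegral.integral_comp_mul_left (fun u => Real.exp u) (by linarith : -δ ≠ 0)]
        simp
        field_simp; ring
      have := intervalIntegral.norm_integral_le_of_norm_le (μ := volume) (f := h) hx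
        (g := fun u => D * Real.exp (-δ * u))
        (Eventually.of_forall fun u hu => hb u hu.1.le (hu.2.trans hxX))
        ((by fun_prop : Continuous fun u => D * Real.exp (-δ * u)).intervalIntegrable _ _)
      rw [hi] at this
      refine this.trans ?_
      gcongr
      linarith [Real.exp_pos (-δ * x)]
    have h2 : ‖h x‖ ≤ D := (hb x hx hxX).trans (mul_le_of_le_one_right hD
      (Real.exp_le_one_iff.2 (by nlinarith)))
    simp only [zero_add, Function.iterate_one, pow_one, pow_zero, mul_one]
    rw [volterra]
    calc _ ≤ ‖h x‖ + ‖z‖ * ‖∫ u in (0 : ℝ)..x, h u‖ := by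
          rw [← norm_mul]; exact norm_add_le _ _
      _ ≤ D + ‖z‖ * (D * (1 / δ)) := by gcongr
      _ ≤ D * (1 + 1 / δ) * (1 + ‖z‖) := by
          have h3 : 0 ≤ D * (1 / δ) := by positivity
          have h4 : 0 ≤ D * ‖z‖ := by positivity
          linear_combination h3 + h4
  | succ j ih =>
    intro x hx hxX
    set M := D * (1 + 1 / δ) * (1 + ‖z‖) ^ (j + 1) with hM
    have hM0 : 0 ≤ M := by positivity
    have h1 := ih x hx hxX
    have h2 : ‖∫ u in (0 : ℝ)..x, (volterra z)^[j + 1] h u‖ ≤ M * (1 + x) ^ j * x := by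
      have := intervalIntegral.norm_integral_le_of_norm_le_const (a := 0) (b := x)
        (f := (volterra z)^[j + 1] h) (C := M * (1 + x) ^ j) fun u hu => by
          rw [Set.uIoc_of_le hx] at hu
          refine (ih u hu.1.le (hu.2.trans hxX)).trans ?_
          have := hu.1.le
          have := hu.2
          gcongr
      rwa [sub_zero, abs_of_nonneg hx] at this
    rw [Function.iterate_succ_apply', volterra]
    calc _ ≤ ‖(volterra z)^[j + 1] h x‖ + ‖z‖ * ‖∫ u in (0 : ℝ)..x, (volterra z)^[j + 1] h u‖ := by
          rw [← norm_mul]; exact norm_add_le _ _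
      _ ≤ M * (1 + x) ^ j + ‖z‖ * (M * (1 + x) ^ j * x) := by gcongr
      _ ≤ M * (1 + x) ^ j * ((1 + ‖z‖) * (1 + x)) := by
          have h3 : 0 ≤ M * (1 + x) ^ j := by positivity
          have h4 : 1 + ‖z‖ * x ≤ (1 + ‖z‖) * (1 + x) := by
            linear_combination norm_nonneg z + hx
          calc _ = M * (1 + x) ^ j * (1 + ‖z‖ * x) := by ring
            _ ≤ _ := by gcongr
      _ = _ := by rw [hM]; ring

end Volterra

/-- Bounded Riesz means at one point have at most polynomial growth on lines further right. -/
theorem exists_bound_rieszMean_add {lam : Frequency} {k : ℕ} (hk : k ≠ 0) {a : ℕ → ℂ} {s₀ : ℂ}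
    {C : ℝ} (hC0 : 0 ≤ C) (hC : ∀ x, 0 < x → ‖rieszMean lam k a x s₀‖ ≤ C) {δ : ℝ} (hδ : 0 < δ) :
    ∃ M : ℝ, 0 ≤ M ∧ ∀ z : ℂ, z.re = δ → ∀ x, 1 ≤ x →
      ‖rieszMean lam k a x (s₀ + z)‖ ≤ M * (1 + ‖z‖) ^ (k + 1) := by
  set D := C * (k.factorial * (2 / δ) ^ k) with hD
  refine ⟨D * (1 + 1 / (δ / 2)) * 2 ^ k, by positivity, fun z hz x hx => ?_⟩
  have hx0 : 0 < x := by linarith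
  obtain ⟨k', rfl⟩ := Nat.exists_eq_succ_of_ne_zero hk
  set k := k'.succ with hkdef
  set d : ℕ → ℂ := fun n => a n * Complex.exp (-(lam.val n : ℂ) * s₀) with hd
  have hterm : ∀ u : ℝ, 0 < u → ∀ n, lam.val n ≤ u →
      (u : ℂ) ^ k * (((1 - lam.val n / u) ^ (k : ℝ) : ℝ) : ℂ) = ramp k (lam.val n) u := by
    intro u hu n hn
    have hu' : (u : ℂ) ≠ 0 := by exact_mod_cast hu.ne'
    rw [ramp_of_le hn, Real.rpow_natCast, Complex.ofReal_pow, ← mul_pow]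
    congr 1
    push_cast
    field_simp
  have hA : ∀ u, 0 ≤ u → u ≤ x →
      ‖∑ n ∈ lam.below x, d n * ramp k (lam.val n) u‖ ≤ C * u ^ k := by
    intro u hu hux
    rcases hu.eq_or_lt with rfl | hu
    · rw [Finset.sum_eq_zero fun n _ => by rw [ramp_zero_right (lam.nonneg n), mul_zero]]
      simp [hkdef]
    have hsub : lam.below u ⊆ lam.below x := fun n hn => by
      rw [Frequency.mem_below] at hn ⊢; linarith
    rw [← Finset.sum_subset hsub]
    · have : ∑ n ∈ lam.below u, d n * ramp k (lam.val n) u = (u : ℂ) ^ k * rieszMean lam k a u s₀ := by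
        rw [rieszMean, Finset.mul_sum]
        refine Finset.sum_congr rfl fun n hn => ?_
        rw [← hterm u hu n (Frequency.mem_below.1 hn).le]; ring
      rw [this, norm_mul, norm_pow, Complex.norm_real, Real.norm_of_nonneg hu.le, mul_comm C]
      gcongr
      exact hC u hu
    · intro n _ hn
      rw [Frequency.mem_below, not_lt] at hn
      -- At λ_n = u the ramp is not cut off, but its value 0^k is zero because k ≠ 0; so the strict
      -- inequality in `below` does no harm.
      rcases hn.eq_or_lt with h | h
      · rw [h, ramp_of_le le_rfl]; simp [hkdef]
      · rw [ramp_of_lt h, mul_zero]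
  have hG : ∀ n, EverywhereIntervalIntegrable fun u : ℝ =>
      Complex.exp (-z * u) * ramp k (lam.val n) u := fun n =>
    everywhereIntervalIntegrable_mul_ramp (by fun_prop) k (lam.val n)
  have hb : ∀ u, 0 ≤ u → u ≤ x → ‖∑ n ∈ lam.below x,
      d n * (Complex.exp (-z * u) * ramp k (lam.val n) u)‖ ≤ D * Real.exp (-(δ / 2) * u) := by
    intro u hu hux
    have : ∑ n ∈ lam.below x, d n * (Complex.exp (-z * u) * ramp k (lam.val n) u) =
        Complex.exp (-z * u) * ∑ n ∈ lam.below x, d n * ramp k (lam.val n) u := by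
      rw [Finset.mul_sum]; exact Finset.sum_congr rfl fun n _ => by ring
    rw [this, norm_mul, Complex.norm_exp]
    have hre : (-z * u).re = -δ * u := by simp [hz]
    rw [hre]
    calc _ ≤ Real.exp (-δ * u) * (C * u ^ k) := by gcongr; exact hA u hu hux
      _ = C * (u ^ k * Real.exp (-δ * u)) := by ring
      _ ≤ C * (k.factorial * (2 / δ) ^ k * Real.exp (-(δ / 2) * u)) := by
          exact mul_le_mul_of_nonneg_left (pow_mul_exp_neg_le hδ k hu) hC0
      _ = _ := by rw [hD]; ring
  -- Applied to e^{-zu} u^k times the Riesz mean at s₀, whose iterate is x^k times the Riesz mean at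
  -- s₀ + z.
  have key := norm_iterate_volterra_le (z := z) (by positivity) (half_pos hδ) hb k x hx0.le le_rfl
  rw [iterate_volterra_sum _ _ hG] at key
  simp_rw [iterate_volterra_exp_mul_ramp (lam.nonneg _)] at key
  have e : ∑ n ∈ lam.below x, d n * (Complex.exp (-z * lam.val n) * ramp k (lam.val n) x) =
      (x : ℂ) ^ k * rieszMean lam k a x (s₀ + z) := by
    rw [rieszMean, Finset.mul_sum]
    refine Finset.sum_congr rfl fun n hn => ?_
    rw [← hterm x hx0 n (Frequency.mem_below.1 hn).le]
    have : Complex.exp (-(lam.val n : ℂ) * (s₀ + z)) =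
        Complex.exp (-(lam.val n : ℂ) * s₀) * Complex.exp (-z * lam.val n) := by
      rw [← Complex.exp_add]; ring_nf
    rw [this]; simp only [hd]; ring
  rw [e, norm_mul, norm_pow, Complex.norm_real, Real.norm_of_nonneg hx0.le] at key
  -- This comparison is where x ≥ 1 enters.
  have h2 : (1 + x) ^ k ≤ 2 ^ k * x ^ k := by
    rw [← mul_pow]; gcongr; linarith
  have hxk : 0 < x ^ k := by positivity
  refine le_of_mul_le_mul_left (key.trans ?_) hxk
  calc _ ≤ D * (1 + 1 / (δ / 2)) * (1 + ‖z‖) ^ (k + 1) * (2 ^ k * x ^ k) := by gcongr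
    _ = _ := by ring

/-! ### From a Riesz germ to almost periodicity and Bohr coefficients -/

section

variable {lam : Frequency} {f : RightHalfPlane → ℂ} {a : ℕ → ℂ}

/-- A Riesz germ may be taken of positive integral order. -/
theorem IsRieszGerm.exists_nat (h : IsRieszGerm lam a f) : ∃ k : ℕ, k ≠ 0 ∧ ∃ σ : ℝ,
    ∀ s : ℂ, 0 < s.re → σ < s.re →
      Tendsto (fun x : ℝ => rieszMean lam k a x s) atTop (𝓝 (extendByZero f s)) := by
  obtain ⟨m, hm, σ, h⟩ := h
  refine ⟨⌈m⌉₊ + 1, by omega, σ, fun s hs hσ => ?_⟩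
  have h1 := h ⟨s, hs⟩ hσ
  rw [← extendByZero_apply f] at h1
  -- Adding p + 1 with p = ⌈m⌉ - m gives the order ⌈m⌉ + 1, a positive integer.
  have hp : 0 ≤ (⌈m⌉₊ : ℝ) - m := sub_nonneg.2 (Nat.le_ceil m)
  have := tendsto_rieszMean_order_add hm hp h1
  rw [show m + ((⌈m⌉₊ : ℝ) - m) + 1 = ((⌈m⌉₊ + 1 : ℕ) : ℝ) by push_cast; ring] at this
  exact this

theorem rieszMean_eq_dirichletPoly (k : ℕ) (x : ℝ) (s : ℂ) :
    rieszMean lam k a x s = dirichletPoly lam (lam.below x)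
      (fun n => a n * ((1 - lam.val n / x : ℝ) : ℂ) ^ k) s := by
  rw [rieszMean, dirichletPoly]
  refine Finset.sum_congr rfl fun n _ => ?_
  rw [Real.rpow_natCast, Complex.ofReal_pow]; ring

/-- Convolution turns a bounded function with a Riesz germ into a Dirichlet polynomial. -/
theorem IsRieszGerm.vconv_eq_dirichletPoly (h : IsRieszGerm lam a f)
    (hF : DifferentiableOn ℂ (extendByZero f) {s : ℂ | 0 < s.re}) {B : ℝ}
    (hB : ∀ s : ℂ, 0 < s.re → ‖extendByZero f s‖ ≤ B) {φ K : ℝ → ℂ}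
    (hφ0 : ∀ x, 1 ≤ |x| → φ x = 0) (hKc : Continuous K)
    (hK : ∀ k : ℕ, Integrable fun w => (1 + |w|) ^ k * ‖K w‖)
    (hφ : ∀ ξ : ℝ, ∫ w : ℝ, Complex.exp (Complex.I * ((ξ * (2 * Real.pi * w) : ℝ) : ℂ)) * K w = φ ξ)
    {y : ℝ} (hy : 0 < y) {s : ℂ} (hs : 0 < s.re) :
    vconv (extendByZero f) K (2 * Real.pi / y) s =
      dirichletPoly lam (lam.below y) (fun n => a n * φ (lam.val n / y)) s := by
  obtain ⟨k, hk, σ, h⟩ := h.exists_nat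
  have hKi : Integrable K := by
    have := hK 0
    simp only [pow_zero, one_mul] at this
    exact (integrable_norm_iff hKc.aestronglyMeasurable).1 this
  set F := extendByZero f with hFdef
  set q := 2 * Real.pi / y with hq
  -- A point of summability inside the half-plane. The identity is proved on the line one unit to
  -- its right, where the growth bound applies with δ = 1.
  set s₀ : ℝ := max σ 0 + 1 with hs₀
  have hs₀σ : σ < s₀ := by linarith [le_max_left σ 0]
  have hs₀0 : 0 < s₀ := by linarith [le_max_right σ 0]
  obtain ⟨C, hC0, hC⟩ := exists_bound_rieszMean (Nat.cast_nonneg k)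
    (h s₀ (by simpa using hs₀0) (by simpa using hs₀σ))
  obtain ⟨M, hM0, hM⟩ := exists_bound_rieszMean_add hk hC0 hC one_pos
  refine eqOn_rightHalfPlane_of_eq_on_line (σ := s₀ + 1) (differentiableOn_vconv hF hB hKi q)
    (differentiable_dirichletPoly _ _ _).differentiableOn (by linarith) (fun t => ?_) hs
  set s₁ : ℂ := ((s₀ + 1 : ℝ) : ℂ) + t * Complex.I with hs₁
  have hs₁re : s₁.re = s₀ + 1 := by simp [hs₁]
  -- Dominated convergence: on this line the means grow at most like the power k + 1 of the height,
  -- uniformly in x ≥ 1, and K has all such moments.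
  have lim1 : Tendsto (fun x : ℝ => ∫ w, rieszMean lam k a x (verticalShift s₁ (q * w)) * K w) atTop
      (𝓝 (vconv F K q s₁)) := by
    set A := 1 + ‖s₁ - s₀‖ + |q| with hA
    have hA0 : 0 ≤ A := by positivity
    refine tendsto_integral_filter_of_dominated_convergence
      (fun w => M * A ^ (k + 1) * ((1 + |w|) ^ (k + 1) * ‖K w‖)) ?_ ?_ ((hK (k + 1)).const_mul _) ?_
    · refine Eventually.of_forall fun x => Continuous.aestronglyMeasurable ?_
      unfold rieszMean verticalShift
      fun_prop
    · filter_upwards [eventually_ge_atTop 1] with x hx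
      refine Eventually.of_forall fun w => ?_
      rw [norm_mul, ← mul_assoc]
      gcongr
      have e : verticalShift s₁ (q * w) = s₀ + (verticalShift s₁ (q * w) - s₀) := by ring
      rw [e]
      refine (hM _ (by rw [Complex.sub_re, verticalShift_re, hs₁re]; simp) x hx).trans ?_
      rw [mul_assoc, ← mul_pow]
      gcongr
      have h1 : ‖verticalShift s₁ (q * w) - s₀‖ ≤ ‖s₁ - s₀‖ + |q| * |w| := by
        have e : verticalShift s₁ (q * w) - s₀ = (s₁ - s₀) - ((q * w : ℝ) : ℂ) * Complex.I := by
          simp only [verticalShift]; ring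
        rw [e]
        refine (norm_sub_le _ _).trans (le_of_eq ?_)
        simp
      have h2 : 0 ≤ ‖s₁ - s₀‖ * |w| := by positivity
      have h3 := abs_nonneg w
      have h4 := abs_nonneg q
      rw [hA]
      linear_combination h1 + h2 + h3 + h4
    · refine Eventually.of_forall fun w => Tendsto.mul_const _ (h _ ?_ ?_)
      · rw [verticalShift_re, hs₁re]; linarith
      · rw [verticalShift_re, hs₁re]; linarith
  have lim2 : Tendsto (fun x : ℝ => dirichletPoly lam (lam.below y)
      (fun n => a n * ((1 - lam.val n / x : ℝ) : ℂ) ^ k * φ (lam.val n / y)) s₁) atTop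
      (𝓝 (dirichletPoly lam (lam.below y) (fun n => a n * φ (lam.val n / y)) s₁)) := by
    refine tendsto_finsetSum _ fun n _ => Tendsto.mul_const _ (Tendsto.mul_const _ ?_)
    have h1 : Tendsto (fun x : ℝ => lam.val n / x) atTop (𝓝 0) :=
      tendsto_const_nhds.div_atTop tendsto_id
    have h2 : Tendsto (fun x : ℝ => ((1 - lam.val n / x : ℝ) : ℂ) ^ k) atTop (𝓝 (((1 - 0 : ℝ) : ℂ) ^ k)) :=
      ((Complex.continuous_ofReal.tendsto _).comp (h1.const_sub 1)).pow k
    simpa using h2.const_mul (a n)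
  refine tendsto_nhds_unique (lim1.congr' ?_) lim2
  -- Once x ≥ y, the factor φ(λ_n/y) removes all terms with y ≤ λ_n < x, so the number of terms no
  -- longer depends on x.
  filter_upwards [eventually_ge_atTop y] with x hx
  have h1 := vconv_dirichletPoly lam (lam.below x)
    (fun n => a n * ((1 - lam.val n / x : ℝ) : ℂ) ^ k) hKi hφ y s₁
  simp only [rieszMean_eq_dirichletPoly]
  rw [vconv] at h1
  rw [h1, dirichletPoly, dirichletPoly]
  refine (Finset.sum_subset (fun n hn => ?_) fun n _ hn => ?_).symm
  · rw [Frequency.mem_below] at hn ⊢; linarith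
  · rw [Frequency.mem_below, not_lt] at hn
    rw [hφ0, mul_zero, zero_mul]
    rw [abs_of_nonneg (div_nonneg (lam.nonneg n) hy.le)]
    exact (one_le_div hy).2 hn

/-- A bounded function with a Riesz germ is approximated by Dirichlet polynomials, uniformly on
vertical lines. -/
theorem IsRieszGerm.exists_uniform_approx (h : IsRieszGerm lam a f)
    (hF : DifferentiableOn ℂ (extendByZero f) {s : ℂ | 0 < s.re}) {B : ℝ}
    (hB : ∀ s : ℂ, 0 < s.re → ‖extendByZero f s‖ ≤ B) :
    ∃ φ : ℝ → ℂ, φ 0 = 1 ∧ Continuous φ ∧ ∀ σ : ℝ, 0 < σ → ∀ ε : ℝ, 0 < ε →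
      ∀ᶠ y : ℝ in atTop, ∀ t : ℝ, ‖extendByZero f (σ + t * Complex.I) -
        dirichletPoly lam (lam.below y) (fun n => a n * φ (lam.val n / y))
          (σ + t * Complex.I)‖ ≤ ε := by
  obtain ⟨φ, K, hφ1, hφc, hφ0, hKc, hK, hφ⟩ := exists_rapidly_decaying_kernel
  refine ⟨φ, hφ1, hφc, fun σ hσ ε hε => ?_⟩
  have hKi : Integrable K := by
    have := hK 0
    simp only [pow_zero, one_mul] at this
    exact (integrable_norm_iff hKc.aestronglyMeasurable).1 this
  have hK1 : ∫ w, K w = 1 := by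
    have := hφ 0
    simpa [hφ1] using this
  have hK2 : Integrable fun w => |w| * ‖K w‖ := by
    refine (hK 1).mono' (by fun_prop) (Eventually.of_forall fun w => ?_)
    rw [Real.norm_of_nonneg (by positivity), pow_one]
    gcongr
    linarith
  have hlim : Tendsto (fun y : ℝ => 2 * B / σ * |2 * Real.pi / y| * ∫ w, |w| * ‖K w‖) atTop
      (𝓝 (2 * B / σ * |0| * ∫ w, |w| * ‖K w‖)) :=
    ((tendsto_const_nhds.div_atTop tendsto_id).abs.const_mul _).mul_const _
  rw [abs_zero, mul_zero, zero_mul] at hlim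
  filter_upwards [eventually_gt_atTop 0, hlim.eventually_le_const hε] with y hy hyε t
  have hre : ((σ : ℂ) + t * Complex.I).re = σ := by simp
  rw [← h.vconv_eq_dirichletPoly hF hB hφ0 hKc hK hφ hy (by rw [hre]; exact hσ), norm_sub_rev]
  exact (norm_vconv_sub_le hF hB hKi hK1 hK2 hσ hre.ge _).trans hyε

theorem continuous_comp_line {F : ℂ → ℂ} (hF : DifferentiableOn ℂ F {s : ℂ | 0 < s.re}) {σ : ℝ}
    (hσ : 0 < σ) : Continuous fun t : ℝ => F (σ + t * Complex.I) :=
  hF.continuousOn.comp_continuous (by fun_prop) fun t => by simpa using hσ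

theorem IsRieszGerm.uniformlyAlmostPeriodic (h : IsRieszGerm lam a f)
    (hF : DifferentiableOn ℂ (extendByZero f) {s : ℂ | 0 < s.re}) {B : ℝ}
    (hB : ∀ s : ℂ, 0 < s.re → ‖extendByZero f s‖ ≤ B) {σ : ℝ} (hσ : 0 < σ) :
    UniformlyAlmostPeriodic fun t : ℝ => extendByZero f (σ + t * Complex.I) := by
  obtain ⟨φ, -, -, happ⟩ := h.exists_uniform_approx hF hB
  refine UniformlyAlmostPeriodic.of_uniform_approx (continuous_comp_line hF hσ) fun ε hε => ?_
  obtain ⟨y, hy⟩ := (happ σ hσ ε hε).exists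
  exact ⟨_, uniformlyAlmostPeriodic_dirichletPoly lam _ _ σ, hy⟩

/-- Bohr coefficients pass to uniform limits on lines. The hypothesis runs over all multipliers φ
because `exists_uniform_approx` supplies one of which only φ(0) = 1 and continuity are kept. -/
theorem IsRieszGerm.hasBohrCoeff (h : IsRieszGerm lam a f)
    (hF : DifferentiableOn ℂ (extendByZero f) {s : ℂ | 0 < s.re}) {B : ℝ}
    (hB : ∀ s : ℂ, 0 < s.re → ‖extendByZero f s‖ ≤ B) {ξ : ℝ} {c : ℂ}
    (hc : ∀ φ : ℝ → ℂ, φ 0 = 1 → Continuous φ → Tendsto (fun y : ℝ => ∑ n ∈ lam.below y,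
      a n * φ (lam.val n / y) * if lam.val n = ξ then 1 else 0) atTop (𝓝 c)) :
    HasBohrCoeff f ξ c := by
  obtain ⟨φ, hφ1, hφc, happ⟩ := h.exists_uniform_approx hF hB
  refine hasBohrCoeff_iff.2 fun σ hσ => ?_
  have hgc := continuous_comp_line hF hσ
  refine tendsto_bohrMean_of_uniform_approx (by fun_prop) fun ε hε => ?_
  have hE : ∀ t : ℝ, ‖Complex.exp ((σ + t * Complex.I) * (ξ : ℂ))‖ = Real.exp (σ * ξ) := fun t => by
    rw [Complex.norm_exp]; simp
  obtain ⟨y, hy, hyc⟩ := ((happ σ hσ (ε / Real.exp (σ * ξ)) (by positivity)).and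
    ((hc φ hφ1 hφc).eventually (Metric.closedBall_mem_nhds c hε))).exists
  refine ⟨_, _, ?_, fun t => ?_, tendsto_bohrMean_dirichletPoly lam (lam.below y)
    (fun n => a n * φ (lam.val n / y)) σ ξ, by rwa [← dist_eq_norm]⟩
  · exact (uniformlyAlmostPeriodic_dirichletPoly lam _ _ σ).1.mul (by fun_prop)
  · rw [← sub_mul, norm_mul, hE, ← le_div_iff₀ (Real.exp_pos _)]
    exact hy t

theorem IsRieszGerm.hasBohrCoeff_val (h : IsRieszGerm lam a f)
    (hF : DifferentiableOn ℂ (extendByZero f) {s : ℂ | 0 < s.re}) {B : ℝ}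
    (hB : ∀ s : ℂ, 0 < s.re → ‖extendByZero f s‖ ≤ B) (m : ℕ) :
    HasBohrCoeff f (lam.val m) (a m) := by
  refine h.hasBohrCoeff hF hB fun φ hφ1 hφc => ?_
  have h1 : Tendsto (fun y : ℝ => lam.val m / y) atTop (𝓝 0) :=
    tendsto_const_nhds.div_atTop tendsto_id
  have h2 := ((hφc.tendsto 0).comp h1).const_mul (a m)
  rw [hφ1, mul_one] at h2
  refine h2.congr' ?_
  filter_upwards [eventually_gt_atTop (lam.val m)] with y hy
  simp only [lam.strictMono.injective.eq_iff, mul_ite, mul_one, mul_zero, Finset.sum_ite_eq',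
    Frequency.mem_below, hy, if_true, Function.comp_apply]

theorem IsRieszGerm.hasBohrCoeff_zero (h : IsRieszGerm lam a f)
    (hF : DifferentiableOn ℂ (extendByZero f) {s : ℂ | 0 < s.re}) {B : ℝ}
    (hB : ∀ s : ℂ, 0 < s.re → ‖extendByZero f s‖ ≤ B) {ξ : ℝ} (hξ : ξ ∉ Set.range lam.val) :
    HasBohrCoeff f ξ 0 := by
  refine h.hasBohrCoeff hF hB fun φ _ _ => tendsto_const_nhds.congr fun y => ?_
  refine (Finset.sum_eq_zero fun n _ => ?_).symm
  rw [if_neg fun e => hξ ⟨n, e⟩, mul_zero]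

theorem HasBohrCoeff.unique {x : ℝ} {c d : ℂ} (hc : HasBohrCoeff f x c) (hd : HasBohrCoeff f x d) :
    c = d := tendsto_nhds_unique (hc 1 one_pos) (hd 1 one_pos)

end

end

theorem mainTheorem9 (lam : Frequency) :
    HInftyOrder lam 0 = HInfty lam ∧
    (∀ f ∈ HInftyOrder lam 0, orderNorm 0 f = supNorm f) ∧
    (∀ f ∈ HInftyOrder lam 0,
      (∃! a : ℕ → ℂ, IsRieszGerm lam a f) ∧
      ∀ a : ℕ → ℂ, IsRieszGerm lam a f → ∀ n : ℕ, HasBohrCoeff f (lam.val n) (a n)) := by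
  have hbdd : ∀ f ∈ HInftyOrder lam 0, BddAbove (Set.range fun s : RightHalfPlane => ‖f s‖) :=
    fun f hf => by simpa using hf.2.2
  have hcoeff : ∀ f ∈ HInftyOrder lam 0, ∀ a : ℕ → ℂ, IsRieszGerm lam a f → ∀ n : ℕ,
      HasBohrCoeff f (lam.val n) (a n) := fun f hf a ha n => by
    obtain ⟨B, hB⟩ := bounded_extendByZero (hbdd f hf)
    exact ha.hasBohrCoeff_val hf.1 hB n
  refine ⟨Set.Subset.antisymm (fun f hf => ?_) fun f hf => ?_, fun f _ => ?_, fun f hf =>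
    ⟨?_, hcoeff f hf⟩⟩
  · obtain ⟨B, hB⟩ := bounded_extendByZero (hbdd f hf)
    obtain ⟨a, ha⟩ := hf.2.1
    refine ⟨hf.1, hbdd f hf, fun σ hσ => ?_, fun ξ hξ => ha.hasBohrCoeff_zero hf.1 hB hξ⟩
    simpa only [extendByZero_line f hσ] using ha.uniformlyAlmostPeriodic hf.1 hB hσ
  · exact ⟨hf.1, exists_isRieszGerm_of_mem_HInfty hf, by simpa using hf.2.1⟩
  -- For ℓ = 0 the weight (1 + |s|)^0 is 1, so the norms agree by definition.
  · simp [orderNorm, supNorm]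
  · obtain ⟨a, ha⟩ := hf.2.1
    exact ⟨a, ha, fun b hb => funext fun n =>
      (hcoeff f hf b hb n).unique (hcoeff f hf a ha n)⟩
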